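/- Let $\mathbb{k}$ be a field of characteristic $0$ and let $r,s\ge 0$ be integers with $2s\le r$. Let $B\in M_r(\mathbb{k})$ be the antisymmetric matrix with $B_{2p-1,2p}=1$, $B_{2p,2p-1}=-1$ for $1\le p\le s$ and all other entries $0$, and let $\mathfrak{so}(B)=\{M\in M_r(\mathbb{k}) : MB=-BM^T\}$, a Lie algebra under the commutator of matrices, with a fixed $\mathbb{k}$-basis $b$. The umbrella Hopf algebra $H=\mathrm{UM}(r,2s)$ is the algebra generated by $x_0,\dots,x_r$, $y_1,\dots,y_r$ and the elements of $b$, with relations: $x_0$ is central; $[x_i,x_j]=B_{ij}x_0$, $[y_i,y_j]=\tfrac13B_{ij}x_0^3$, $[x_i,y_j]=0$, $[x_i,M]=\sum_{l=1}^r M_{il}x_l$, $[y_i,M]=\sum_{l=1}^r M_{il}y_l$ for $1\le i,j\le r$, $M\in b$; and, for $M,N\in b$, $[M,N]$ equals the commutator of the matrices $M,N$ expanded in $b$. The $x_i$ and the $M\in b$ are primitive, $\Delta y_i=y_i\otimes1+1\otimes y_i+x_0\otimes x_i-x_i\otimes x_0$, $\varepsilon(y_i)=0$ and $S(y_i)=-y_i$.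 For Hopf algebras $K,J$, a weak action $\gamma:J\otimes K\to K$, a weak coaction $\rho:J\to J\otimes K$, a cocycle $\sigma:J\otimes J\to K$ and a co-cocycle $\tau:J\to K\otimes K$, the crossed product $K^\tau\#_\sigma J$ is the vector space $K\otimes J$ with unit $1\#1$, counit $\varepsilon\#\varepsilon$, product $(h\#a)(g\#c)=h\,\gamma(a_1,g)\,\sigma(a_2,c_1)\#a_3c_2$ and coproduct $\Delta(h\#a)=(h_1\tau(a_1)^{(1)}\#\rho(a_2)^{(1)})\otimes(h_2\tau(a_1)^{(2)}\rho(a_2)^{(2)}\#a_3)$, provided that it is a Hopf algebra (its antipode is then determined). Trivial data are $\gamma(a,g)=\varepsilon(a)g$, $\rho(a)=a\otimes1$, $\sigma(a,c)=\varepsilon(a)\varepsilon(c)1$, $\tau(a)=\varepsilon(a)1\otimes1$; data that are not mentioned below are trivial. Let $\mathfrak{L}$ be the Lie algebra with basis $x_0,\dots,x_r$, with $x_0$ central and $[x_i,x_j]=B_{ij}x_0$, and let $Y$ be the abelian Lie algebra with basis $\overline{y_1},\dots,\overline{y_r}$. Then there are crossed products of Hopf algebras $U(\mathfrak{L})^\tau\#_\sigma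 U(Y)$ and $(U(\mathfrak{L})^\tau\#_\sigma U(Y))\#U(\mathfrak{so}(B))$ and an isomorphism of Hopf algebras $$H\cong\bigl(U(\mathfrak{L})^\tau\#_\sigma U(Y)\bigr)\#U(\mathfrak{so}(B)),\qquad x_i\mapsto (x_i\#1)\#1,\quad y_i\mapsto(1\#\overline{y_i})\#1,\quad M\mapsto 1\#M\ (M\in b),$$ such that $U(Y)$ acts trivially on $U(\mathfrak{L})$, $$\sigma(\overline{y_i},\overline{y_j})=\begin{cases}-\tfrac13x_0^3,& i=2p,\ j=2p-1\text{ for some }1\le p\le s,\\0,&\text{otherwise,}\end{cases}\qquad \tau(\overline{y_i})=x_0\otimes x_i-x_i\otimes x_0,$$ and $U(\mathfrak{so}(B))$ acts on $U(\mathfrak{L})^\tau\#_\sigma U(Y)$ by an action (a weak action that is also a module structure) with, for all $M\in\mathfrak{so}(B)$ and $1\le i,j\le r$, $$M\rightharpoonup(x_i\#\overline{y_j})=\sum_{l=1}^r\bigl(-M_{il}x_l\#\overline{y_j}-x_i\#M_{jl}\overline{y_l}\bigr),$$ $$M\rightharpoonup(x_0\#1)=0,\qquad M\rightharpoonup(x_i\#1)=-\sum_{l=1}^r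 M_{il}x_l\#1,\qquad M\rightharpoonup(1\#\overline{y_j})=-\sum_{l=1}^r 1\#M_{jl}\overline{y_l}.$$ -/

import Mathlib

open scoped TensorProduct

namespace Umbrella

universe u v w

/-! ### Antipodes of bialgebras given on generators -/

section Antipode

variable {k : Type u} [CommRing k] {A : Type v} [Ring A] [Bialgebra k A]

/-- The elements on which an anti-multiplicative linear map `S` satisfies both antipode
identities form a subalgebra. -/
def antipodeSubalgebra (S : A →ₐ[k] Aᵐᵒᵖ) : Subalgebra k A where
  carrier := {a |
    LinearMap.mul' k A ((((MulOpposite.opLinearEquiv k).symm.toLinearMap ∘ₗ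
      S.toLinearMap).rTensor A) (Coalgebra.comul a)) = algebraMap k A (Coalgebra.counit a) ∧
    LinearMap.mul' k A ((((MulOpposite.opLinearEquiv k).symm.toLinearMap ∘ₗ
      S.toLinearMap).lTensor A) (Coalgebra.comul a)) = algebraMap k A (Coalgebra.counit a)}
  mul_mem' := by
    rintro a b ⟨ha, ha'⟩ ⟨hb, hb'⟩
    set T : A →ₗ[k] A := (MulOpposite.opLinearEquiv k).symm.toLinearMap ∘ₗ S.toLinearMap with hT
    have hTm : ∀ p q, T (p * q) = T q * T p := by intro p q; simp [hT]
    constructor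
    · have key : ∀ (c : k) (p q : A ⊗[k] A),
          LinearMap.mul' k A (T.rTensor A p) = algebraMap k A c →
          LinearMap.mul' k A (T.rTensor A (p * q)) =
            algebraMap k A c * LinearMap.mul' k A (T.rTensor A q) := by
        intro c p q hp
        induction q with
        | zero => simp
        | add q₁ q₂ h₁ h₂ => rw [mul_add, map_add, map_add, h₁, h₂, map_add, map_add, mul_add]
        | tmul d e =>
          have : LinearMap.mul' k A (T.rTensor A (p * d ⊗ₜ[k] e)) =
              T d * LinearMap.mul' k A (T.rTensor A p) * e := by
            clear hp
            induction p with
            | zero => simp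
            | add p₁ p₂ h₁ h₂ =>
              rw [add_mul, map_add, map_add, h₁, h₂, map_add, map_add, mul_add, add_mul]
            | tmul f g => simp [hTm, mul_assoc]
          rw [this, hp]
          simp only [LinearMap.rTensor_tmul, LinearMap.mul'_apply]
          rw [← Algebra.commutes, mul_assoc]
      rw [Bialgebra.comul_mul, key _ _ _ ha, hb, Bialgebra.counit_mul, map_mul]
    · have key : ∀ (c : k) (p q : A ⊗[k] A),
          LinearMap.mul' k A (T.lTensor A q) = algebraMap k A c →
          LinearMap.mul' k A (T.lTensor A (p * q)) =
            algebraMap k A c * LinearMap.mul' k A (T.lTensor A p) := by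
        intro c p q hq
        induction p with
        | zero => simp
        | add q₁ q₂ h₁ h₂ => rw [add_mul, map_add, map_add, h₁, h₂, map_add, map_add, mul_add]
        | tmul d e =>
          have : LinearMap.mul' k A (T.lTensor A (d ⊗ₜ[k] e * q)) =
              d * LinearMap.mul' k A (T.lTensor A q) * T e := by
            clear hq
            induction q with
            | zero => simp
            | add p₁ p₂ h₁ h₂ =>
              rw [mul_add, map_add, map_add, h₁, h₂, map_add, map_add, mul_add, add_mul]
            | tmul f g => simp [hTm, mul_assoc]
          rw [this, hq]
          simp only [LinearMap.lTensor_tmul, LinearMap.mul'_apply]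
          rw [← Algebra.commutes, mul_assoc]
      rw [Bialgebra.comul_mul, key _ _ _ hb', ha', Bialgebra.counit_mul, map_mul,
        ← map_mul, mul_comm, map_mul]
  add_mem' := by
    rintro a b ⟨ha, ha'⟩ ⟨hb, hb'⟩
    constructor
    · simp only [map_add, ha, hb]
    · simp only [map_add, ha', hb']
  algebraMap_mem' := by
    intro c
    constructor <;> simp [Bialgebra.comul_algebraMap, Algebra.TensorProduct.algebraMap_apply]

/-- A bialgebra with an algebra map `S : A → Aᵐᵒᵖ` satisfying the antipode identities on a
generating set is a Hopf algebra with antipode `S`. -/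
noncomputable abbrev hopfOfAntipode (S : A →ₐ[k] Aᵐᵒᵖ) (h : antipodeSubalgebra S = ⊤) :
    HopfAlgebra k A where
  antipode := (MulOpposite.opLinearEquiv k).symm.toLinearMap ∘ₗ S.toLinearMap
  mul_antipode_rTensor_comul := by
    ext a
    have ha : a ∈ antipodeSubalgebra S := by rw [h]; trivial
    exact ha.1
  mul_antipode_lTensor_comul := by
    ext a
    have ha : a ∈ antipodeSubalgebra S := by rw [h]; trivial
    exact ha.2

end Antipode

/-! ### The Hopf algebra structure of an enveloping algebra -/

section Enveloping

attribute [local instance 100] LieRing.ofAssociativeRing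

variable (k : Type u) [CommRing k] (L : Type v) [LieRing L] [LieAlgebra k L]

local notation "U" => UniversalEnvelopingAlgebra k L

/-- The comultiplication, for which all elements of `L` are primitive. -/
noncomputable def envComul : U →ₐ[k] U ⊗[k] U :=
  UniversalEnvelopingAlgebra.lift k
    { toFun := fun x => UniversalEnvelopingAlgebra.ι k x ⊗ₜ[k] 1 +
        1 ⊗ₜ[k] UniversalEnvelopingAlgebra.ι k x
      map_add' := by intro x y; simp only [map_add, TensorProduct.add_tmul, TensorProduct.tmul_add]; abel
      map_smul' := by intro c x; simp [TensorProduct.smul_tmul']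
      map_lie' := by
        intro x y
        simp only [LieHom.map_lie, LieRing.of_associative_ring_bracket, mul_add, add_mul,
          Algebra.TensorProduct.tmul_mul_tmul, mul_one, one_mul, TensorProduct.sub_tmul,
          TensorProduct.tmul_sub]
        abel }

/-- The counit, which vanishes on `L`. -/
noncomputable def envCounit : U →ₐ[k] k :=
  UniversalEnvelopingAlgebra.lift k (0 : L →ₗ⁅k⁆ k)

/-- The antipode, which is `-1` on `L`. -/
noncomputable def envAntipode : U →ₐ[k] Uᵐᵒᵖ :=
  UniversalEnvelopingAlgebra.lift k
    { toFun := fun x => MulOpposite.op (-UniversalEnvelopingAlgebra.ι k x)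
      map_add' := by intro x y; simp only [map_add, neg_add, MulOpposite.op_add]
      map_smul' := by intro c x; simp
      map_lie' := by
        intro x y
        simp only [LieHom.map_lie, LieRing.of_associative_ring_bracket, ← MulOpposite.op_mul,
          ← MulOpposite.op_sub]
        congr 1
        noncomm_ring }

variable {k L} in
theorem envComul_ι (x : L) : envComul k L (UniversalEnvelopingAlgebra.ι k x) =
    UniversalEnvelopingAlgebra.ι k x ⊗ₜ[k] 1 + 1 ⊗ₜ[k] UniversalEnvelopingAlgebra.ι k x := by
  unfold envComul; rw [UniversalEnvelopingAlgebra.lift_ι_apply]; rfl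

variable {k L} in
theorem envCounit_ι (x : L) : envCounit k L (UniversalEnvelopingAlgebra.ι k x) = 0 := by
  unfold envCounit; rw [UniversalEnvelopingAlgebra.lift_ι_apply]; rfl

variable {k L} in
theorem envAntipode_ι (x : L) : envAntipode k L (UniversalEnvelopingAlgebra.ι k x) =
    MulOpposite.op (-UniversalEnvelopingAlgebra.ι k x) := by
  unfold envAntipode; rw [UniversalEnvelopingAlgebra.lift_ι_apply]; rfl

variable {k L} in
theorem env_hom_ext {B : Type w} [Ring B] [Algebra k B] {f g : U →ₐ[k] B}
    (h : ∀ x : L, f (UniversalEnvelopingAlgebra.ι k x) = g (UniversalEnvelopingAlgebra.ι k x)) :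
    f = g := by
  apply UniversalEnvelopingAlgebra.hom_ext
  ext x
  exact h x

noncomputable instance envBialgebra : Bialgebra k U :=
  .ofAlgHom (envComul k L) (envCounit k L)
    (by
      apply env_hom_ext; intro x
      simp [-UniversalEnvelopingAlgebra.ι_apply, envComul_ι, Algebra.TensorProduct.one_def, TensorProduct.add_tmul,
        TensorProduct.tmul_add]
      abel)
    (by apply env_hom_ext; intro x; simp [-UniversalEnvelopingAlgebra.ι_apply, envComul_ι, envCounit_ι])
    (by apply env_hom_ext; intro x; simp [-UniversalEnvelopingAlgebra.ι_apply, envComul_ι, envCounit_ι])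

theorem env_subalgebra_eq_top (S : Subalgebra k U)
    (h : ∀ x : L, UniversalEnvelopingAlgebra.ι k x ∈ S) : S = ⊤ := by
  let f : U →ₐ[k] S := UniversalEnvelopingAlgebra.lift k
    { toFun := fun x => ⟨UniversalEnvelopingAlgebra.ι k x, h x⟩
      map_add' := by intro x y; ext; simp
      map_smul' := by intro c x; ext; simp
      map_lie' := by intro x y; ext; simp [LieRing.of_associative_ring_bracket] }
  have hf : S.val.comp f = AlgHom.id k U := by
    apply env_hom_ext; intro x
    simp only [AlgHom.comp_apply, f, UniversalEnvelopingAlgebra.lift_ι_apply]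
    rfl
  rw [eq_top_iff]
  intro a _
  have := AlgHom.congr_fun hf a
  simp only [AlgHom.comp_apply, AlgHom.id_apply] at this
  rw [← this]
  exact (f a).2

noncomputable instance envHopfAlgebra : HopfAlgebra k U :=
  hopfOfAntipode (envAntipode k L) (env_subalgebra_eq_top k L _ (by
    intro x
    have h1 : (Coalgebra.comul (UniversalEnvelopingAlgebra.ι k x) : U ⊗[k] U) =
      UniversalEnvelopingAlgebra.ι k x ⊗ₜ[k] 1 + 1 ⊗ₜ[k] UniversalEnvelopingAlgebra.ι k x :=
      envComul_ι x
    have h2 : Coalgebra.counit (R := k) (UniversalEnvelopingAlgebra.ι k x : U) = 0 :=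
      envCounit_ι x
    constructor
    · rw [h1, h2]; simp [-UniversalEnvelopingAlgebra.ι_apply, envAntipode_ι]
    · rw [h1, h2]; simp [-UniversalEnvelopingAlgebra.ι_apply, envAntipode_ι]))

end Enveloping

/-! ### The Lie algebra `𝔰𝔬(A)` -/

section So

variable {k : Type u} [Field k] {r : ℕ}

/-- The space of matrices `M` with `M A = - A Mᵀ`. -/
def so (A : Matrix (Fin r) (Fin r) k) : Submodule k (Matrix (Fin r) (Fin r) k) where
  carrier := {M | M * A = -(A * M.transpose)}
  add_mem' := by
    intro M N hM hN
    simp only [Set.mem_ofPred_eq] at hM hN ⊢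
    rw [add_mul, hM, hN, Matrix.transpose_add, mul_add, neg_add]
  zero_mem' := by simp
  smul_mem' := by
    intro c M hM
    simp only [Set.mem_ofPred_eq] at hM ⊢
    simp [hM]

theorem mem_so {A M : Matrix (Fin r) (Fin r) k} : M ∈ so A ↔ M * A = -(A * M.transpose) :=
  Iff.rfl

theorem commutator_mem_so {A M N : Matrix (Fin r) (Fin r) k} (hM : M ∈ so A) (hN : N ∈ so A) :
    M * N - N * M ∈ so A := by
  rw [mem_so] at *
  rw [sub_mul, mul_assoc, mul_assoc, hM, hN, mul_neg, mul_neg, ← mul_assoc, ← mul_assoc, hM, hN,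
    Matrix.transpose_sub, Matrix.transpose_mul, Matrix.transpose_mul]
  noncomm_ring

/-- `𝔰𝔬(A)` is a Lie algebra under the commutator of matrices. -/
instance soLieRing (A : Matrix (Fin r) (Fin r) k) : LieRing (so A) where
  bracket M N := ⟨M.1 * N.1 - N.1 * M.1, commutator_mem_so M.2 N.2⟩
  add_lie := by
    rintro ⟨x, hx⟩ ⟨y, hy⟩ ⟨z, hz⟩; apply Subtype.ext
    change (x + y) * z - z * (x + y) = (x * z - z * x) + (y * z - z * y); noncomm_ring
  lie_add := by
    rintro ⟨x, hx⟩ ⟨y, hy⟩ ⟨z, hz⟩; apply Subtype.ext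
    change x * (y + z) - (y + z) * x = (x * y - y * x) + (x * z - z * x); noncomm_ring
  lie_self := by rintro ⟨x, hx⟩; apply Subtype.ext; change x * x - x * x = 0; simp
  leibniz_lie := by
    rintro ⟨x, hx⟩ ⟨y, hy⟩ ⟨z, hz⟩; apply Subtype.ext
    change x * (y * z - z * y) - (y * z - z * y) * x =
      ((x * y - y * x) * z - z * (x * y - y * x)) + (y * (x * z - z * x) - (x * z - z * x) * y)
    noncomm_ring

instance soLieAlgebra (A : Matrix (Fin r) (Fin r) k) : LieAlgebra k (so A) where
  lie_smul := by
    rintro c ⟨x, hx⟩ ⟨y, hy⟩; apply Subtype.ext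
    change x * (c • y) - (c • y) * x = c • (x * y - y * x)
    simp [smul_sub]

end So

/-! ### The Hopf algebra `UM(A)` -/

section UM

/-- The generators: `x₀`, `x₁, …, x_r`, `y₁, …, y_r`, and one for each element of a basis
(indexed by `ι`) of `𝔰𝔬(A)`. The indices `1, …, r` are represented by `Fin r`. -/
inductive Gen (r : ℕ) (ι : Type v) : Type v
  | x₀ : Gen r ι
  | x (i : Fin r) : Gen r ι
  | y (i : Fin r) : Gen r ι
  | m (j : ι) : Gen r ι

variable {k : Type u} [Field k] {r : ℕ} {ι : Type v}

local notation "F" => FreeAlgebra.ι k (X := Gen r ι)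

/-- The defining relations of `UM(A)`. -/
inductive UMRel (A : Matrix (Fin r) (Fin r) k) (b : Module.Basis ι k (so A)) :
    FreeAlgebra k (Gen r ι) → FreeAlgebra k (Gen r ι) → Prop
  | x₀_central (g : Gen r ι) : UMRel A b (F .x₀ * F g - F g * F .x₀) 0
  | xx (i j : Fin r) : UMRel A b (F (.x i) * F (.x j) - F (.x j) * F (.x i)) (A i j • F .x₀)
  | yy (i j : Fin r) :
      UMRel A b (F (.y i) * F (.y j) - F (.y j) * F (.y i)) ((1 / 3 * A i j : k) • F .x₀ ^ 3)
  | xy (i j : Fin r) : UMRel A b (F (.x i) * F (.y j) - F (.y j) * F (.x i)) 0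
  | xm (i : Fin r) (j : ι) :
      UMRel A b (F (.x i) * F (.m j) - F (.m j) * F (.x i)) (∑ l, (b j).1 i l • F (.x l))
  | ym (i : Fin r) (j : ι) :
      UMRel A b (F (.y i) * F (.m j) - F (.m j) * F (.y i)) (∑ l, (b j).1 i l • F (.y l))
  | mm (i j : ι) :
      UMRel A b (F (.m i) * F (.m j) - F (.m j) * F (.m i))
        (Finsupp.linearCombination k (fun l => F (.m l)) (b.repr ⁅b i, b j⁆))

/-- The algebra `UM(A)`, presented by means of the basis `b` of `𝔰𝔬(A)`. -/
def UM (A : Matrix (Fin r) (Fin r) k) (b : Module.Basis ι k (so A)) : Type (max u v) :=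
  RingQuot (UMRel A b)

namespace UM

variable (A : Matrix (Fin r) (Fin r) k) (b : Module.Basis ι k (so A))

noncomputable instance : Ring (UM A b) := inferInstanceAs (Ring (RingQuot (UMRel A b)))

noncomputable instance : Algebra k (UM A b) :=
  inferInstanceAs (Algebra k (RingQuot (UMRel A b)))

/-- The images of the generators in `UM(A)`. -/
noncomputable def gen (g : Gen r ι) : UM A b :=
  RingQuot.mkAlgHom k (UMRel A b) (FreeAlgebra.ι k g)

variable {A b} in
theorem hom_ext {B : Type w} [Semiring B] [Algebra k B] {f g : UM A b →ₐ[k] B}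
    (h : ∀ z, f (gen A b z) = g (gen A b z)) : f = g := by
  refine RingQuot.ringQuot_ext' (S := k) (f := f) (g := g) ?_
  ext z
  exact h z

/-- A family of elements of an algebra satisfies the defining relations of `UM(A)`. -/
structure SatisfiesRel {B : Type w} [Ring B] [Algebra k B] (f : Gen r ι → B) : Prop where
  x₀_central : ∀ g, f .x₀ * f g - f g * f .x₀ = 0
  xx : ∀ i j, f (.x i) * f (.x j) - f (.x j) * f (.x i) = A i j • f .x₀
  yy : ∀ i j, f (.y i) * f (.y j) - f (.y j) * f (.y i) = (1 / 3 * A i j : k) • f .x₀ ^ 3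
  xy : ∀ i j, f (.x i) * f (.y j) - f (.y j) * f (.x i) = 0
  xm : ∀ i j, f (.x i) * f (.m j) - f (.m j) * f (.x i) = ∑ l, (b j).1 i l • f (.x l)
  ym : ∀ i j, f (.y i) * f (.m j) - f (.m j) * f (.y i) = ∑ l, (b j).1 i l • f (.y l)
  mm : ∀ i j, f (.m i) * f (.m j) - f (.m j) * f (.m i) =
    Finsupp.linearCombination k (fun l => f (.m l)) (b.repr ⁅b i, b j⁆)

theorem satisfiesRel_gen : SatisfiesRel A b (gen A b) := by
  have key : ∀ {p q}, UMRel A b p q →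
      RingQuot.mkAlgHom k (UMRel A b) p = RingQuot.mkAlgHom k (UMRel A b) q :=
    fun h => RingQuot.mkAlgHom_rel k h
  constructor
  · intro g; simpa [gen] using! key (.x₀_central g)
  · intro i j; simpa [gen] using! key (.xx i j)
  · intro i j; simpa [gen] using! key (.yy i j)
  · intro i j; simpa [gen] using! key (.xy i j)
  · intro i j; simpa [gen] using! key (.xm i j)
  · intro i j; simpa [gen] using! key (.ym i j)
  · intro i j
    have := key (.mm i j)
    simp only [map_sub, map_mul, Finsupp.linearCombination_apply, Finsupp.sum, map_sum,
      map_smul] at this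
    simpa [gen, Finsupp.linearCombination_apply, Finsupp.sum] using! this

variable {A b} in
/-- The universal property of `UM(A)`. -/
noncomputable def lift {B : Type w} [Ring B] [Algebra k B] (f : Gen r ι → B)
    (hf : SatisfiesRel A b f) : UM A b →ₐ[k] B :=
  RingQuot.liftAlgHom k ⟨FreeAlgebra.lift k f, by
    intro p q h
    induction h with
    | x₀_central g => simpa using hf.x₀_central g
    | xx i j => simpa using hf.xx i j
    | yy i j => simpa using hf.yy i j
    | xy i j => simpa using hf.xy i j
    | xm i j => simpa using hf.xm i j
    | ym i j => simpa using hf.ym i j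
    | mm i j =>
      simpa [Finsupp.linearCombination_apply, Finsupp.sum] using hf.mm i j⟩

variable {A b} in
theorem lift_gen {B : Type w} [Ring B] [Algebra k B] (f : Gen r ι → B)
    (hf : SatisfiesRel A b f) (g : Gen r ι) : lift f hf (gen A b g) = f g := by
  unfold lift gen
  refine (RingQuot.liftAlgHom_mkAlgHom_apply k _ _ _).trans ?_
  simp

/-- The comultiplication on the generators: `x₀`, `xᵢ` and the elements of `𝔰𝔬(A)` are primitive,
and `Δ yᵢ = yᵢ ⊗ 1 + 1 ⊗ yᵢ + x₀ ⊗ xᵢ - xᵢ ⊗ x₀`. -/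
noncomputable def comulGen : Gen r ι → UM A b ⊗[k] UM A b
  | .x₀ => gen A b .x₀ ⊗ₜ 1 + 1 ⊗ₜ gen A b .x₀
  | .x i => gen A b (.x i) ⊗ₜ 1 + 1 ⊗ₜ gen A b (.x i)
  | .y i => gen A b (.y i) ⊗ₜ 1 + 1 ⊗ₜ gen A b (.y i) +
      gen A b .x₀ ⊗ₜ gen A b (.x i) - gen A b (.x i) ⊗ₜ gen A b .x₀
  | .m j => gen A b (.m j) ⊗ₜ 1 + 1 ⊗ₜ gen A b (.m j)

/-- The antipode on the generators. -/
noncomputable def antipodeGen (g : Gen r ι) : (UM A b)ᵐᵒᵖ := MulOpposite.op (-gen A b g)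

variable {A b} in
theorem prim_comm (p q : UM A b) :
    (p ⊗ₜ[k] (1 : UM A b) + (1 : UM A b) ⊗ₜ[k] p) * (q ⊗ₜ 1 + 1 ⊗ₜ q) -
      (q ⊗ₜ 1 + 1 ⊗ₜ q) * (p ⊗ₜ 1 + 1 ⊗ₜ p) =
    (p * q - q * p) ⊗ₜ 1 + 1 ⊗ₜ (p * q - q * p) := by
  simp only [mul_add, add_mul, Algebra.TensorProduct.tmul_mul_tmul, mul_one, one_mul,
    TensorProduct.sub_tmul, TensorProduct.tmul_sub]
  abel

variable {A b} in
theorem tens_comm (p s t : UM A b) :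
    (p ⊗ₜ[k] (1 : UM A b) + (1 : UM A b) ⊗ₜ[k] p) * (s ⊗ₜ t) -
      (s ⊗ₜ t) * (p ⊗ₜ 1 + 1 ⊗ₜ p) =
    (p * s - s * p) ⊗ₜ t + s ⊗ₜ (p * t - t * p) := by
  simp only [mul_add, add_mul, Algebra.TensorProduct.tmul_mul_tmul, mul_one, one_mul,
    TensorProduct.sub_tmul, TensorProduct.tmul_sub]
  abel

theorem satisfiesRel_antipodeGen : SatisfiesRel A b (antipodeGen A b) := by
  have R := satisfiesRel_gen A b
  have key : ∀ g h : Gen r ι, antipodeGen A b g * antipodeGen A b h -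
      antipodeGen A b h * antipodeGen A b g =
      MulOpposite.op (-(gen A b g * gen A b h - gen A b h * gen A b g)) := by
    intro g h
    simp only [antipodeGen, ← MulOpposite.op_mul, ← MulOpposite.op_sub]
    congr 1
    noncomm_ring
  constructor
  · intro g; rw [key, R.x₀_central]; simp
  · intro i j; rw [key, R.xx]; simp [antipodeGen]
  · intro i j; rw [key, R.yy]
    simp only [antipodeGen, ← MulOpposite.op_pow, ← MulOpposite.op_smul]
    congr 1
    rw [Odd.neg_pow (by decide), smul_neg]
  · intro i j; rw [key, R.xy]; simp
  · intro i j; rw [key, R.xm]; simp [antipodeGen]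
  · intro i j; rw [key, R.ym]; simp [antipodeGen]
  · intro i j; rw [key, R.mm]; simp [antipodeGen, Finsupp.linearCombination_apply, Finsupp.sum]

/-- The counit of `UM(A)`, which vanishes on the generators. -/
noncomputable def counitHom : UM A b →ₐ[k] k :=
  lift (fun _ => 0) (by constructor <;> simp [Finsupp.linearCombination_apply, Finsupp.sum])

/-- The antipode of `UM(A)`, as an algebra map to the opposite algebra. -/
noncomputable def antipodeHom : UM A b →ₐ[k] (UM A b)ᵐᵒᵖ :=
  lift (antipodeGen A b) (satisfiesRel_antipodeGen A b)

@[simp] theorem counitHom_gen (g : Gen r ι) : counitHom A b (gen A b g) = 0 :=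
  lift_gen _ _ g

@[simp] theorem antipodeHom_gen (g : Gen r ι) :
    antipodeHom A b (gen A b g) = MulOpposite.op (-gen A b g) :=
  lift_gen _ _ g

theorem subalgebra_eq_top (S : Subalgebra k (UM A b)) (h : ∀ g, gen A b g ∈ S) : S = ⊤ := by
  have R := satisfiesRel_gen A b
  let f : UM A b →ₐ[k] S := lift (fun g => ⟨gen A b g, h g⟩) (by
    constructor
    · intro g; ext; simpa using R.x₀_central g
    · intro i j; ext; simpa using R.xx i j
    · intro i j; ext; simpa using R.yy i j
    · intro i j; ext; simpa using R.xy i j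
    · intro i j; ext; simpa using R.xm i j
    · intro i j; ext; simpa using R.ym i j
    · intro i j; ext
      simpa [Finsupp.linearCombination_apply, Finsupp.sum] using R.mm i j)
  have hf : S.val.comp f = AlgHom.id k (UM A b) := by
    apply hom_ext; intro g
    simp [f, lift_gen]
  rw [eq_top_iff]
  intro a _
  have := AlgHom.congr_fun hf a
  simp only [AlgHom.comp_apply, AlgHom.id_apply] at this
  rw [← this]
  exact (f a).2

variable [CharZero k]

theorem satisfiesRel_comulGen : SatisfiesRel A b (comulGen A b) := by
  have R := satisfiesRel_gen A b
  have hy : ∀ (g : Gen r ι) (j : Fin r),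
      (gen A b g ⊗ₜ[k] (1 : UM A b) + (1 : UM A b) ⊗ₜ[k] gen A b g) * comulGen A b (.y j) -
        comulGen A b (.y j) * (gen A b g ⊗ₜ[k] (1 : UM A b) + (1 : UM A b) ⊗ₜ[k] gen A b g) =
      ((gen A b g * gen A b (.y j) - gen A b (.y j) * gen A b g) ⊗ₜ 1 +
        1 ⊗ₜ (gen A b g * gen A b (.y j) - gen A b (.y j) * gen A b g)) +
      ((gen A b g * gen A b .x₀ - gen A b .x₀ * gen A b g) ⊗ₜ gen A b (.x j) +
        gen A b .x₀ ⊗ₜ (gen A b g * gen A b (.x j) - gen A b (.x j) * gen A b g)) -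
      ((gen A b g * gen A b (.x j) - gen A b (.x j) * gen A b g) ⊗ₜ gen A b .x₀ +
        gen A b (.x j) ⊗ₜ (gen A b g * gen A b .x₀ - gen A b .x₀ * gen A b g)) := by
    intro g j
    rw [← prim_comm, ← tens_comm, ← tens_comm]
    simp only [comulGen]
    noncomm_ring
  have h0 : ∀ g, gen A b g * gen A b .x₀ - gen A b .x₀ * gen A b g = 0 := by
    intro g; rw [← neg_sub, R.x₀_central, neg_zero]
  constructor
  · rintro (_ | i | i | j)
    · simp
    · simp only [comulGen]; rw [prim_comm, R.x₀_central]; simp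
    · refine (hy .x₀ i).trans ?_
      simp only [R.x₀_central]; simp
    · simp only [comulGen]; rw [prim_comm, R.x₀_central]; simp
  · intro i j
    simp only [comulGen]; rw [prim_comm, R.xx]
    simp [TensorProduct.smul_tmul']
  · intro i j
    have e0 : ∀ g, gen A b g * gen A b .x₀ = gen A b .x₀ * gen A b g :=
      fun g => sub_eq_zero.1 (h0 g)
    have exy : ∀ i j, gen A b (.y j) * gen A b (.x i) = gen A b (.x i) * gen A b (.y j) :=
      fun i j => (sub_eq_zero.1 (R.xy i j)).symm
    have exx := R.xx i j
    rw [sub_eq_iff_eq_add] at exx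
    have eyy := R.yy i j
    rw [sub_eq_iff_eq_add] at eyy
    simp only [comulGen, pow_succ, pow_zero, mul_add, add_mul, mul_sub, sub_mul,
      Algebra.TensorProduct.tmul_mul_tmul, mul_one, one_mul, e0 (.x _), e0 (.y _), exy, exx, eyy,
      TensorProduct.add_tmul, TensorProduct.tmul_add, ← TensorProduct.smul_tmul',
      TensorProduct.tmul_smul, smul_add, mul_assoc]
    match_scalars <;> field_simp <;> ring
  · intro i j
    refine (hy (.x i) j).trans ?_
    simp only [R.xx, R.xy, h0]
    simp [TensorProduct.smul_tmul']
  · intro i j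
    simp only [comulGen]; rw [prim_comm, R.xm]
    simp [TensorProduct.sum_tmul, TensorProduct.tmul_sum, TensorProduct.smul_tmul',
      Finset.sum_add_distrib]
  · intro i j
    have ex := R.xm i j
    have ey := R.ym i j
    rw [← neg_sub, neg_eq_iff_eq_neg] at ex ey
    refine Eq.trans (neg_sub _ _).symm ?_
    rw [neg_eq_iff_eq_neg]
    refine (hy (.m j) i).trans ?_
    rw [ex, ey, h0]
    simp only [comulGen, TensorProduct.neg_tmul, TensorProduct.tmul_neg, TensorProduct.sum_tmul,
      TensorProduct.tmul_sum, TensorProduct.smul_tmul', TensorProduct.tmul_smul, smul_add,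
      smul_sub, Finset.sum_add_distrib, Finset.sum_sub_distrib, TensorProduct.zero_tmul,
      TensorProduct.tmul_zero]
    abel
  · intro i j
    simp only [comulGen]; rw [prim_comm, R.mm]
    simp [Finsupp.linearCombination_apply, Finsupp.sum, TensorProduct.sum_tmul,
      TensorProduct.tmul_sum, TensorProduct.smul_tmul', Finset.sum_add_distrib]

/-- The comultiplication of `UM(A)`. -/
noncomputable def comulHom : UM A b →ₐ[k] UM A b ⊗[k] UM A b :=
  lift (comulGen A b) (satisfiesRel_comulGen A b)

@[simp] theorem comulHom_gen (g : Gen r ι) : comulHom A b (gen A b g) = comulGen A b g :=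
  lift_gen _ _ g

noncomputable instance : Bialgebra k (UM A b) :=
  .ofAlgHom (comulHom A b) (counitHom A b)
    (by
      apply hom_ext
      rintro (_ | i | i | j) <;>
        simp [comulGen, Algebra.TensorProduct.one_def, TensorProduct.add_tmul,
          TensorProduct.tmul_add, TensorProduct.sub_tmul, TensorProduct.tmul_sub] <;> abel)
    (by apply hom_ext; rintro (_ | i | i | j) <;> simp [comulGen])
    (by apply hom_ext; rintro (_ | i | i | j) <;> simp [comulGen])

/-- The Hopf algebra structure of `UM(A)`. -/
noncomputable instance : HopfAlgebra k (UM A b) :=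
  hopfOfAntipode (antipodeHom A b) (subalgebra_eq_top A b _ (by
    intro g
    have R := satisfiesRel_gen A b
    have h1 : (Coalgebra.comul (gen A b g) : UM A b ⊗[k] UM A b) = comulGen A b g :=
      comulHom_gen A b g
    have h2 : Coalgebra.counit (R := k) (gen A b g) = 0 := counitHom_gen A b g
    have h0 : ∀ g, gen A b .x₀ * gen A b g = gen A b g * gen A b .x₀ :=
      fun g => sub_eq_zero.1 (R.x₀_central g)
    constructor
    · rw [h1, h2]
      rcases g with (_ | i | i | j) <;> simp [comulGen, h0]
    · rw [h1, h2]
      rcases g with (_ | i | i | j) <;> simp [comulGen, h0]))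

end UM

end UM

/-! ### Crossed products of Hopf algebras -/

section Crossed

/-- Linear maps `γ : J ⊗ K → K`, `σ : J ⊗ J → K`, `ρ : J → J ⊗ K` and `τ : J → K ⊗ K`. -/
structure CrossedData (k : Type u) [Field k] (K : Type v) (J : Type w)
    [Ring K] [HopfAlgebra k K] [Ring J] [HopfAlgebra k J] where
  γ : J →ₗ[k] K →ₗ[k] K
  σ : J →ₗ[k] J →ₗ[k] K
  ρ : J →ₗ[k] J ⊗[k] K
  τ : J →ₗ[k] K ⊗[k] K

namespace CrossedData

variable {k : Type u} [Field k] {K : Type v} {J : Type w}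
  [Ring K] [HopfAlgebra k K] [Ring J] [HopfAlgebra k J] (D : CrossedData k K J)

open Coalgebra (comul counit)

/-- `γ` is a weak action of `J` on `K`:
`γ(1, g) = g`, `γ(a, 1) = ε(a) 1` and `γ(a, g h) = γ(a₁, g) γ(a₂, h)`. -/
structure IsWeakAction : Prop where
  one_act : ∀ g, D.γ 1 g = g
  act_one : ∀ a, D.γ a 1 = counit (R := k) a • (1 : K)
  act_mul : ∀ a g h, D.γ a (g * h) =
    LinearMap.mul' k K (TensorProduct.map (D.γ.flip g) (D.γ.flip h) (comul a))

/-- `ρ` is a weak coaction of `K` on `J`: writing `ρ(a) = ρ(a)⁽¹⁾ ⊗ ρ(a)⁽²⁾`,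
`ρ(a)⁽¹⁾ ε(ρ(a)⁽²⁾) = a`, `ε(ρ(a)⁽¹⁾) ρ(a)⁽²⁾ = ε(a) 1`, and
`Δ(ρ(a)⁽¹⁾) ⊗ ρ(a)⁽²⁾ = ρ(a₁)⁽¹⁾ ⊗ ρ(a₂)⁽¹⁾ ⊗ ρ(a₁)⁽²⁾ ρ(a₂)⁽²⁾`. -/
structure IsWeakCoaction : Prop where
  counit_right : ∀ a, TensorProduct.rid k J ((counit (R := k) (A := K)).lTensor J (D.ρ a)) = a
  counit_left : ∀ a, TensorProduct.lid k K ((counit (R := k) (A := J)).rTensor K (D.ρ a)) =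
    counit (R := k) a • (1 : K)
  comul_left : ∀ a, (comul (R := k) (A := J)).rTensor K (D.ρ a) =
    (LinearMap.mul' k K).lTensor (J ⊗[k] J)
      (TensorProduct.tensorTensorTensorComm k J K J K
        (TensorProduct.map D.ρ D.ρ (comul a)))

/-- The bilinear map `(a, b) ↦ σ(a₁, b₁) ⊗ a₂ b₂`. -/
noncomputable def twist : J →ₗ[k] J →ₗ[k] K ⊗[k] J :=
  (TensorProduct.map₂ D.σ (LinearMap.mul k J)).compl₁₂ comul comul

/-- `σ` is a cocycle: `σ(1, a) = σ(a, 1) = ε(a) 1` and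
`γ(a₁, σ(b₁, c₁)) σ(a₂, b₂ c₂) = σ(a₁, b₁) σ(a₂ b₂, c)`. -/
structure IsCocycle : Prop where
  one_left : ∀ a, D.σ 1 a = counit (R := k) a • (1 : K)
  one_right : ∀ a, D.σ a 1 = counit (R := k) a • (1 : K)
  cocycle : ∀ a b c,
    LinearMap.mul' k K (TensorProduct.map₂ D.γ D.σ (comul a) (D.twist b c)) =
      LinearMap.mul' k K ((D.σ.flip c).lTensor K (D.twist a b))

/-- `τ` is a co-cocycle: writing `τ(a) = τ(a)⁽¹⁾ ⊗ τ(a)⁽²⁾`,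
`ε(τ(a)⁽¹⁾) τ(a)⁽²⁾ = τ(a)⁽¹⁾ ε(τ(a)⁽²⁾) = ε(a) 1` and, in the algebra `K ⊗ K ⊗ K`,
`(Δ ⊗ id)(τ(a₁)) (τ ⊗ id)(ρ(a₂)) = (id ⊗ Δ)(τ(a₁)) (1 ⊗ τ(a₂))`. -/
structure IsCococycle : Prop where
  counit_left : ∀ a, TensorProduct.lid k K ((counit (R := k) (A := K)).rTensor K (D.τ a)) =
    counit (R := k) a • (1 : K)
  counit_right : ∀ a, TensorProduct.rid k K ((counit (R := k) (A := K)).lTensor K (D.τ a)) =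
    counit (R := k) a • (1 : K)
  cococycle : ∀ a,
    TensorProduct.assoc k K K K (LinearMap.mul' k ((K ⊗[k] K) ⊗[k] K)
      (TensorProduct.map ((comul (R := k) (A := K)).rTensor K ∘ₗ D.τ) (D.τ.rTensor K ∘ₗ D.ρ)
        (comul a))) =
    LinearMap.mul' k (K ⊗[k] (K ⊗[k] K))
      (TensorProduct.map ((comul (R := k) (A := K)).lTensor K ∘ₗ D.τ)
        (TensorProduct.mk k K (K ⊗[k] K) 1 ∘ₗ D.τ) (comul a))

/-- The bilinear map `(a, g) ↦ γ(a₁, g) ⊗ a₂`. -/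
noncomputable def swap : J →ₗ[k] K →ₗ[k] K ⊗[k] J :=
  LinearMap.mk₂ k (fun a g => (D.γ.flip g).rTensor J (comul a))
    (by intros; simp) (by intros; simp)
    (by intros; simp [LinearMap.rTensor_add]) (by intros; simp [LinearMap.rTensor_smul])

/-- The bilinear map `(u ⊗ c, b) ↦ u σ(c₁, b₁) ⊗ c₂ b₂`. -/
noncomputable def straighten : K ⊗[k] J →ₗ[k] J →ₗ[k] K ⊗[k] J :=
  TensorProduct.lift (LinearMap.mk₂ k
    (fun u c => LinearMap.mulLeft k (u ⊗ₜ[k] (1 : J)) ∘ₗ D.twist c)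
    (by intros; ext; simp [TensorProduct.add_tmul, add_mul])
    (by intros; ext; simp [← TensorProduct.smul_tmul'])
    (by intros; ext; simp [mul_add])
    (by intros; ext; simp))

/-- The product of the crossed product:
`(h # a)(g # b) = h γ(a₁, g) σ(a₂, b₁) # a₃ b₂`. -/
noncomputable def mul : K ⊗[k] J →ₗ[k] K ⊗[k] J →ₗ[k] K ⊗[k] J :=
  TensorProduct.lift (LinearMap.mk₂ k
    (fun h a => TensorProduct.lift (LinearMap.mk₂ k
      (fun g b => (h ⊗ₜ[k] (1 : J)) * D.straighten (D.swap a g) b)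
      (by intros; simp [mul_add]) (by intros; simp)
      (by intros; simp [mul_add]) (by intros; simp)))
    (by intros; ext; simp [TensorProduct.add_tmul, add_mul])
    (by intros; ext; simp [← TensorProduct.smul_tmul'])
    (by intros; ext; simp [mul_add])
    (by intros; ext; simp))

/-- The counit `ε(h # a) = ε(h) ε(a)` of the crossed product. -/
noncomputable def counitMap : K ⊗[k] J →ₗ[k] k :=
  LinearMap.mul' k k ∘ₗ TensorProduct.map counit counit

/-- The linear map `a ↦ (1 ⊗ ρ(a₁)⁽¹⁾) ⊗ (ρ(a₁)⁽²⁾ ⊗ a₂)`. -/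
noncomputable def coswap : J →ₗ[k] (K ⊗[k] J) ⊗[k] (K ⊗[k] J) :=
  (TensorProduct.mk k K J 1).rTensor (K ⊗[k] J) ∘ₗ
    (TensorProduct.assoc k J K J).toLinearMap ∘ₗ D.ρ.rTensor J ∘ₗ comul

variable (k K J) in
/-- The linear map `g ⊗ h ↦ (g ⊗ 1) ⊗ (h ⊗ 1)`. -/
noncomputable def incl : K ⊗[k] K →ₗ[k] (K ⊗[k] J) ⊗[k] (K ⊗[k] J) :=
  TensorProduct.map ((TensorProduct.mk k K J).flip 1) ((TensorProduct.mk k K J).flip 1)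

/-- The coproduct of the crossed product:
`Δ(h # a) = (h₁ τ(a₁)⁽¹⁾ # ρ(a₂)⁽¹⁾) ⊗ (h₂ τ(a₁)⁽²⁾ ρ(a₂)⁽²⁾ # a₃)`.
The factors are multiplied in the tensor product algebra `(K ⊗ J) ⊗ (K ⊗ J)`. -/
noncomputable def comulMap : K ⊗[k] J →ₗ[k] (K ⊗[k] J) ⊗[k] (K ⊗[k] J) :=
  LinearMap.mul' k ((K ⊗[k] J) ⊗[k] (K ⊗[k] J)) ∘ₗ
    TensorProduct.map (incl k K J ∘ₗ comul)
      (LinearMap.mul' k ((K ⊗[k] J) ⊗[k] (K ⊗[k] J)) ∘ₗ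
        TensorProduct.map (incl k K J ∘ₗ D.τ) D.coswap ∘ₗ comul)

/-- `σ` is trivial: `σ(a, b) = ε(a) ε(b) 1`. -/
def TrivialCocycle : Prop :=
  ∀ a b, D.σ a b = (counit (R := k) a * counit (R := k) b) • (1 : K)

/-- `τ` is trivial: `τ(a) = ε(a) 1 ⊗ 1`. -/
def TrivialCococycle : Prop :=
  ∀ a, D.τ a = counit (R := k) a • ((1 : K) ⊗ₜ[k] (1 : K))

/-- `γ` is trivial: `γ(a, g) = ε(a) g`. -/
def TrivialAction : Prop := ∀ a g, D.γ a g = counit (R := k) a • g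

/-- `ρ` is trivial: `ρ(a) = a ⊗ 1`. -/
def TrivialCoaction : Prop := ∀ a, D.ρ a = a ⊗ₜ[k] (1 : K)

end CrossedData

/-- The data `(γ, σ, ρ, τ)` of a crossed product `K^τ #_σ J` of Hopf algebras: `γ` is a weak
action, `ρ` a weak coaction, `σ` a cocycle, `τ` a co-cocycle, and the vector space `K ⊗ J` is a
Hopf algebra with unit `1 # 1` and the product, coproduct and counit determined by the data. -/
structure CrossedSystem (k : Type u) [Field k] (K : Type v) (J : Type w)
    [Ring K] [HopfAlgebra k K] [Ring J] [HopfAlgebra k J] extends CrossedData k K J where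
  weakAction : toCrossedData.IsWeakAction
  weakCoaction : toCrossedData.IsWeakCoaction
  cocycle : toCrossedData.IsCocycle
  cococycle : toCrossedData.IsCococycle
  one_mul : ∀ p, toCrossedData.mul 1 p = p
  mul_one : ∀ p, toCrossedData.mul p 1 = p
  mul_assoc : ∀ p q t, toCrossedData.mul (toCrossedData.mul p q) t =
    toCrossedData.mul p (toCrossedData.mul q t)
  coassoc : TensorProduct.assoc k (K ⊗[k] J) (K ⊗[k] J) (K ⊗[k] J) ∘ₗ
      toCrossedData.comulMap.rTensor (K ⊗[k] J) ∘ₗ toCrossedData.comulMap =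
    toCrossedData.comulMap.lTensor (K ⊗[k] J) ∘ₗ toCrossedData.comulMap
  rTensor_counit : CrossedData.counitMap.rTensor (K ⊗[k] J) ∘ₗ toCrossedData.comulMap =
    TensorProduct.mk k k (K ⊗[k] J) 1
  lTensor_counit : CrossedData.counitMap.lTensor (K ⊗[k] J) ∘ₗ toCrossedData.comulMap =
    (TensorProduct.mk k (K ⊗[k] J) k).flip 1
  counit_one : CrossedData.counitMap (1 : K ⊗[k] J) = (1 : k)
  counit_mul : ∀ p q : K ⊗[k] J, CrossedData.counitMap (toCrossedData.mul p q) =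
    (CrossedData.counitMap p * CrossedData.counitMap q : k)
  comul_one : toCrossedData.comulMap 1 = 1 ⊗ₜ[k] 1
  comul_mul : ∀ p q, toCrossedData.comulMap (toCrossedData.mul p q) =
    TensorProduct.map₂ toCrossedData.mul toCrossedData.mul
      (toCrossedData.comulMap p) (toCrossedData.comulMap q)
  antipode : K ⊗[k] J →ₗ[k] K ⊗[k] J
  antipode_left : ∀ p, TensorProduct.lift toCrossedData.mul
    (antipode.rTensor (K ⊗[k] J) (toCrossedData.comulMap p)) =
      (CrossedData.counitMap p : k) • (1 : K ⊗[k] J)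
  antipode_right : ∀ p, TensorProduct.lift toCrossedData.mul
    (antipode.lTensor (K ⊗[k] J) (toCrossedData.comulMap p)) =
      (CrossedData.counitMap p : k) • (1 : K ⊗[k] J)

namespace CrossedSystem

variable {k : Type u} [Field k] {K : Type v} {J : Type w}
  [Ring K] [HopfAlgebra k K] [Ring J] [HopfAlgebra k J]

/-- The crossed product `K^τ #_σ J`: the vector space `K ⊗ J` with the structure given by the
data `D`. (It must not be confused with the tensor product algebra.) -/
def Prod (_D : CrossedSystem k K J) : Type (max v w) := K ⊗[k] J

variable (D : CrossedSystem k K J)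

noncomputable instance : AddCommGroup D.Prod := inferInstanceAs (AddCommGroup (K ⊗[k] J))

noncomputable instance : Module k D.Prod := inferInstanceAs (Module k (K ⊗[k] J))

/-- The element `h # a` of the crossed product. -/
def tmul (h : K) (a : J) : D.Prod := (h ⊗ₜ[k] a : K ⊗[k] J)

noncomputable instance : Ring D.Prod :=
  { (inferInstance : AddCommGroup D.Prod) with
    one := ((1 : K ⊗[k] J) : K ⊗[k] J)
    mul := fun p q => D.mul p q
    one_mul := D.one_mul
    mul_one := D.mul_one
    mul_assoc := D.mul_assoc
    left_distrib := fun p q t => map_add (D.mul p) q t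
    right_distrib := fun p q t => LinearMap.map_add₂ D.mul p q t
    zero_mul := fun p => LinearMap.map_zero₂ D.mul p
    mul_zero := fun p => map_zero (D.mul p) }

noncomputable instance : Algebra k D.Prod :=
  Algebra.ofModule (fun c p q => LinearMap.map_smul₂ D.mul c p q)
    (fun c p q => map_smul (D.mul p) c q)

noncomputable instance : Coalgebra k D.Prod where
  comul := D.comulMap
  counit := CrossedData.counitMap
  coassoc := D.coassoc
  rTensor_counit_comp_comul := D.rTensor_counit
  lTensor_counit_comp_comul := D.lTensor_counit

theorem map₂_mul (s t : D.Prod ⊗[k] D.Prod) :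
    TensorProduct.map₂ (LinearMap.mul k D.Prod) (LinearMap.mul k D.Prod) s t = s * t := by
  induction s with
  | zero => simp
  | add _ _ h₁ h₂ => rw [map_add, LinearMap.add_apply, h₁, h₂, add_mul]
  | tmul p q =>
    induction t with
    | zero => simp
    | add _ _ h₁ h₂ => rw [map_add, h₁, h₂, mul_add]
    | tmul p' q' => simp

noncomputable instance : Bialgebra k D.Prod :=
  Bialgebra.mk' k D.Prod D.counit_one (fun {p q} => D.counit_mul p q) D.comul_one
    (fun {p q} => (D.comul_mul p q).trans (map₂_mul D _ _))

noncomputable instance : HopfAlgebra k D.Prod where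
  antipode := (D.antipode : K ⊗[k] J →ₗ[k] K ⊗[k] J)
  mul_antipode_rTensor_comul := by
    ext p
    exact (D.antipode_left p).trans
      (Algebra.algebraMap_eq_smul_one (A := D.Prod) (CrossedData.counitMap (k := k) p)).symm
  mul_antipode_lTensor_comul := by
    ext p
    exact (D.antipode_right p).trans
      (Algebra.algebraMap_eq_smul_one (A := D.Prod) (CrossedData.counitMap (k := k) p)).symm

end CrossedSystem

end Crossed

/-! ### The umbrella Hopf algebra `UM(r, 2s)` and its building blocks -/

section Blocks

/-- The normal form of an antisymmetric `r × r` matrix of rank `2s`: `s` diagonal blocks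
`[[0, 1], [-1, 0]]` followed by zeros. As the indices start at `0`, the block number `p`
occupies the rows and columns `2p` and `2p + 1`. -/
def normalForm (k : Type u) [Field k] (r s : ℕ) : Matrix (Fin r) (Fin r) k :=
  Matrix.of fun i j =>
    if ∃ p < s, i.val = 2 * p ∧ j.val = 2 * p + 1 then 1
    else if ∃ p < s, i.val = 2 * p + 1 ∧ j.val = 2 * p then -1
    else 0

theorem normalForm_antisymm (k : Type u) [Field k] (r s : ℕ) (i j : Fin r) :
    normalForm k r s i j = -normalForm k r s j i := by
  simp only [normalForm, Matrix.of_apply, and_comm (a := j.val = _)]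
  by_cases h₁ : ∃ p < s, i.val = 2 * p ∧ j.val = 2 * p + 1
  · have h₂ : ¬ ∃ p < s, i.val = 2 * p + 1 ∧ j.val = 2 * p := by
      rintro ⟨p, _, hp⟩; obtain ⟨q, _, hq⟩ := h₁; omega
    simp only [h₁, h₂, if_true, if_false, neg_neg]
  · by_cases h₂ : ∃ p < s, i.val = 2 * p + 1 ∧ j.val = 2 * p
    · simp only [h₁, h₂, if_true, if_false]
    · simp only [h₁, h₂, if_false, neg_zero]

theorem normalForm_diag (k : Type u) [Field k] (r s : ℕ) (i : Fin r) :
    normalForm k r s i i = 0 := by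
  simp only [normalForm, Matrix.of_apply]
  split_ifs <;> first | rfl | (exfalso; grind)

/-- The Lie algebra `𝔏` with basis `x₀, x₁, …, x_r`, where `x₀` is central and
`[xᵢ, xⱼ] = B i j • x₀` for the matrix `B` in normal form. -/
@[ext]
structure LieL (k : Type u) [Field k] (r s : ℕ) : Type u where
  /-- the coefficient of `x₀` -/
  c₀ : k
  /-- the coefficients of `x₁, …, x_r` -/
  c : Fin r → k

namespace LieL

variable {k : Type u} [Field k] {r s : ℕ}

instance : Zero (LieL k r s) := ⟨⟨0, 0⟩⟩
instance : Add (LieL k r s) := ⟨fun p q => ⟨p.c₀ + q.c₀, p.c + q.c⟩⟩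
instance : Neg (LieL k r s) := ⟨fun p => ⟨-p.c₀, -p.c⟩⟩
instance : SMul k (LieL k r s) := ⟨fun a p => ⟨a • p.c₀, a • p.c⟩⟩

theorem zero_def : (0 : LieL k r s) = ⟨0, 0⟩ := rfl
theorem add_def (p q : LieL k r s) : p + q = ⟨p.c₀ + q.c₀, p.c + q.c⟩ := rfl
theorem neg_def (p : LieL k r s) : -p = ⟨-p.c₀, -p.c⟩ := rfl
theorem smul_def (a : k) (p : LieL k r s) : a • p = ⟨a • p.c₀, a • p.c⟩ := rfl

instance : AddCommGroup (LieL k r s) where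
  add_assoc p q t := by ext <;> simp [add_def, add_assoc]
  zero_add p := by ext <;> simp [add_def, zero_def]
  add_zero p := by ext <;> simp [add_def, zero_def]
  add_comm p q := by ext <;> simp [add_def, add_comm]
  neg_add_cancel p := by ext <;> simp [add_def, neg_def, zero_def]
  nsmul := nsmulRec
  zsmul := zsmulRec

instance : Module k (LieL k r s) where
  one_smul p := by ext <;> simp [smul_def]
  mul_smul a b p := by ext <;> simp [smul_def, mul_assoc]
  smul_zero a := by ext <;> simp [smul_def, zero_def]
  smul_add a p q := by ext <;> simp [smul_def, add_def, mul_add]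
  add_smul a b p := by ext <;> simp [smul_def, add_def, add_mul]
  zero_smul p := by ext <;> simp [smul_def, zero_def]

instance : Bracket (LieL k r s) (LieL k r s) :=
  ⟨fun p q => ⟨∑ i, ∑ j, p.c i * q.c j * normalForm k r s i j, 0⟩⟩

theorem bracket_def (p q : LieL k r s) :
    ⁅p, q⁆ = ⟨∑ i, ∑ j, p.c i * q.c j * normalForm k r s i j, 0⟩ := rfl

instance : LieRing (LieL k r s) where
  add_lie p q t := by
    ext <;> simp [bracket_def, add_def, add_mul, Finset.sum_add_distrib]
  lie_add p q t := by
    ext <;> simp [bracket_def, add_def, mul_add, add_mul, Finset.sum_add_distrib]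
  lie_self p := by
    ext
    · simp only [bracket_def, zero_def, ← Finset.sum_product']
      refine Finset.sum_involution (fun z _ => (z.2, z.1)) ?_ ?_ ?_ ?_
      · rintro ⟨i, j⟩ _
        simp only
        rw [normalForm_antisymm k r s i j]
        ring
      · rintro ⟨i, j⟩ _ h he
        obtain rfl : j = i := congrArg Prod.fst he
        exact h (by simp [normalForm_diag])
      · simp
      · simp
    · rfl
  leibniz_lie p q t := by ext <;> simp [bracket_def, add_def]

instance : LieAlgebra k (LieL k r s) where
  lie_smul a p q := by
    ext
    · simp only [bracket_def, smul_def, Pi.smul_apply, smul_eq_mul, Finset.mul_sum]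
      refine Finset.sum_congr rfl fun i _ => Finset.sum_congr rfl fun j _ => ?_
      ring
    · simp [bracket_def, smul_def]

end LieL

/-- The abelian Lie algebra `Y` with basis `ȳ₁, …, ȳ_r`. -/
def LieY (k : Type u) (r : ℕ) : Type u := Fin r → k

namespace LieY

variable {k : Type u} [Field k] {r : ℕ}

instance : AddCommGroup (LieY k r) := inferInstanceAs (AddCommGroup (Fin r → k))
instance : Module k (LieY k r) := inferInstanceAs (Module k (Fin r → k))

instance : LieRing (LieY k r) where
  bracket _ _ := 0
  add_lie _ _ _ := by simp
  lie_add _ _ _ := by simp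
  lie_self _ := rfl
  leibniz_lie _ _ _ := by simp

instance : LieAlgebra k (LieY k r) where
  lie_smul _ _ _ := (smul_zero _).symm

end LieY

variable (k : Type u) [Field k] (r s : ℕ)

/-- The enveloping algebra `U(𝔏)`. -/
abbrev UL : Type u := UniversalEnvelopingAlgebra k (LieL k r s)

/-- The enveloping algebra `U(Y)`. -/
abbrev UY : Type u := UniversalEnvelopingAlgebra k (LieY k r)

/-- The enveloping algebra `U(𝔰𝔬(B))`. -/
abbrev USo : Type u := UniversalEnvelopingAlgebra k (so (normalForm k r s))

/-- The element `x₀` of `U(𝔏)`. -/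
noncomputable def UL.x₀ : UL k r s :=
  UniversalEnvelopingAlgebra.ι k (⟨1, 0⟩ : LieL k r s)

/-- The element `xᵢ` of `U(𝔏)`, for `1 ≤ i ≤ r`. -/
noncomputable def UL.x (i : Fin r) : UL k r s :=
  UniversalEnvelopingAlgebra.ι k (⟨0, Pi.single i 1⟩ : LieL k r s)

/-- The element `ȳᵢ` of `U(Y)`. -/
noncomputable def UY.y (i : Fin r) : UY k r :=
  UniversalEnvelopingAlgebra.ι k (show LieY k r from Pi.single i (1 : k))

variable {k r s} in
/-- The image in `U(𝔰𝔬(B))` of an element of `𝔰𝔬(B)`. -/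
noncomputable def USo.m (M : so (normalForm k r s)) : USo k r s :=
  UniversalEnvelopingAlgebra.ι k M

/-- The umbrella Hopf algebra `UM(r, 2s) = UM(B)`, for `B` the normal form of rank `2s`. -/
abbrev UMrs {ι : Type v} (b : Module.Basis ι k (so (normalForm k r s))) : Type (max u v) :=
  UM (normalForm k r s) b

end Blocks

end Umbrella

/-!
The Hopf algebra `UM(r, 2s)` is compared with an iterated crossed product built by hand, and
every property of the crossed products is deduced from an injective map into `UM(r, 2s)`. No
Poincaré–Birkhoff–Witt theorem is needed: the injectivity comes from a regular representation.

The one relation that keeps `Y` from spanning a commutative subalgebra is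
`[yᵢ, yⱼ] = (1/3) Bᵢⱼ x₀³`. It is written as `β(v, w) - β(w, v)` times the central element
`lam = -(1/3) x₀³`, for the lower triangular part `β` of `-B`, together with the projection `π` of
`Y` onto the span of the `ȳᵢ` with `i = 2p`, `p ≤ s`. The form `β` sees only `π v` in its first
argument and only `w - π w` in its second one (`TwistData`). Hence the relation holds trivially on
the image of `π` and on that of `id - π`, and any linear map `η` on `Y` satisfying it restricts to
two algebra maps on `U(Y)`, whose convolution product `a ↦ first(a₁) second(a₂)` orders the
monomials (`TwistData.Pair.sec`). As all maps on `U(Y)` that occur are convolution products of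
algebra maps, identities between them are checked on generators (`convOf_mul_eq`).

Applied to the operators on `K ⊗ U(Y)` by which `v` acts as `v + lam β(v, -)`, with `β(v, -)` extended
to a derivation of `U(Y)`, this gives an associative product on `K ⊗ U(Y)` with a universal property
(`TwistData.mulOp`, `TwistData.Pair.ext_mulOp`). As the ordering map is colinear
(`TwistData.coact_sec`), this product has the form `(h ⊗ a)(g ⊗ b) = h g σ(a₁, b₁) ⊗ a₂ b₂`, and the
associativity makes `σ` a cocycle (`CrossedData.TrivialAction.isCocycle`). The co-cocycle `τ` is the
ordered extension of `ȳᵢ ↦ x₀ ⊗ xᵢ - xᵢ ⊗ x₀` (`tau`, `tau_cococycle`).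

The Lie algebra `𝔰𝔬(B)` preserves the form `B` and so acts on the twisted product by derivations
(`soDer`). This lets `UM(r, 2s)` act on the tensor product of the twisted product and `U(𝔰𝔬(B))`
(`regUM`), and evaluation at `1 ⊗ 1` inverts the multiplication map into `UM(r, 2s)`
(`mulUM_bijective`). In particular the twisted product embeds in `UM(r, 2s)`, and the image is stable
under the antipode. The multiplication map respects the coproduct and the counit (`comul_sec`), so
that the Hopf algebra axioms for both crossed products can be read off in `UM(r, 2s)`
(`CrossedData.IsHopfMap.crossedSystem`).
-/


namespace Umbrella

universe u v w

open Coalgebra (comul counit)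
open WithConv (toConv)
open Matrix

/-! ### Algebra maps out of enveloping algebras -/

section Enveloping

variable {k : Type*} [CommRing k] {L : Type*} [LieRing L] [LieAlgebra k L]
  {Q : Type*} [Ring Q] [Algebra k Q]

local notation "U" => UniversalEnvelopingAlgebra k L
local notation "ι" => UniversalEnvelopingAlgebra.ι k

section
attribute [local instance 100] LieRing.ofAssociativeRing

/-- The algebra map out of an enveloping algebra given by a linear map that turns brackets into
commutators. -/
noncomputable def envLift (f : L →ₗ[k] Q) (hf : ∀ x y, f ⁅x, y⁆ = f x * f y - f y * f x) :
    U →ₐ[k] Q :=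
  UniversalEnvelopingAlgebra.lift k
    { f with map_lie' := by intro x y; exact hf x y }

theorem envLift_ι (f : L →ₗ[k] Q) (hf : ∀ x y, f ⁅x, y⁆ = f x * f y - f y * f x) (x : L) :
    envLift f hf (ι x) = f x :=
  UniversalEnvelopingAlgebra.lift_ι_apply k _ x

/-- The inclusion of a Lie algebra in its enveloping algebra, as a linear map. -/
noncomputable def envInc : L →ₗ[k] U := (ι : L →ₗ⁅k⁆ U)

theorem envInc_apply (x : L) : (envInc x : U) = ι x := rfl

theorem ι_lie (x y : L) : (ι ⁅x, y⁆ : U) = ι x * ι y - ι y * ι x :=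
  LieHom.map_lie (ι : L →ₗ⁅k⁆ U) x y

end

theorem comul_ι (x : L) : comul (R := k) (ι x : U) = ι x ⊗ₜ 1 + 1 ⊗ₜ ι x := envComul_ι x

theorem counit_ι (x : L) : counit (R := k) (ι x : U) = 0 := envCounit_ι x

/-- Induction on the generators of an enveloping algebra. -/
theorem env_induction {p : U → Prop} (S : Subalgebra k U) (hS : ∀ a ∈ S, p a)
    (h : ∀ x : L, ι x ∈ S) (a : U) : p a :=
  hS a (by rw [env_subalgebra_eq_top k L S h]; trivial)

theorem env_commute (f : U →ₐ[k] Q) (q : Q) (h : ∀ x : L, Commute (f (ι x)) q) (a : U) :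
    Commute (f a) q := by
  refine env_induction (p := fun a => Commute (f a) q)
    ((Subalgebra.centralizer k {q}).comap f) (fun a ha => ?_) (fun x => ?_) a
  · exact ((Subalgebra.mem_centralizer_iff k).1 ha q rfl).symm
  · refine (Subalgebra.mem_centralizer_iff k).2 fun g hg => ?_
    rw [Set.mem_singleton_iff.1 hg]
    exact (h x).symm

theorem env_commute₂ {L' : Type*} [LieRing L'] [LieAlgebra k L'] (f : U →ₐ[k] Q)
    (g : UniversalEnvelopingAlgebra k L' →ₐ[k] Q)
    (h : ∀ (x : L) (y : L'), Commute (f (ι x)) (g (ι y))) (a : U)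
    (b : UniversalEnvelopingAlgebra k L') : Commute (f a) (g b) :=
  env_commute f _ (fun x => (env_commute g _ (fun y => (h x y).symm) b).symm) a

/-- A linear map that intertwines the actions of the generators intertwines the actions of
the enveloping algebra. -/
theorem env_equivariant {V W : Type*} [AddCommGroup V] [Module k V] [AddCommGroup W] [Module k W]
    (F : U →ₐ[k] Module.End k V) (G : U →ₐ[k] Module.End k W) (θ : V →ₗ[k] W)
    (h : ∀ (x : L) (p : V), θ (F (ι x) p) = G (ι x) (θ p)) (a : U) (p : V) :
    θ (F a p) = G a (θ p) := by
  let S : Subalgebra k U :=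
    { carrier := {a | ∀ p, θ (F a p) = G a (θ p)}
      mul_mem' := by intro a b ha hb p; simp [ha (F b p), hb p]
      add_mem' := by intro a b ha hb p; simp [ha p, hb p]
      algebraMap_mem' := by intro c p; simp [Module.algebraMap_end_apply] }
  exact env_induction (p := fun a => ∀ p, θ (F a p) = G a (θ p)) S (fun a ha => ha) h a p

/-- Two linear maps satisfying the Leibniz rule along an algebra map agree if they agree on the
generators. -/
theorem leibniz_eqOn {P : Type*} [Ring P] [Algebra k P] (f : P →ₐ[k] Q) (D E : P →ₗ[k] Q)
    (hD : ∀ a b, D (a * b) = f a * D b + D a * f b)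
    (hE : ∀ a b, E (a * b) = f a * E b + E a * f b) :
    ∃ S : Subalgebra k P, ∀ a, a ∈ S ↔ D a = E a := by
  have h1 : ∀ F : P →ₗ[k] Q, (∀ a b, F (a * b) = f a * F b + F a * f b) → F 1 = 0 := by
    intro F hF
    simpa using hF 1 1
  exact ⟨{
    carrier := {a | D a = E a}
    mul_mem' := by
      intro a b (ha : D a = E a) (hb : D b = E b)
      change D (a * b) = E (a * b)
      rw [hD, hE, ha, hb]
    add_mem' := by
      intro a b (ha : D a = E a) (hb : D b = E b)
      change D (a + b) = E (a + b)
      rw [map_add, map_add, ha, hb]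
    algebraMap_mem' := by
      intro c
      change D _ = E _
      rw [Algebra.algebraMap_eq_smul_one, map_smul, map_smul, h1 D hD, h1 E hE] }, fun a => Iff.rfl⟩

theorem env_leibniz_ext (f : U →ₐ[k] Q) (D E : U →ₗ[k] Q)
    (hD : ∀ a b, D (a * b) = f a * D b + D a * f b)
    (hE : ∀ a b, E (a * b) = f a * E b + E a * f b)
    (h : ∀ x : L, D (ι x) = E (ι x)) : D = E := by
  obtain ⟨S, hS⟩ := leibniz_eqOn f D E hD hE
  ext a
  exact env_induction (p := fun a => D a = E a) S (fun a ha => (hS a).1 ha)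
    (fun x => (hS _).2 (h x)) a

/-! ### Convolution of algebra maps -/

/-- An algebra map, as an element of the convolution algebra. -/
abbrev convOf (f : U →ₐ[k] Q) : WithConv (U →ₗ[k] Q) := toConv f.toLinearMap

/-- The convolution product of algebra maps with commuting images is the algebra map
`a ↦ f(a₁) g(a₂)`. -/
noncomputable def convHom (f g : U →ₐ[k] Q)
    (h : ∀ x y : L, Commute (f (ι x)) (g (ι y))) : U →ₐ[k] Q :=
  (Algebra.TensorProduct.lift f g (env_commute₂ f g h)).comp (Bialgebra.comulAlgHom k U)

theorem convOf_convHom (f g : U →ₐ[k] Q) (h : ∀ x y : L, Commute (f (ι x)) (g (ι y))) :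
    convOf (convHom f g h) = convOf f * convOf g := by
  have : (Algebra.TensorProduct.lift f g (env_commute₂ f g h)).toLinearMap =
      LinearMap.mul' k Q ∘ₗ TensorProduct.map f.toLinearMap g.toLinearMap := by
    ext; simp
  exact congrArg toConv (LinearMap.ext fun a => LinearMap.congr_fun this (comul a))

theorem convHom_ι (f g : U →ₐ[k] Q) (h : ∀ x y : L, Commute (f (ι x)) (g (ι y))) (x : L) :
    convHom f g h (ι x) = f (ι x) + g (ι x) := by
  change Algebra.TensorProduct.lift f g (env_commute₂ f g h) (comul (ι x)) = _
  rw [comul_ι]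
  simp only [map_add, Algebra.TensorProduct.lift_tmul, map_one, mul_one, one_mul]

/-- Convolution products of pairs of algebra maps with commuting images are determined by their
values on the generators. -/
theorem convOf_mul_eq {f g f' g' : U →ₐ[k] Q} (h : ∀ x y : L, Commute (f (ι x)) (g (ι y)))
    (h' : ∀ x y : L, Commute (f' (ι x)) (g' (ι y)))
    (e : ∀ x : L, f (ι x) + g (ι x) = f' (ι x) + g' (ι x)) :
    convOf f * convOf g = convOf f' * convOf g' := by
  rw [← convOf_convHom f g h, ← convOf_convHom f' g' h']
  refine congrArg convOf (env_hom_ext fun x => ?_)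
  rw [convHom_ι, convHom_ι, e]

theorem convOf_mul_eq_convOf {f g f' : U →ₐ[k] Q} (h : ∀ x y : L, Commute (f (ι x)) (g (ι y)))
    (e : ∀ x : L, f (ι x) + g (ι x) = f' (ι x)) :
    convOf f * convOf g = convOf f' := by
  rw [← convOf_convHom f g h]
  refine congrArg convOf (env_hom_ext fun x => ?_)
  rw [convHom_ι, e]

theorem convOf_mul_comm {f g : U →ₐ[k] Q} (h : ∀ x y : L, Commute (f (ι x)) (g (ι y))) :
    convOf f * convOf g = convOf g * convOf f :=
  convOf_mul_eq h (fun x y => (h y x).symm) fun _ => add_comm _ _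

theorem convOf_mul_mul_mul_comm {g₁ f₂ : U →ₐ[k] Q}
    (h : ∀ x y : L, Commute (f₂ (ι x)) (g₁ (ι y))) (f₁ g₂ : U →ₐ[k] Q) :
    convOf f₁ * convOf g₁ * (convOf f₂ * convOf g₂) =
      convOf f₁ * convOf f₂ * (convOf g₁ * convOf g₂) := by
  rw [mul_assoc, mul_assoc, ← mul_assoc (convOf g₁), ← mul_assoc (convOf f₂), convOf_mul_comm h]

theorem convOf_comp_mul {Q' : Type*} [Ring Q'] [Algebra k Q'] (F : Q →ₐ[k] Q') (f g : U →ₐ[k] Q) :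
    toConv (F.toLinearMap ∘ₗ (convOf f * convOf g).ofConv) =
      convOf (F.comp f) * convOf (F.comp g) :=
  congrArg toConv (LinearMap.algHom_comp_convMul_distrib F (convOf f) (convOf g))

end Enveloping

/-! ### Derivations from dual numbers -/

section Dual

variable {k : Type*} [CommRing k] {A : Type*} [Ring A] [Algebra k A] {Q : Type*} [Ring Q]
  [Algebra k Q]

/-- The infinitesimal part of an algebra map into the dual numbers. -/
noncomputable def infPart (F : A →ₐ[k] DualNumber Q) : A →ₗ[k] Q where
  toFun a := (F a).snd
  map_add' _ _ := by rw [map_add, TrivSqZeroExt.snd_add]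
  map_smul' _ _ := by rw [map_smul, TrivSqZeroExt.snd_smul, RingHom.id_apply]

theorem infPart_apply (F : A →ₐ[k] DualNumber Q) (a : A) : infPart F a = (F a).snd := rfl

theorem infPart_mul (F : A →ₐ[k] DualNumber Q) (f : A →ₐ[k] Q) (h : ∀ a, (F a).fst = f a)
    (a b : A) : infPart F (a * b) = f a * infPart F b + infPart F a * f b := by
  simp [infPart_apply, h]

end Dual

/-! ### Derivations of the enveloping algebra of an abelian Lie algebra -/

section Deriv

variable {k : Type*} [CommRing k] {Y : Type*} [LieRing Y] [LieAlgebra k Y] [IsLieAbelian Y]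

local notation "U" => UniversalEnvelopingAlgebra k Y
local notation "ι" => UniversalEnvelopingAlgebra.ι k

theorem ι_comm (x y : Y) : (ι x * ι y : U) = ι y * ι x := by
  rw [← sub_eq_zero, ← ι_lie, trivial_lie_zero, map_zero]

/-- The endomorphism of `U(Y)` induced by a linear endomorphism of `Y`. -/
noncomputable def envMap (f : Y →ₗ[k] Y) : U →ₐ[k] U :=
  envLift (envInc ∘ₗ f) (by
    intro x y
    rw [trivial_lie_zero, map_zero]
    exact (sub_eq_zero.2 (ι_comm (f x) (f y))).symm)

theorem envMap_ι (f : Y →ₗ[k] Y) (y : Y) : envMap f (ι y) = ι (f y) := envLift_ι _ _ y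

/-- The algebra map `y ↦ y + f(y) ε` to the dual numbers over `U(Y)`. -/
noncomputable def dualHom (f : Y →ₗ[k] k) : U →ₐ[k] DualNumber U :=
  envLift
    { toFun := fun y => TrivSqZeroExt.inl (ι y : U) + TrivSqZeroExt.inr (f y • (1 : U))
      map_add' := by
        intro x y
        ext <;> simp [-UniversalEnvelopingAlgebra.ι_apply, add_smul]
      map_smul' := by
        intro c y
        ext <;> simp [-UniversalEnvelopingAlgebra.ι_apply, mul_smul] }
    (by
      intro x y
      rw [trivial_lie_zero, map_zero]
      ext
      · simp [-UniversalEnvelopingAlgebra.ι_apply, ι_comm x y]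
      · simp [-UniversalEnvelopingAlgebra.ι_apply, add_comm])

theorem dualHom_fst (f : Y →ₗ[k] k) (a : U) : (dualHom f a).fst = a := by
  have : (TrivSqZeroExt.fstHom k U U).comp (dualHom f) = AlgHom.id k U := by
    apply env_hom_ext
    intro x
    simp [dualHom, envLift_ι, -UniversalEnvelopingAlgebra.ι_apply]
  exact AlgHom.congr_fun this a

/-- The derivation of `U(Y)` that extends a linear form on `Y`. -/
noncomputable def partialDeriv (f : Y →ₗ[k] k) : U →ₗ[k] U := infPart (dualHom f)

theorem partialDeriv_mul (f : Y →ₗ[k] k) (a b : U) :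
    partialDeriv f (a * b) = a * partialDeriv f b + partialDeriv f a * b :=
  infPart_mul (dualHom f) (AlgHom.id k U) (dualHom_fst f) a b

theorem partialDeriv_ι (f : Y →ₗ[k] k) (y : Y) : partialDeriv f (ι y) = f y • (1 : U) := by
  simp [partialDeriv, infPart_apply, dualHom, envLift_ι, -UniversalEnvelopingAlgebra.ι_apply]

theorem partialDeriv_one (f : Y →ₗ[k] k) : partialDeriv f (1 : U) = 0 := by
  simpa using partialDeriv_mul f (1 : U) 1

theorem partialDeriv_add (f g : Y →ₗ[k] k) :
    partialDeriv (f + g) = partialDeriv f + (partialDeriv g : U →ₗ[k] U) := by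
  apply env_leibniz_ext (AlgHom.id k U)
  · exact partialDeriv_mul _
  · intro a b
    simp only [LinearMap.add_apply, partialDeriv_mul, AlgHom.id_apply, mul_add, add_mul]
    abel
  · intro x
    simp only [LinearMap.add_apply, partialDeriv_ι, add_smul]

theorem partialDeriv_smul (c : k) (f : Y →ₗ[k] k) :
    partialDeriv (c • f) = c • (partialDeriv f : U →ₗ[k] U) := by
  apply env_leibniz_ext (AlgHom.id k U)
  · exact partialDeriv_mul _
  · intro a b
    simp only [LinearMap.smul_apply, partialDeriv_mul, AlgHom.id_apply, mul_smul_comm,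
      smul_mul_assoc, smul_add]
  · intro x
    simp only [LinearMap.smul_apply, partialDeriv_ι, smul_assoc]

theorem partialDeriv_comm (f g : Y →ₗ[k] k) (a : U) :
    partialDeriv f (partialDeriv g a) = partialDeriv g (partialDeriv f a) := by
  have : partialDeriv f ∘ₗ partialDeriv g - partialDeriv g ∘ₗ partialDeriv f =
      (0 : U →ₗ[k] U) := by
    apply env_leibniz_ext (AlgHom.id k U)
    · intro a b
      simp only [LinearMap.sub_apply, LinearMap.comp_apply, partialDeriv_mul, map_add,
        AlgHom.id_apply, mul_sub, sub_mul]
      abel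
    · simp
    · intro x
      simp [partialDeriv_ι, partialDeriv_one, -UniversalEnvelopingAlgebra.ι_apply]
  exact sub_eq_zero.1 (LinearMap.congr_fun this a)

theorem rTensor_partialDeriv_mul (f : Y →ₗ[k] k) (s t : U ⊗[k] U) :
    (partialDeriv f).rTensor U (s * t) =
      s * (partialDeriv f).rTensor U t + (partialDeriv f).rTensor U s * t := by
  induction s with
  | zero => simp
  | add _ _ h₁ h₂ => simp only [add_mul, map_add, h₁, h₂]; abel
  | tmul a b =>
    induction t with
    | zero => simp
    | add _ _ h₁ h₂ => simp only [mul_add, map_add, h₁, h₂]; abel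
    | tmul c d => simp [partialDeriv_mul, TensorProduct.add_tmul]

/-- The derivation `partialDeriv f` is a map of comodules. -/
theorem comul_partialDeriv (f : Y →ₗ[k] k) (a : U) :
    comul (R := k) (partialDeriv f a) = (partialDeriv f).rTensor U (comul a) := by
  refine LinearMap.congr_fun (f := comul ∘ₗ partialDeriv f)
    (g := (partialDeriv f).rTensor U ∘ₗ comul) ?_ a
  apply env_leibniz_ext (Bialgebra.comulAlgHom k U)
  · intro a b
    simp [partialDeriv_mul]
  · intro a b
    simp [rTensor_partialDeriv_mul]
  · intro x
    simp [partialDeriv_ι, comul_ι, partialDeriv_one, TensorProduct.smul_tmul',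
      Algebra.TensorProduct.one_def, -UniversalEnvelopingAlgebra.ι_apply]

end Deriv

/-! ### Twisted pairs of maps into an algebra -/

section Twist

/-- The data of a twist of `K ⊗ U(Y)`, for an algebra `K` and an abelian Lie algebra `Y`:
a central element `lam` of `K` and a bilinear form `β` on `Y`. The endomorphism `π` of `Y` splits
every `v` as `π v + (v - π v)` in such a way that the first argument of `β` sees only `π v`, and the
second one only `v - π v`. -/
structure TwistData (k : Type*) [CommRing k] (K : Type*) [Ring K] [Algebra k K] (Y : Type*)
    [LieRing Y] [LieAlgebra k Y] where
  lam : K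
  β : Y →ₗ[k] Y →ₗ[k] k
  π : Y →ₗ[k] Y
  lam_comm : ∀ g, Commute lam g
  β_left : ∀ v w, β (π v) w = β v w
  β_right : ∀ v w, β v (π w) = 0

variable {k : Type*} [CommRing k] {K : Type*} [Ring K] [Algebra k K] {Y : Type*} [LieRing Y]
  [LieAlgebra k Y] {Q : Type*} [Ring Q] [Algebra k Q]

local notation "J" => UniversalEnvelopingAlgebra k Y
local notation "ι" => UniversalEnvelopingAlgebra.ι k

namespace TwistData

/-- An algebra map `i` on `K` and a linear map `η` on `Y` with commuting images, such that
`[η v, η w] = (β(v, w) - β(w, v)) i(lam)`. -/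
structure Pair (T : TwistData k K Y) (i : K →ₐ[k] Q) (η : Y →ₗ[k] Q) : Prop where
  comm : ∀ g v, Commute (i g) (η v)
  rel : ∀ v w, η v * η w - η w * η v = (T.β v w - T.β w v) • i T.lam

theorem β_compl (T : TwistData k K Y) (v w : Y) : T.β (v - T.π v) w = 0 := by
  rw [map_sub, LinearMap.sub_apply, T.β_left, sub_self]

variable [IsLieAbelian Y] {T : TwistData k K Y} {i : K →ₐ[k] Q} {η : Y →ₗ[k] Q}

/-- The algebra map on `U(Y)` given by `v ↦ η (π v)`. -/
noncomputable def Pair.second (hp : T.Pair i η) : J →ₐ[k] Q :=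
  envLift (η ∘ₗ T.π) (by
    intro v w
    rw [trivial_lie_zero, map_zero, LinearMap.comp_apply, LinearMap.comp_apply, hp.rel, T.β_right,
      T.β_right, sub_zero, zero_smul])

/-- The algebra map on `U(Y)` given by `v ↦ η (v - π v)`. -/
noncomputable def Pair.first (hp : T.Pair i η) : J →ₐ[k] Q :=
  envLift (η ∘ₗ (LinearMap.id - T.π)) (by
    intro v w
    have := hp.rel (v - T.π v) (w - T.π w)
    rw [T.β_compl, T.β_compl, sub_self, zero_smul] at this
    rw [trivial_lie_zero, map_zero]
    exact this.symm)

theorem Pair.second_ι (hp : T.Pair i η) (v : Y) : hp.second (ι v) = η (T.π v) :=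
  envLift_ι _ _ v

theorem Pair.first_ι (hp : T.Pair i η) (v : Y) : hp.first (ι v) = η (v - T.π v) :=
  (envLift_ι _ _ v).trans (by simp)

theorem Pair.commute_first (hp : T.Pair i η) (g : K) (a : J) : Commute (i g) (hp.first a) :=
  (env_commute hp.first (i g) (fun v => by rw [hp.first_ι]; exact (hp.comm g _).symm) a).symm

theorem Pair.commute_second (hp : T.Pair i η) (g : K) (a : J) : Commute (i g) (hp.second a) :=
  (env_commute hp.second (i g) (fun v => by rw [hp.second_ι]; exact (hp.comm g _).symm) a).symm

/-- The linear map `a ↦ first(a₁) second(a₂)`, which orders the factors of a monomial. -/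
noncomputable def Pair.sec (hp : T.Pair i η) : J →ₗ[k] Q :=
  (convOf hp.first * convOf hp.second).ofConv

theorem Pair.sec_apply (hp : T.Pair i η) (a : J) : hp.sec a =
    LinearMap.mul' k Q (TensorProduct.map hp.first.toLinearMap hp.second.toLinearMap (comul a)) :=
  rfl

theorem Pair.sec_one (hp : T.Pair i η) : hp.sec 1 = 1 := by
  simp [hp.sec_apply, Bialgebra.comul_one, Algebra.TensorProduct.one_def]

theorem Pair.sec_ι (hp : T.Pair i η) (v : Y) : hp.sec (ι v) = η v := by
  simp [hp.sec_apply, comul_ι, hp.first_ι, hp.second_ι, -UniversalEnvelopingAlgebra.ι_apply]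

theorem Pair.commute_sec (hp : T.Pair i η) (g : K) (a : J) : Commute (i g) (hp.sec a) := by
  rw [hp.sec_apply]
  induction comul (R := k) a with
  | zero => simp
  | add _ _ h₁ h₂ => rw [map_add, map_add]; exact h₁.add_right h₂
  | tmul b c => exact (hp.commute_first g b).mul_right (hp.commute_second g c)

/-- The linear map `h ⊗ a ↦ i(h) sec(a)`. -/
noncomputable def Pair.ext (hp : T.Pair i η) : K ⊗[k] J →ₗ[k] Q :=
  LinearMap.mul' k Q ∘ₗ TensorProduct.map i.toLinearMap hp.sec

theorem Pair.ext_tmul (hp : T.Pair i η) (h : K) (a : J) :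
    hp.ext (h ⊗ₜ a) = i h * hp.sec a := rfl

/-- The generators of the second part move past the first part at the cost of a derivation. -/
theorem Pair.second_mul_first (hp : T.Pair i η) (v : Y) (b : J) :
    hp.second (ι v) * hp.first b =
      hp.first b * hp.second (ι v) + i T.lam * hp.first (partialDeriv (T.β v) b) := by
  rw [← sub_eq_iff_eq_add']
  refine LinearMap.congr_fun
    (f := (LinearMap.mulLeft k (hp.second (ι v)) - LinearMap.mulRight k (hp.second (ι v))) ∘ₗ
      hp.first.toLinearMap)
    (g := LinearMap.mulLeft k (i T.lam) ∘ₗ hp.first.toLinearMap ∘ₗ partialDeriv (T.β v)) ?_ b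
  apply env_leibniz_ext hp.first
  · intro a b
    simp only [LinearMap.comp_apply, LinearMap.sub_apply, LinearMap.mulLeft_apply,
      LinearMap.mulRight_apply, AlgHom.toLinearMap_apply, map_mul]
    noncomm_ring
  · intro a b
    simp only [LinearMap.comp_apply, LinearMap.mulLeft_apply, AlgHom.toLinearMap_apply,
      partialDeriv_mul, map_add, map_mul, ← mul_assoc, (hp.commute_first T.lam a).eq]
  · intro w
    have := hp.rel (T.π v) (w - T.π w)
    rw [T.β_compl, T.β_left, map_sub (T.β v), T.β_right, sub_zero, sub_zero] at this
    simpa [hp.first_ι, hp.second_ι, partialDeriv_ι, -UniversalEnvelopingAlgebra.ι_apply] using this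

/-- Left multiplication by `η v` on ordered monomials is multiplication by `v` in `U(Y)`, corrected
by the derivation `β(v, -)`. -/
theorem Pair.sec_ι_mul (hp : T.Pair i η) (v : Y) (b : J) :
    hp.sec (ι v * b) + i T.lam * hp.sec (partialDeriv (T.β v) b) = η v * hp.sec b := by
  simp only [hp.sec_apply, comul_partialDeriv, Bialgebra.comul_mul, comul_ι]
  have hη : η v = hp.first (ι v) + hp.second (ι v) := by
    rw [hp.first_ι, hp.second_ι, ← map_add, sub_add_cancel]
  induction comul (R := k) b with
  | zero => simp
  | add _ _ h₁ h₂ =>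
    simp only [mul_add, map_add] at h₁ h₂ ⊢
    rw [← h₁, ← h₂]
    abel
  | tmul c d =>
    simp only [add_mul, Algebra.TensorProduct.tmul_mul_tmul, one_mul, map_add,
      TensorProduct.map_tmul, LinearMap.rTensor_tmul, LinearMap.mul'_apply,
      AlgHom.toLinearMap_apply, map_mul, hη]
    rw [← mul_assoc (hp.second (ι v)), hp.second_mul_first]
    noncomm_ring

end TwistData
end Twist

section Twist

variable {k : Type*} [CommRing k] {K : Type*} [Ring K] [Algebra k K] {Y : Type*} [LieRing Y]
  [LieAlgebra k Y] {Q : Type*} [Ring Q] [Algebra k Q]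

local notation "J" => UniversalEnvelopingAlgebra k Y
local notation "ι" => UniversalEnvelopingAlgebra.ι k

namespace TwistData

/-! ### The regular representation of a twisted product -/

variable (T : TwistData k K Y)

/-- The action of `K` on `K ⊗ U(Y)` by left multiplication. -/
noncomputable def leftOp : K →ₐ[k] Module.End k (K ⊗[k] J) :=
  (Module.End.rTensorAlgHom k K J).comp (Algebra.lmul k K)

@[simp] theorem leftOp_tmul (g h : K) (a : J) :
    leftOp (Y := Y) g (h ⊗ₜ[k] a) = (g * h) ⊗ₜ a := rfl

variable (k K Y) in
/-- The action of `U(Y)` on the second factor of `(K ⊗ U(Y)) ⊗ U(Y)`. -/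
noncomputable def lastOp : J →ₐ[k] Module.End k ((K ⊗[k] J) ⊗[k] J) :=
  (Module.End.lTensorAlgHom k J (K ⊗[k] J)).comp (Algebra.lmul k J)

variable (k K Y) in
/-- The action of endomorphisms of `K ⊗ U(Y)` on the first factor of `(K ⊗ U(Y)) ⊗ U(Y)`. -/
noncomputable def headOp : Module.End k (K ⊗[k] J) →ₐ[k] Module.End k ((K ⊗[k] J) ⊗[k] J) :=
  Module.End.rTensorAlgHom k (K ⊗[k] J) J

@[simp] theorem lastOp_tmul (a b : J) (p : K ⊗[k] J) :
    lastOp k K Y a (p ⊗ₜ[k] b) = p ⊗ₜ (a * b) := rfl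

@[simp] theorem headOp_tmul (F : Module.End k (K ⊗[k] J)) (b : J) (p : K ⊗[k] J) :
    headOp k K Y F (p ⊗ₜ[k] b) = F p ⊗ₜ b := rfl

theorem commute_headOp_lastOp (F : Module.End k (K ⊗[k] J)) (a : J) :
    Commute (headOp k K Y F) (lastOp k K Y a) := by
  ext
  rfl

theorem headOp_comp_lastOp_commute (f : J →ₐ[k] Module.End k (K ⊗[k] J)) (g : J →ₐ[k] J)
    (x y : Y) : Commute ((headOp k K Y).comp f (ι x)) ((lastOp k K Y).comp g (ι y)) :=
  commute_headOp_lastOp _ _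

variable [IsLieAbelian Y]

/-- The action of `Y` on `K ⊗ U(Y)`, in which `v` acts by left multiplication corrected by the
derivation `β(v, -)`. -/
noncomputable def op : Y →ₗ[k] Module.End k (K ⊗[k] J) where
  toFun v := (LinearMap.mulLeft k (ι v : J)).lTensor K +
    TensorProduct.map (LinearMap.mulLeft k T.lam) (partialDeriv (T.β v))
  map_add' v w := by
    ext h a
    simp [partialDeriv_add, add_mul, TensorProduct.tmul_add, -UniversalEnvelopingAlgebra.ι_apply]
    abel
  map_smul' c v := by
    ext h a
    simp [partialDeriv_smul, -UniversalEnvelopingAlgebra.ι_apply]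

@[simp] theorem op_tmul (v : Y) (h : K) (a : J) : T.op v (h ⊗ₜ[k] a) =
    h ⊗ₜ (ι v * a) + (T.lam * h) ⊗ₜ partialDeriv (T.β v) a := rfl

/-- The operators satisfy the relations of a twisted pair, so that ordered monomials act on
`K ⊗ U(Y)`; this defines the product. -/
theorem opPair : T.Pair leftOp T.op where
  comm g v := by
    ext h a
    simp only [TensorProduct.AlgebraTensorModule.curry_apply,
      LinearMap.restrictScalars_self, TensorProduct.curry_apply, Module.End.mul_apply, op_tmul,
      leftOp_tmul, map_add]
    rw [← mul_assoc, ← mul_assoc, (T.lam_comm g).eq]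
  rel v w := by
    ext h a
    simp only [TensorProduct.AlgebraTensorModule.curry_apply,
      LinearMap.restrictScalars_self, TensorProduct.curry_apply, Module.End.mul_apply, op_tmul,
      leftOp_tmul, map_add, LinearMap.sub_apply, LinearMap.smul_apply, partialDeriv_mul,
      partialDeriv_ι, TensorProduct.tmul_add, ← mul_assoc, ι_comm v w, smul_mul_assoc, one_mul,
      TensorProduct.tmul_smul, partialDeriv_comm (T.β v) (T.β w), sub_smul]
    abel

/-- The product of the twisted algebra structure on `K ⊗ U(Y)`. -/
noncomputable def mulOp : K ⊗[k] J →ₗ[k] K ⊗[k] J →ₗ[k] K ⊗[k] J := T.opPair.ext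

variable {T} {i : K →ₐ[k] Q} {η : Y →ₗ[k] Q}

theorem Pair.ext_leftOp (hp : T.Pair i η) (g : K) (p : K ⊗[k] J) :
    hp.ext (leftOp g p) = i g * hp.ext p := by
  induction p with
  | zero => simp
  | add _ _ h₁ h₂ => simp only [map_add, h₁, h₂, mul_add]
  | tmul h a => simp [hp.ext_tmul, mul_assoc]

theorem Pair.ext_op (hp : T.Pair i η) (v : Y) (p : K ⊗[k] J) :
    hp.ext (T.op v p) = η v * hp.ext p := by
  induction p with
  | zero => simp
  | add _ _ h₁ h₂ => simp only [map_add, h₁, h₂, mul_add]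
  | tmul h a =>
    rw [op_tmul, map_add, hp.ext_tmul, hp.ext_tmul, hp.ext_tmul,
      (T.lam_comm h).eq, map_mul i, mul_assoc, ← mul_add, hp.sec_ι_mul, ← mul_assoc, ← mul_assoc,
      (hp.comm h v).eq]

/-- The extension of a twisted pair is multiplicative for the twisted product. -/
theorem Pair.ext_mulOp (hp : T.Pair i η) (p q : K ⊗[k] J) :
    hp.ext (T.mulOp p q) = hp.ext p * hp.ext q := by
  have h1 : ∀ (a : J) q, hp.ext (T.opPair.first a q) = hp.first a * hp.ext q := fun a q =>
    env_equivariant T.opPair.first ((Algebra.lmul k Q).comp hp.first) hp.ext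
      (fun v q => by simp [T.opPair.first_ι, hp.first_ι, hp.ext_op,
        -UniversalEnvelopingAlgebra.ι_apply, - map_sub]) a q
  have h2 : ∀ (a : J) q, hp.ext (T.opPair.second a q) = hp.second a * hp.ext q := fun a q =>
    env_equivariant T.opPair.second ((Algebra.lmul k Q).comp hp.second) hp.ext
      (fun v q => by simp [T.opPair.second_ι, hp.second_ι, hp.ext_op,
        -UniversalEnvelopingAlgebra.ι_apply]) a q
  induction p with
  | zero => simp
  | add _ _ h₁ h₂ => simp only [map_add, LinearMap.add_apply, h₁, h₂, add_mul]
  | tmul h a =>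
    rw [mulOp, T.opPair.ext_tmul, hp.ext_tmul, Module.End.mul_apply, hp.ext_leftOp, mul_assoc]
    congr 1
    rw [T.opPair.sec_apply, hp.sec_apply]
    induction comul (R := k) a with
    | zero => simp
    | add _ _ h₁ h₂ => simp only [map_add, LinearMap.add_apply, h₁, h₂, add_mul]
    | tmul b c => simp [h1, h2, mul_assoc]

variable (T)

/-- Associativity is the multiplicativity of the extension of the regular pair. -/
theorem mulOp_assoc (p q t : K ⊗[k] J) : T.mulOp (T.mulOp p q) t = T.mulOp p (T.mulOp q t) :=
  LinearMap.congr_fun (T.opPair.ext_mulOp p q) t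

theorem mulOp_tmul (h : K) (a : J) (q : K ⊗[k] J) :
    T.mulOp (h ⊗ₜ a) q = leftOp h (T.opPair.sec a q) := rfl

theorem opPair_first_one_tmul (a b : J) : T.opPair.first a ((1 : K) ⊗ₜ[k] b) =
    (1 : K) ⊗ₜ (envMap (LinearMap.id - T.π) a * b) := by
  refine (env_equivariant ((Algebra.lmul k J).comp (envMap (LinearMap.id - T.π))) T.opPair.first
    (TensorProduct.mk k K J 1) (fun v c => ?_) a b).symm
  have h : T.β (v - T.π v) = 0 := LinearMap.ext (T.β_compl v)
  have h0 : partialDeriv (0 : Y →ₗ[k] k) c = 0 := by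
    simpa using LinearMap.congr_fun (partialDeriv_smul (0 : k) (0 : Y →ₗ[k] k)) c
  rw [T.opPair.first_ι, TensorProduct.mk_apply, TensorProduct.mk_apply, op_tmul, h, h0,
    TensorProduct.tmul_zero, add_zero]
  simp only [AlgHom.comp_apply, envMap_ι]
  rfl

theorem partialDeriv_envMap_π (v : Y) (a : J) : partialDeriv (T.β v) (envMap T.π a) = 0 := by
  refine LinearMap.congr_fun (f := partialDeriv (T.β v) ∘ₗ (envMap T.π).toLinearMap) (g := 0) ?_ a
  apply env_leibniz_ext (envMap T.π)
  · intro a b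
    simp [partialDeriv_mul]
  · simp
  · intro w
    simp [envMap_ι, partialDeriv_ι, T.β_right, -UniversalEnvelopingAlgebra.ι_apply]

theorem opPair_second_one (a : J) : T.opPair.second a ((1 : K) ⊗ₜ[k] (1 : J)) =
    (1 : K) ⊗ₜ envMap T.π a := by
  let i₂ : J →ₗ[k] K ⊗[k] J := TensorProduct.mk k K J 1 ∘ₗ (envMap T.π).toLinearMap
  have := (env_equivariant (Algebra.lmul k J) T.opPair.second i₂ (fun v c => ?_) a 1).symm
  · simpa [i₂] using this
  · simp [i₂, T.opPair.second_ι, envMap_ι, partialDeriv_envMap_π,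
      -UniversalEnvelopingAlgebra.ι_apply]

theorem convOf_envMap :
    convOf (envMap (LinearMap.id - T.π)) * convOf (envMap T.π) = convOf (AlgHom.id k J) := by
  apply convOf_mul_eq_convOf
  · intro x y
    rw [envMap_ι, envMap_ι]
    exact ι_comm _ _
  · intro x
    rw [envMap_ι, envMap_ι, ← map_add]
    simp [-UniversalEnvelopingAlgebra.ι_apply]

/-- Applied to the unit, the ordered monomial map is the identity of `U(Y)`. -/
theorem opPair_sec_one_tmul_one (a : J) :
    T.opPair.sec a ((1 : K) ⊗ₜ[k] (1 : J)) = (1 : K) ⊗ₜ a := by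
  have h : a = LinearMap.mul' k J (TensorProduct.map
      (envMap (LinearMap.id - T.π)).toLinearMap (envMap T.π).toLinearMap (comul a)) :=
    (congrArg (fun F => F.ofConv a) T.convOf_envMap).symm
  rw [T.opPair.sec_apply]
  conv_rhs => rw [h]
  induction comul (R := k) a with
  | zero => simp
  | add _ _ h₁ h₂ => simp only [map_add, LinearMap.add_apply, h₁, h₂, TensorProduct.tmul_add]
  | tmul b c => simp [opPair_second_one, opPair_first_one_tmul]

theorem mulOp_one (p : K ⊗[k] J) : T.mulOp p 1 = p := by
  induction p with
  | zero => simp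
  | add _ _ h₁ h₂ => simp only [map_add, LinearMap.add_apply, h₁, h₂]
  | tmul h a =>
    rw [mulOp_tmul, Algebra.TensorProduct.one_def, opPair_sec_one_tmul_one, leftOp_tmul, mul_one]

theorem one_mulOp (p : K ⊗[k] J) : T.mulOp 1 p = p := by
  rw [Algebra.TensorProduct.one_def, mulOp_tmul, T.opPair.sec_one, map_one]
  rfl

/-! ### The twisted product as a comodule algebra -/

/-- The coaction `id ⊗ Δ` of `U(Y)` on `K ⊗ U(Y)`. -/
noncomputable def coact : K ⊗[k] J →ₗ[k] (K ⊗[k] J) ⊗[k] J :=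
  (TensorProduct.assoc k K J J).symm.toLinearMap ∘ₗ (comul (R := k)).lTensor K

theorem coact_op (v : Y) (q : K ⊗[k] J) : coact (T.op v q) =
    (headOp k K Y (T.op v) + lastOp k K Y (ι v) : Module.End k ((K ⊗[k] J) ⊗[k] J)) (coact q) := by
  induction q with
  | zero => simp
  | add _ _ h₁ h₂ => rw [map_add, map_add, map_add, map_add, h₁, h₂]
  | tmul g b =>
    simp only [coact, op_tmul, LinearMap.comp_apply, map_add, LinearMap.lTensor_tmul,
      Bialgebra.comul_mul, comul_ι, comul_partialDeriv, add_mul]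
    induction comul (R := k) b with
    | zero => simp
    | add _ _ h₁ h₂ =>
      simp only [mul_add, map_add, TensorProduct.tmul_add] at h₁ h₂ ⊢
      rw [← h₁, ← h₂]
      abel
    | tmul c d =>
      simp [TensorProduct.add_tmul, TensorProduct.tmul_add,
        -UniversalEnvelopingAlgebra.ι_apply]
      abel

/-- The action on `(K ⊗ U(Y)) ⊗ U(Y)` of the part `f` of the regular representation. -/
noncomputable def coactHom (f : J →ₐ[k] Module.End k (K ⊗[k] J)) (g : J →ₐ[k] J) :
    J →ₐ[k] Module.End k ((K ⊗[k] J) ⊗[k] J) :=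
  convHom (k := k) (L := Y) (Q := Module.End k ((K ⊗[k] J) ⊗[k] J)) ((headOp k K Y).comp f)
    ((lastOp k K Y).comp g) (headOp_comp_lastOp_commute f g)

theorem coact_equivariant {f : J →ₐ[k] Module.End k (K ⊗[k] J)} {p : Y →ₗ[k] Y}
    (h : ∀ v, f (ι v) = T.op (p v)) (a : J) (q : K ⊗[k] J) :
    coact (f a q) = coactHom f (envMap p) a (coact q) := by
  refine env_equivariant f (coactHom f (envMap p)) coact (fun v q => ?_) a q
  rw [coactHom, h, coact_op, convHom_ι, AlgHom.comp_apply, AlgHom.comp_apply, h, envMap_ι]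

local notation "conv₂" => convOf (k := k) (L := Y) (Q := Module.End k ((K ⊗[k] J) ⊗[k] J))

theorem convOf_lastOp :
    conv₂ ((lastOp k K Y).comp (envMap (.id - T.π))) *
      conv₂ ((lastOp k K Y).comp (envMap T.π)) = conv₂ (lastOp k K Y) := by
  rw [← convOf_comp_mul, convOf_envMap]
  rfl

theorem convOf_coactHom :
    conv₂ (coactHom T.opPair.first (envMap (.id - T.π))) *
      conv₂ (coactHom T.opPair.second (envMap T.π)) =
      toConv ((headOp k K Y).toLinearMap ∘ₗ T.opPair.sec) * conv₂ (lastOp k K Y) := by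
  have hc := headOp_comp_lastOp_commute (K := K) T.opPair.second (envMap (.id - T.π))
  rw [coactHom, coactHom, convOf_convHom, convOf_convHom,
    convOf_mul_mul_mul_comm (Q := Module.End k ((K ⊗[k] J) ⊗[k] J)) hc, convOf_lastOp,
    ← convOf_comp_mul]
  rfl

/-- The ordered monomial map is colinear. -/
theorem coact_sec (a : J) (q : K ⊗[k] J) : coact (T.opPair.sec a q) =
    LinearMap.mul' k (Module.End k ((K ⊗[k] J) ⊗[k] J))
      (TensorProduct.map ((headOp k K Y).toLinearMap ∘ₗ T.opPair.sec)
        (lastOp k K Y).toLinearMap (comul a))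
      (coact q) := by
  have h1 := T.coact_equivariant (f := T.opPair.first) (p := .id - T.π)
    (fun v => by rw [T.opPair.first_ι, LinearMap.sub_apply, LinearMap.id_apply])
  have h2 := T.coact_equivariant (f := T.opPair.second) (p := T.π) T.opPair.second_ι
  have h3 := LinearMap.congr_fun (congrArg WithConv.ofConv T.convOf_coactHom) a
  rw [LinearMap.convMul_def, LinearMap.convMul_def] at h3
  simp only [LinearMap.comp_apply] at h3
  rw [← h3, T.opPair.sec_apply]
  induction comul (R := k) a with
  | zero => simp
  | add _ _ h₁ h₂ => simp only [map_add, LinearMap.add_apply, h₁, h₂]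
  | tmul b c => simp [h1, h2]

/-- The cocycle of the twisted product: the `K`-component of the product of `a` and `b`. -/
noncomputable def cocycle : J →ₗ[k] J →ₗ[k] K :=
  LinearMap.compr₂ (T.opPair.sec.compl₂ (TensorProduct.mk k K J 1))
    ((TensorProduct.rid k K).toLinearMap ∘ₗ (counit (R := k)).lTensor K)

theorem cocycle_apply (a b : J) : T.cocycle a b =
    TensorProduct.rid k K ((counit (R := k)).lTensor K (T.opPair.sec a (1 ⊗ₜ[k] b))) := rfl

/-- The product of `1 ⊗ a` and `1 ⊗ b` is `σ(a₁, b₁) ⊗ a₂ b₂`. -/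
theorem opPair_sec_one_tmul (a b : J) : T.opPair.sec a ((1 : K) ⊗ₜ[k] b) =
    TensorProduct.map₂ T.cocycle (LinearMap.mul k J) (comul a) (comul b) := by
  let E : (K ⊗[k] J) ⊗[k] J →ₗ[k] K ⊗[k] J :=
    ((TensorProduct.rid k K).toLinearMap ∘ₗ (counit (R := k)).lTensor K).rTensor J
  have hE : ∀ q, E (coact q) = q := by
    intro q
    induction q with
    | zero => simp
    | add _ _ h₁ h₂ => rw [map_add, map_add, h₁, h₂]
    | tmul g b =>
      have : b = TensorProduct.lid k J ((counit (R := k)).rTensor J (comul b)) := by simp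
      conv_rhs => rw [this]
      simp only [coact, LinearMap.comp_apply, LinearMap.lTensor_tmul]
      induction comul (R := k) b with
      | zero => simp
      | add _ _ h₁ h₂ => simp only [map_add, TensorProduct.tmul_add, h₁, h₂]
      | tmul c d => simp [E, TensorProduct.smul_tmul]
  have h := congrArg E (T.coact_sec a (1 ⊗ₜ[k] b))
  rw [hE] at h
  rw [h]
  simp only [coact, LinearMap.comp_apply, LinearMap.lTensor_tmul]
  induction comul (R := k) a with
  | zero => simp
  | add _ _ h₁ h₂ => simp only [map_add, LinearMap.add_apply, h₁, h₂]
  | tmul a₁ a₂ =>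
    induction comul (R := k) b with
    | zero => simp
    | add _ _ h₁ h₂ => simp only [map_add, TensorProduct.tmul_add, h₁, h₂]
    | tmul b₁ b₂ => simp [E, cocycle_apply]

theorem mulOp_tmul_tmul (h g : K) (a b : J) : T.mulOp (h ⊗ₜ a) (g ⊗ₜ b) =
    leftOp (h * g) (TensorProduct.map₂ T.cocycle (LinearMap.mul k J) (comul a) (comul b)) := by
  have e : (g ⊗ₜ[k] b : K ⊗[k] J) = leftOp g (1 ⊗ₜ b) := by simp
  rw [mulOp_tmul, e, ← Module.End.mul_apply (T.opPair.sec a), ← (T.opPair.commute_sec g a).eq,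
    Module.End.mul_apply, opPair_sec_one_tmul, map_mul, Module.End.mul_apply]

theorem cocycle_one_left (a : J) : T.cocycle 1 a = counit (R := k) a • (1 : K) := by
  simp [cocycle_apply, T.opPair.sec_one]

theorem cocycle_one_right (a : J) : T.cocycle a 1 = counit (R := k) a • (1 : K) := by
  simp [cocycle_apply, opPair_sec_one_tmul_one]

theorem cocycle_ι (v w : Y) : T.cocycle (ι v) (ι w) = T.β v w • T.lam := by
  simp [cocycle_apply, T.opPair.sec_ι, partialDeriv_ι, counit_ι,
    -UniversalEnvelopingAlgebra.ι_apply]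

end TwistData
end Twist

/-! ### Crossed products with trivial data -/

section CrossedTrivial

variable {k : Type u} [Field k] {K : Type v} {J : Type w}
  [Ring K] [HopfAlgebra k K] [Ring J] [HopfAlgebra k J] {D : CrossedData k K J}

namespace CrossedData

theorem TrivialAction.isWeakAction (h : D.TrivialAction) : D.IsWeakAction where
  one_act g := by simp [h 1 g]
  act_one a := h a 1
  act_mul a g g' := by
    have key : ∀ t : J ⊗[k] J, LinearMap.mul' k K
        (TensorProduct.map (D.γ.flip g) (D.γ.flip g') t) =
        D.γ.flip (g * g') (TensorProduct.lid k J ((counit (R := k)).rTensor J t)) := by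
      intro t
      induction t with
      | zero => simp
      | add _ _ h₁ h₂ => simp only [map_add, h₁, h₂]
      | tmul b c => simp [h _ _, smul_smul, mul_comm]
    rw [key]
    simp

theorem TrivialCoaction.isWeakCoaction (h : D.TrivialCoaction) : D.IsWeakCoaction where
  counit_right a := by simp [h a]
  counit_left a := by simp [h a]
  comul_left a := by
    rw [h a, LinearMap.rTensor_tmul]
    induction comul (R := k) a with
    | zero => simp
    | add _ _ h₁ h₂ => simp only [map_add, TensorProduct.add_tmul, h₁, h₂]
    | tmul b c => simp [h b, h c]

theorem TrivialCocycle.twist_eq (h : D.TrivialCocycle) (a b : J) :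
    D.twist a b = 1 ⊗ₜ (a * b) := by
  have key : ∀ s t : J ⊗[k] J, TensorProduct.map₂ D.σ (LinearMap.mul k J) s t =
      1 ⊗ₜ[k] (TensorProduct.lid k J ((counit (R := k)).rTensor J s) *
        TensorProduct.lid k J ((counit (R := k)).rTensor J t)) := by
    intro s t
    induction s with
    | zero => simp
    | add _ _ h₁ h₂ =>
      simp only [map_add, LinearMap.add_apply, add_mul, TensorProduct.tmul_add, h₁, h₂]
    | tmul b c =>
      induction t with
      | zero => simp
      | add _ _ h₁ h₂ => simp only [map_add, mul_add, TensorProduct.tmul_add, h₁, h₂]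
      | tmul b' c' => simp [h _ _, TensorProduct.smul_tmul', smul_smul, mul_comm]
  refine (key _ _).trans ?_
  simp

theorem TrivialCocycle.isCocycle (h : D.TrivialCocycle) (hγ : D.IsWeakAction) : D.IsCocycle where
  one_left a := by simp [h 1 a]
  one_right a := by simp [h a 1]
  cocycle a b c := by
    rw [h.twist_eq, h.twist_eq]
    have key : ∀ (t : J ⊗[k] J) (d : J), LinearMap.mul' k K
        (TensorProduct.map₂ D.γ D.σ t (1 ⊗ₜ d)) =
        D.σ (TensorProduct.lid k J ((counit (R := k)).rTensor J t)) d := by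
      intro t d
      induction t with
      | zero => simp
      | add _ _ h₁ h₂ => simp only [map_add, LinearMap.add_apply, h₁, h₂]
      | tmul b c => simp [h _ _, hγ.act_one, smul_smul, mul_comm, mul_left_comm]
    rw [key]
    simp [h _ _, mul_assoc]

theorem TrivialCococycle.isCococycle (h : D.TrivialCococycle) (hρ : D.TrivialCoaction) :
    D.IsCococycle where
  counit_left a := by simp [h a]
  counit_right a := by simp [h a]
  cococycle a := by
    induction comul (R := k) a with
    | zero => simp
    | add _ _ h₁ h₂ => simp only [map_add, h₁, h₂]
    | tmul b c =>
      simp only [h _, hρ _, Algebra.TensorProduct.one_def, TensorProduct.map_tmul, map_smul,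
        LinearMap.comp_apply, LinearMap.rTensor_tmul, LinearMap.lTensor_tmul, Bialgebra.comul_one,
        TensorProduct.mk_apply, LinearMap.mul'_apply, Algebra.TensorProduct.tmul_mul_tmul, mul_one,
        ← TensorProduct.smul_tmul', TensorProduct.tmul_smul,
        TensorProduct.assoc_tmul]

theorem TrivialCoaction.coswap_eq (h : D.TrivialCoaction) (a : J) : D.coswap a =
    TensorProduct.map (TensorProduct.mk k K J 1) (TensorProduct.mk k K J 1) (comul a) := by
  rw [coswap, LinearMap.comp_apply, LinearMap.comp_apply, LinearMap.comp_apply]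
  induction comul (R := k) a with
  | zero => simp
  | add _ _ h₁ h₂ => simp only [map_add, h₁, h₂]
  | tmul b c => simp [h _]

theorem TrivialCocycle.mul_tmul (h : D.TrivialCocycle) (g g' : K) (a b : J) :
    D.mul (g ⊗ₜ a) (g' ⊗ₜ b) =
      (g ⊗ₜ[k] (1 : J)) * (((D.γ.flip g').rTensor J (comul a)) * ((1 : K) ⊗ₜ b)) := by
  simp only [mul, TensorProduct.lift.tmul, LinearMap.mk₂_apply, swap]
  congr 1
  induction comul (R := k) a with
  | zero => simp
  | add _ _ h₁ h₂ => simp only [map_add, LinearMap.add_apply, add_mul, h₁, h₂]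
  | tmul c d => simp [straighten, h.twist_eq]

theorem TrivialAction.mul_tmul (h : D.TrivialAction) (g g' : K) (a b : J) :
    D.mul (g ⊗ₜ a) (g' ⊗ₜ b) = ((g * g') ⊗ₜ[k] (1 : J)) * D.twist a b := by
  have hs : D.swap a g' = g' ⊗ₜ a := by
    have key : ∀ t : J ⊗[k] J, (D.γ.flip g').rTensor J t =
        g' ⊗ₜ[k] (TensorProduct.lid k J ((counit (R := k)).rTensor J t)) := by
      intro t
      induction t with
      | zero => simp
      | add _ _ h₁ h₂ => simp only [map_add, TensorProduct.tmul_add, h₁, h₂]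
      | tmul b c => simp [h _ _, TensorProduct.smul_tmul]
    refine (key (comul a)).trans ?_
    simp
  simp only [mul, TensorProduct.lift.tmul, LinearMap.mk₂_apply, hs, straighten]
  simp [← mul_assoc]

end CrossedData

end CrossedTrivial

/-! ### Crossed products inside a Hopf algebra -/

section Transport

variable {k : Type u} [Field k] {K : Type v} {J : Type w}
  [Ring K] [HopfAlgebra k K] [Ring J] [HopfAlgebra k J]
  {A : Type*} [Ring A] [HopfAlgebra k A]

/-- A linear map `K ⊗ J → A` compatible with the structure maps of a crossed product. -/
structure CrossedData.IsHopfMap (D : CrossedData k K J) (θ : K ⊗[k] J →ₗ[k] A) : Prop where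
  map_one : θ 1 = 1
  map_mul : ∀ p q, θ (D.mul p q) = θ p * θ q
  map_comul : ∀ p, comul (R := k) (θ p) = TensorProduct.map θ θ (D.comulMap p)
  map_counit : ∀ p, counit (R := k) (θ p) = (CrossedData.counitMap p : k)

namespace CrossedData

variable {D : CrossedData k K J} {θ : K ⊗[k] J →ₗ[k] A}

theorem IsHopfMap.map_map₂ (h : D.IsHopfMap θ) (s t : (K ⊗[k] J) ⊗[k] (K ⊗[k] J)) :
    TensorProduct.map θ θ (TensorProduct.map₂ D.mul D.mul s t) =
      TensorProduct.map θ θ s * TensorProduct.map θ θ t := by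
  induction s with
  | zero => simp
  | add _ _ h₁ h₂ => simp only [map_add, LinearMap.add_apply, add_mul, h₁, h₂]
  | tmul p q =>
    induction t with
    | zero => simp
    | add _ _ h₁ h₂ => simp only [map_add, mul_add, h₁, h₂]
    | tmul p' q' => simp [h.map_mul]

/-- A crossed product is a Hopf algebra if it embeds in a Hopf algebra as a subspace that is stable
under the antipode. -/
noncomputable def IsHopfMap.crossedSystem (h : D.IsHopfMap θ) (hθ : Function.Injective θ)
    (hγ : D.IsWeakAction) (hρ : D.IsWeakCoaction) (hσ : D.IsCocycle) (hτ : D.IsCococycle)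
    (hS : ∀ p, HopfAlgebra.antipode k (θ p) ∈ LinearMap.range θ) : CrossedSystem k K J :=
  -- over a field, the tensor powers of an injective map are injective, so that each axiom may be
  -- checked in `A`
  have inj₂ : Function.Injective (TensorProduct.map θ θ) :=
    TensorProduct.map_injective_of_flat_flat θ θ hθ hθ
  have inj₃ : Function.Injective (TensorProduct.map θ (TensorProduct.map θ θ)) :=
    TensorProduct.map_injective_of_flat_flat _ _ hθ inj₂
  let S : K ⊗[k] J →ₗ[k] K ⊗[k] J := (LinearEquiv.ofInjective θ hθ).symm.toLinearMap ∘ₗ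
    (HopfAlgebra.antipode k ∘ₗ θ).codRestrict (LinearMap.range θ) hS
  have hθS : ∀ p, θ (S p) = HopfAlgebra.antipode k (θ p) := fun p =>
    congrArg Subtype.val ((LinearEquiv.ofInjective θ hθ).apply_symm_apply
      ((HopfAlgebra.antipode k ∘ₗ θ).codRestrict (LinearMap.range θ) hS p))
  { D with
    weakAction := hγ
    weakCoaction := hρ
    cocycle := hσ
    cococycle := hτ
    one_mul := fun p => hθ (by rw [h.map_mul, h.map_one, one_mul])
    mul_one := fun p => hθ (by rw [h.map_mul, h.map_one, mul_one])
    mul_assoc := fun p q t => hθ (by simp only [h.map_mul, mul_assoc])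
    coassoc := by
      refine LinearMap.ext fun p => inj₃ ?_
      have h1 : ∀ t, TensorProduct.map θ (TensorProduct.map θ θ)
          (TensorProduct.assoc k (K ⊗[k] J) (K ⊗[k] J) (K ⊗[k] J)
            (D.comulMap.rTensor (K ⊗[k] J) t)) =
          TensorProduct.assoc k A A A ((comul (R := k)).rTensor A (TensorProduct.map θ θ t)) := by
        intro t
        induction t with
        | zero => simp
        | add _ _ h₁ h₂ => simp only [map_add, h₁, h₂]
        | tmul q q' =>
          rw [TensorProduct.map_tmul, LinearMap.rTensor_tmul, LinearMap.rTensor_tmul, h.map_comul]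
          induction D.comulMap q with
          | zero => simp
          | add _ _ h₁ h₂ => simp only [map_add, TensorProduct.add_tmul, h₁, h₂]
          | tmul _ _ => simp
      have h2 : ∀ t, TensorProduct.map θ (TensorProduct.map θ θ)
          (D.comulMap.lTensor (K ⊗[k] J) t) =
          (comul (R := k)).lTensor A (TensorProduct.map θ θ t) := by
        intro t
        induction t with
        | zero => simp
        | add _ _ h₁ h₂ => simp only [map_add, h₁, h₂]
        | tmul q q' => simp [h.map_comul]
      simp only [LinearMap.comp_apply, LinearEquiv.coe_coe]
      rw [h1, h2, ← h.map_comul]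
      exact Coalgebra.coassoc_apply _
    rTensor_counit := by
      have i1 : Function.Injective (θ.lTensor k) :=
        Module.Flat.lTensor_preserves_injective_linearMap θ hθ
      refine LinearMap.ext fun p => i1 ?_
      have h1 : ∀ t, θ.lTensor k (CrossedData.counitMap.rTensor (K ⊗[k] J) t) =
          (counit (R := k)).rTensor A (TensorProduct.map θ θ t) := by
        intro t
        induction t with
        | zero => simp
        | add _ _ h₁ h₂ => simp only [map_add, h₁, h₂]
        | tmul q q' => simp [h.map_counit]
      rw [LinearMap.comp_apply, h1, ← h.map_comul, Coalgebra.rTensor_counit_comul]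
      rfl
    lTensor_counit := by
      have i1 : Function.Injective (θ.rTensor k) :=
        Module.Flat.rTensor_preserves_injective_linearMap θ hθ
      refine LinearMap.ext fun p => i1 ?_
      have h1 : ∀ t, θ.rTensor k (CrossedData.counitMap.lTensor (K ⊗[k] J) t) =
          (counit (R := k)).lTensor A (TensorProduct.map θ θ t) := by
        intro t
        induction t with
        | zero => simp
        | add _ _ h₁ h₂ => simp only [map_add, h₁, h₂]
        | tmul q q' => simp [h.map_counit]
      rw [LinearMap.comp_apply, h1, ← h.map_comul, Coalgebra.lTensor_counit_comul]
      rfl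
    counit_one := by rw [← h.map_counit, h.map_one, Bialgebra.counit_one]
    counit_mul := fun p q => by
      rw [← h.map_counit, h.map_mul, Bialgebra.counit_mul, h.map_counit, h.map_counit]
    comul_one := inj₂ (by
      rw [← h.map_comul, h.map_one, Bialgebra.comul_one, TensorProduct.map_tmul, h.map_one]
      rfl)
    comul_mul := fun p q => inj₂ (by
      rw [← h.map_comul, h.map_mul, Bialgebra.comul_mul, h.map_map₂, h.map_comul, h.map_comul])
    antipode := S
    antipode_left := fun p => hθ (by
      have h1 : ∀ t, θ (TensorProduct.lift D.mul (S.rTensor (K ⊗[k] J) t)) =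
          LinearMap.mul' k A ((HopfAlgebra.antipode k).rTensor A (TensorProduct.map θ θ t)) := by
        intro t
        induction t with
        | zero => simp
        | add _ _ h₁ h₂ => simp only [map_add, h₁, h₂]
        | tmul q q' => simp [h.map_mul, hθS]
      rw [h1, ← h.map_comul, HopfAlgebra.mul_antipode_rTensor_comul_apply, map_smul, h.map_one,
        h.map_counit, Algebra.algebraMap_eq_smul_one])
    antipode_right := fun p => hθ (by
      have h1 : ∀ t, θ (TensorProduct.lift D.mul (S.lTensor (K ⊗[k] J) t)) =
          LinearMap.mul' k A ((HopfAlgebra.antipode k).lTensor A (TensorProduct.map θ θ t)) := by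
        intro t
        induction t with
        | zero => simp
        | add _ _ h₁ h₂ => simp only [map_add, h₁, h₂]
        | tmul q q' => simp [h.map_mul, hθS]
      rw [h1, ← h.map_comul, HopfAlgebra.mul_antipode_lTensor_comul_apply, map_smul, h.map_one,
        h.map_counit, Algebra.algebraMap_eq_smul_one]) }

end CrossedData

namespace CrossedSystem

variable {D : CrossedSystem k K J} {θ : K ⊗[k] J →ₗ[k] A}

/-- A linear map compatible with the structure maps of a crossed product is a map of bialgebras. -/
noncomputable def bialgHom (D : CrossedSystem k K J) {θ : K ⊗[k] J →ₗ[k] A}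
    (h : D.toCrossedData.IsHopfMap θ) : D.Prod →ₐc[k] A :=
  BialgHom.ofAlgHom (AlgHom.ofLinearMap (A := D.Prod) θ h.map_one h.map_mul)
    (AlgHom.ext fun p => h.map_counit p)
    (AlgHom.ext fun p => (h.map_comul p).symm)

end CrossedSystem

end Transport

/-! ### The twisted product as an algebra -/

section TwistAlg

variable {k : Type*} [CommRing k] {K : Type*} [Ring K] [Algebra k K] {Y : Type*} [LieRing Y]
  [LieAlgebra k Y] [IsLieAbelian Y] {Q : Type*} [Ring Q] [Algebra k Q]

local notation "J" => UniversalEnvelopingAlgebra k Y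
local notation "ι" => UniversalEnvelopingAlgebra.ι k

/-- The vector space `K ⊗ U(Y)` with the twisted product. -/
def TwistData.Alg (_T : TwistData k K Y) : Type _ := K ⊗[k] J

namespace TwistData

variable (T : TwistData k K Y)

noncomputable instance : AddCommGroup T.Alg := inferInstanceAs (AddCommGroup (K ⊗[k] J))

noncomputable instance : Module k T.Alg := inferInstanceAs (Module k (K ⊗[k] J))

noncomputable instance : Ring T.Alg :=
  { (inferInstance : AddCommGroup T.Alg) with
    one := ((1 : K ⊗[k] J) : K ⊗[k] J)
    mul := fun p q => T.mulOp p q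
    one_mul := T.one_mulOp
    mul_one := T.mulOp_one
    mul_assoc := T.mulOp_assoc
    left_distrib := fun p q t => map_add (T.mulOp p) q t
    right_distrib := fun p q t => LinearMap.map_add₂ T.mulOp p q t
    zero_mul := fun p => LinearMap.map_zero₂ T.mulOp p
    mul_zero := fun p => map_zero (T.mulOp p) }

noncomputable instance : Algebra k T.Alg :=
  Algebra.ofModule (fun c p q => LinearMap.map_smul₂ T.mulOp c p q)
    (fun c p q => map_smul (T.mulOp p) c q)

/-- The identity map from `K ⊗ U(Y)` to the twisted product. -/
noncomputable def toAlg : K ⊗[k] J ≃ₗ[k] T.Alg := LinearEquiv.refl k (K ⊗[k] J)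

theorem toAlg_mulOp (p q : K ⊗[k] J) : T.toAlg (T.mulOp p q) = T.toAlg p * T.toAlg q := rfl

/-- The inclusion of `K` in the twisted product. -/
noncomputable def algK : K →ₐ[k] T.Alg :=
  AlgHom.ofLinearMap (T.toAlg.toLinearMap ∘ₗ (TensorProduct.mk k K J).flip 1) rfl (by
    intro g h
    change T.toAlg ((g * h) ⊗ₜ 1) = T.toAlg (g ⊗ₜ 1) * T.toAlg (h ⊗ₜ 1)
    rw [← toAlg_mulOp, mulOp_tmul, T.opPair.sec_one]
    rfl)

/-- The inclusion of `Y` in the twisted product. -/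
noncomputable def algY : Y →ₗ[k] T.Alg := T.toAlg.toLinearMap ∘ₗ TensorProduct.mk k K J 1 ∘ₗ envInc

theorem algK_apply (g : K) : T.algK g = T.toAlg (g ⊗ₜ 1) := rfl

theorem algY_apply (v : Y) : T.algY v = T.toAlg (1 ⊗ₜ ι v) := rfl

theorem algK_mul (g : K) (p : K ⊗[k] J) : T.algK g * T.toAlg p = T.toAlg (leftOp g p) := by
  rw [algK_apply, ← toAlg_mulOp, mulOp_tmul, T.opPair.sec_one]
  rfl

theorem algY_mul (v : Y) (p : K ⊗[k] J) : T.algY v * T.toAlg p = T.toAlg (T.op v p) := by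
  rw [algY_apply, ← toAlg_mulOp, mulOp_tmul, T.opPair.sec_ι, map_one]
  rfl

theorem algPair : T.Pair T.algK T.algY where
  comm g v := by
    change T.algK g * T.algY v = T.algY v * T.algK g
    rw [algY_apply, algK_mul, ← algY_apply, algK_apply, algY_mul]
    simp [partialDeriv_one, -UniversalEnvelopingAlgebra.ι_apply]
  rel v w := by
    nth_rewrite 2 [algY_apply]
    nth_rewrite 3 [algY_apply]
    rw [algY_mul, algY_mul, algK_apply, ← map_sub, ← map_smul]
    congr 1
    simp [partialDeriv_ι, ι_comm v w, sub_smul, -UniversalEnvelopingAlgebra.ι_apply]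

theorem algPair_sec (a : J) : T.algPair.sec a = T.toAlg (1 ⊗ₜ a) := by
  have h1 : ∀ (a : J) p, T.toAlg (T.opPair.first a p) = T.algPair.first a * T.toAlg p := fun a p =>
    env_equivariant T.opPair.first ((Algebra.lmul k T.Alg).comp T.algPair.first)
      T.toAlg.toLinearMap (fun v q => by
        rw [T.opPair.first_ι, AlgHom.comp_apply, T.algPair.first_ι]
        exact (T.algY_mul _ q).symm) a p
  have h2 : ∀ (a : J) p, T.toAlg (T.opPair.second a p) = T.algPair.second a * T.toAlg p :=
    fun a p => env_equivariant T.opPair.second ((Algebra.lmul k T.Alg).comp T.algPair.second)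
      T.toAlg.toLinearMap (fun v q => by
        rw [T.opPair.second_ι, AlgHom.comp_apply, T.algPair.second_ι]
        exact (T.algY_mul _ q).symm) a p
  rw [← T.opPair_sec_one_tmul_one, ← mul_one (T.algPair.sec a), T.algPair.sec_apply,
    T.opPair.sec_apply]
  induction comul (R := k) a with
  | zero => simp
  | add _ _ h₁ h₂ => simp only [map_add, LinearMap.add_apply, h₁, h₂, add_mul]
  | tmul b c =>
    simp only [TensorProduct.map_tmul, LinearMap.mul'_apply, AlgHom.toLinearMap_apply,
      Module.End.mul_apply, h1, h2, mul_assoc]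
    rfl

/-- The twisted product is generated by `K` and `Y`. -/
theorem subalgebra_eq_top (S : Subalgebra k T.Alg) (hK : ∀ g, T.algK g ∈ S)
    (hY : ∀ v, T.algY v ∈ S) : S = ⊤ := by
  have h1 : ∀ a, T.algPair.first a ∈ S := env_induction (S.comap T.algPair.first)
    (fun a ha => ha) (fun v => by
      change T.algPair.first (ι v) ∈ S
      rw [T.algPair.first_ι]; exact hY _)
  have h2 : ∀ a, T.algPair.second a ∈ S := env_induction (S.comap T.algPair.second)
    (fun a ha => ha) (fun v => by
      change T.algPair.second (ι v) ∈ S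
      rw [T.algPair.second_ι]; exact hY _)
  have h3 : ∀ a, T.algPair.sec a ∈ S := by
    intro a
    rw [T.algPair.sec_apply]
    induction comul (R := k) a with
    | zero => simp
    | add _ _ h₁ h₂ => rw [map_add, map_add]; exact S.add_mem h₁ h₂
    | tmul b c => exact S.mul_mem (h1 b) (h2 c)
  rw [eq_top_iff]
  rintro p -
  obtain ⟨p, rfl⟩ := T.toAlg.surjective p
  induction p with
  | zero => rw [map_zero]; exact S.zero_mem
  | add _ _ h₁ h₂ => rw [map_add]; exact S.add_mem h₁ h₂
  | tmul g a =>
    have := S.mul_mem (hK g) (h3 a)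
    rwa [algPair_sec, algK_mul, leftOp_tmul, mul_one] at this

variable {T} {i : K →ₐ[k] Q} {η : Y →ₗ[k] Q}

/-- The universal property of the twisted product. -/
noncomputable def Pair.lift (hp : T.Pair i η) : T.Alg →ₐ[k] Q :=
  AlgHom.ofLinearMap (A := T.Alg) hp.ext
    ((hp.ext_tmul 1 1).trans (by rw [hp.sec_one, map_one, one_mul])) hp.ext_mulOp

theorem Pair.lift_algK (hp : T.Pair i η) (g : K) : hp.lift (T.algK g) = i g :=
  (hp.ext_tmul g 1).trans (by rw [hp.sec_one, mul_one])

theorem Pair.lift_algY (hp : T.Pair i η) (v : Y) : hp.lift (T.algY v) = η v :=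
  (hp.ext_tmul 1 _).trans (by rw [envInc_apply, hp.sec_ι, map_one, one_mul])

end TwistData

theorem TwistData.subalgebra_eq_top_of_env {L : Type*} [LieRing L] [LieAlgebra k L]
    (T : TwistData k (UniversalEnvelopingAlgebra k L) Y) (S : Subalgebra k T.Alg)
    (hL : ∀ x : L, T.algK (ι x) ∈ S) (hY : ∀ v, T.algY v ∈ S) : S = ⊤ :=
  T.subalgebra_eq_top S (env_induction (S.comap T.algK) (fun _ ha => ha) hL) hY

/-- When `K` is an enveloping algebra, a linear map satisfying the Leibniz rule is determined by its
values on the generators. -/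
theorem TwistData.alg_leibniz_ext {L : Type*} [LieRing L] [LieAlgebra k L]
    {T : TwistData k (UniversalEnvelopingAlgebra k L) Y} (f : T.Alg →ₐ[k] Q) {D E : T.Alg →ₗ[k] Q}
    (hD : ∀ a b, D (a * b) = f a * D b + D a * f b)
    (hE : ∀ a b, E (a * b) = f a * E b + E a * f b)
    (hL : ∀ x : L, D (T.algK (ι x)) = E (T.algK (ι x))) (hY : ∀ v, D (T.algY v) = E (T.algY v)) :
    D = E := by
  obtain ⟨S, hS⟩ := leibniz_eqOn f D E hD hE
  have : S = ⊤ := T.subalgebra_eq_top_of_env S (fun x => (hS _).2 (hL x)) fun v => (hS _).2 (hY v)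
  ext a
  exact (hS a).1 (by rw [this]; trivial)

theorem TwistData.alg_hom_ext {L : Type*} [LieRing L] [LieAlgebra k L]
    {T : TwistData k (UniversalEnvelopingAlgebra k L) Y} {f g : T.Alg →ₐ[k] Q}
    (hL : ∀ x : L, f (T.algK (ι x)) = g (T.algK (ι x))) (hY : ∀ v, f (T.algY v) = g (T.algY v)) :
    f = g := by
  have : AlgHom.equalizer f g = ⊤ := T.subalgebra_eq_top_of_env _ hL hY
  ext a
  exact (AlgHom.mem_equalizer f g a).1 (by rw [this]; trivial)

end TwistAlg

/-! ### The twist of `U(𝔏) ⊗ U(Y)` -/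

section Concrete

variable (k : Type u) [Field k] (r s : ℕ)

local notation "ι" => UniversalEnvelopingAlgebra.ι k

/-- The lower triangular part of the normal form: `C (2p + 1) (2p) = 1` for `p < s`. -/
noncomputable def lowerForm : Matrix (Fin r) (Fin r) k :=
  Matrix.of fun i j => if ∃ p < s, i.val = 2 * p + 1 ∧ j.val = 2 * p then 1 else 0

theorem normalForm_eq : normalForm k r s = (lowerForm k r s)ᵀ - lowerForm k r s := by
  ext i j
  simp only [normalForm, lowerForm, Matrix.of_apply, Matrix.sub_apply, Matrix.transpose_apply]
  by_cases h₁ : ∃ p < s, i.val = 2 * p ∧ j.val = 2 * p + 1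
  · have h₂ : ¬ ∃ p < s, i.val = 2 * p + 1 ∧ j.val = 2 * p := by
      rintro ⟨p, _, hp⟩; obtain ⟨q, _, hq⟩ := h₁; omega
    have h₃ : ∃ p < s, j.val = 2 * p + 1 ∧ i.val = 2 * p := by
      obtain ⟨q, hq, hq'⟩ := h₁; exact ⟨q, hq, hq'.symm⟩
    simp [h₁, h₂, h₃]
  · have h₃ : ¬ ∃ p < s, j.val = 2 * p + 1 ∧ i.val = 2 * p := by
      rintro ⟨q, hq, hq'⟩; exact h₁ ⟨q, hq, hq'.symm⟩
    by_cases h₂ : ∃ p < s, i.val = 2 * p + 1 ∧ j.val = 2 * p <;> simp [h₁, h₂, h₃]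

instance : IsLieAbelian (LieY k r) := ⟨fun _ _ => rfl⟩

/-- The coordinates of an element of `Y`. -/
def LieY.coords : LieY k r ≃ₗ[k] (Fin r → k) := LinearEquiv.refl k (Fin r → k)

/-- The coordinate projection of `kʳ` onto the span of the basis vectors with index `2p + 1`,
`p < s`. -/
noncomputable def pairedProj : (Fin r → k) →ₗ[k] (Fin r → k) := by
  classical
  exact LinearMap.pi fun i => if ∃ p < s, i.val = 2 * p + 1 then LinearMap.proj i else 0

theorem pairedProj_apply (v : Fin r → k) (i : Fin r) [Decidable (∃ p < s, i.val = 2 * p + 1)] :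
    pairedProj k r s v i = if ∃ p < s, i.val = 2 * p + 1 then v i else 0 := by
  simp only [pairedProj, LinearMap.pi_apply]
  split_ifs <;> rfl

/-- The linear map `v ↦ ∑ᵢ vᵢ xᵢ` from `kʳ` to `𝔏`. -/
def vecL : (Fin r → k) →ₗ[k] LieL k r s where
  toFun v := ⟨0, v⟩
  map_add' v w := by ext <;> simp [LieL.add_def]
  map_smul' c v := by ext <;> simp [LieL.smul_def]

theorem vecL_eq_sum (v : Fin r → k) : vecL k r s v = ∑ i, v i • vecL k r s (Pi.single i 1) := by
  conv_lhs => rw [pi_eq_sum_univ' v]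
  simp only [map_sum, map_smul]

theorem x₀_commute (g : UL k r s) : Commute (UL.x₀ k r s) g := by
  refine (env_commute (AlgHom.id k (UL k r s)) _ (fun x => ?_) g).symm
  change ι x * ι _ = ι _ * ι x
  rw [← sub_eq_zero, ← ι_lie]
  have : ⁅x, (⟨1, 0⟩ : LieL k r s)⁆ = 0 := by simp [LieL.bracket_def, LieL.zero_def]
  rw [this, map_zero]

/-- The twist of `U(𝔏) ⊗ U(Y)` that presents `ȳᵢ ȳⱼ` as an ordered product. -/
noncomputable def twistData : TwistData k (UL k r s) (LieY k r) where
  -- the cocycle is `β(v, w) lam`: the sign belongs to `ȳᵢ ȳⱼ` with `i` even and `j = i - 1`,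
  -- counting from `1`
  lam := -((1 / 3 : k) • UL.x₀ k r s ^ 3)
  β := LinearMap.mk₂ k (fun v w => LieY.coords k r v ⬝ᵥ lowerForm k r s *ᵥ LieY.coords k r w)
    (by intros; simp [add_dotProduct]) (by intros; simp)
    (by intros; simp [mulVec_add, dotProduct_add]) (by intros; simp [mulVec_smul])
  π := (LieY.coords k r).symm.toLinearMap ∘ₗ pairedProj k r s ∘ₗ (LieY.coords k r).toLinearMap
  lam_comm g := (((x₀_commute k r s g).pow_left 3).smul_left _).neg_left
  β_left v w := by
    classical
    simp only [LinearMap.mk₂_apply, LinearMap.comp_apply, LinearEquiv.coe_coe,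
      LinearEquiv.apply_symm_apply, dotProduct, mulVec]
    refine Finset.sum_congr rfl fun i _ => ?_
    rw [pairedProj_apply]
    split_ifs with h
    · rfl
    · have : ∀ j, lowerForm k r s i j = 0 := fun j =>
        if_neg fun ⟨p, hp, hp'⟩ => h ⟨p, hp, hp'.1⟩
      simp [this]
  β_right v w := by
    classical
    simp only [LinearMap.mk₂_apply, LinearMap.comp_apply, LinearEquiv.coe_coe,
      LinearEquiv.apply_symm_apply, dotProduct, mulVec]
    refine Finset.sum_eq_zero fun i _ => mul_eq_zero_of_right _ (Finset.sum_eq_zero fun j _ => ?_)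
    rw [pairedProj_apply]
    split_ifs with h
    · have : lowerForm k r s i j = 0 := if_neg fun ⟨p, hp, hp'⟩ => by
        obtain ⟨q, hq, hq'⟩ := h
        omega
      rw [this, zero_mul]
    · rw [mul_zero]

variable {k r s}

theorem twistData_lam : (twistData k r s).lam = -((1 / 3 : k) • UL.x₀ k r s ^ 3) := rfl

theorem twistData_β_sub (v w : LieY k r) :
    (twistData k r s).β v w - (twistData k r s).β w v =
      -(LieY.coords k r v ⬝ᵥ normalForm k r s *ᵥ LieY.coords k r w) := by
  have : LieY.coords k r w ⬝ᵥ lowerForm k r s *ᵥ LieY.coords k r v =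
      LieY.coords k r v ⬝ᵥ (lowerForm k r s)ᵀ *ᵥ LieY.coords k r w := by
    rw [dotProduct_comm, ← vecMul_transpose, ← dotProduct_mulVec]
  rw [normalForm_eq, sub_mulVec, dotProduct_sub, neg_sub, ← this]
  rfl

theorem twistData_β_single (i j : Fin r) [Decidable (∃ p < s, i.val = 2 * p + 1 ∧ j.val = 2 * p)] :
    (twistData k r s).β ((LieY.coords k r).symm (Pi.single i 1))
      ((LieY.coords k r).symm (Pi.single j 1)) =
      if ∃ p < s, i.val = 2 * p + 1 ∧ j.val = 2 * p then 1 else 0 := by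
  change Pi.single i 1 ⬝ᵥ lowerForm k r s *ᵥ Pi.single j 1 = _
  simp only [single_dotProduct, one_mul, mulVec_single_one, col_apply, lowerForm, of_apply]
  congr

/-! ### The action of `𝔰𝔬(B)` by derivations -/

theorem so_invariant (M : so (normalForm k r s)) (v w : Fin r → k) :
    (v ᵥ* M.1) ⬝ᵥ normalForm k r s *ᵥ w + v ⬝ᵥ normalForm k r s *ᵥ (w ᵥ* M.1) = 0 := by
  have h : M.1 * normalForm k r s = -(normalForm k r s * M.1ᵀ) := M.2
  rw [← dotProduct_mulVec, ← mulVec_transpose, mulVec_mulVec, mulVec_mulVec, h, neg_mulVec,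
    dotProduct_neg, neg_add_cancel]

/-- The action of `𝔰𝔬(B)` on `𝔏`. -/
def soL (M : so (normalForm k r s)) : LieL k r s →ₗ[k] LieL k r s where
  toFun p := ⟨0, -(p.c ᵥ* M.1)⟩
  map_add' p q := by ext <;> simp [LieL.add_def, add_vecMul, add_comm]
  map_smul' c p := by ext <;> simp [LieL.smul_def, smul_vecMul]

/-- The action of `𝔰𝔬(B)` on `Y`. -/
def soY (M : so (normalForm k r s)) : LieY k r →ₗ[k] LieY k r where
  toFun v := (LieY.coords k r).symm (-(LieY.coords k r v ᵥ* M.1))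
  map_add' p q := by
    simp only [map_add, add_vecMul, neg_add]
  map_smul' c p := by simp [smul_vecMul]

theorem bracket_eq (p q : LieL k r s) : ⁅p, q⁆ = ⟨p.c ⬝ᵥ normalForm k r s *ᵥ q.c, 0⟩ := by
  rw [LieL.bracket_def]
  congr 1
  simp only [dotProduct, mulVec, Finset.mul_sum]
  exact Finset.sum_congr rfl fun i _ => Finset.sum_congr rfl fun j _ => by ring

theorem soL_lie (M : so (normalForm k r s)) (p q : LieL k r s) :
    ⁅soL M p, q⁆ + ⁅p, soL M q⁆ = 0 := by
  rw [bracket_eq, bracket_eq, LieL.add_def, LieL.zero_def]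
  ext
  · change (-(p.c ᵥ* M.1)) ⬝ᵥ normalForm k r s *ᵥ q.c +
      p.c ⬝ᵥ normalForm k r s *ᵥ (-(q.c ᵥ* M.1)) = 0
    rw [neg_dotProduct, mulVec_neg, dotProduct_neg, ← neg_add, so_invariant, neg_zero]
  · simp

theorem soL_bracket (M : so (normalForm k r s)) (p q : LieL k r s) : soL M ⁅p, q⁆ = 0 := by
  rw [bracket_eq]
  simp [soL, LieL.zero_def]

theorem soY_β (M : so (normalForm k r s)) (v w : LieY k r) :
    ((twistData k r s).β (soY M v) w - (twistData k r s).β w (soY M v)) +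
      ((twistData k r s).β v (soY M w) - (twistData k r s).β (soY M w) v) = 0 := by
  rw [twistData_β_sub, twistData_β_sub]
  simp only [soY, LinearMap.coe_mk, AddHom.coe_mk, LinearEquiv.apply_symm_apply]
  rw [neg_dotProduct, mulVec_neg, dotProduct_neg, neg_neg, neg_neg, so_invariant]

end Concrete

section Action

variable {k : Type u} [Field k] {r s : ℕ}

local notation "ι" => UniversalEnvelopingAlgebra.ι k

variable (k r s) in
/-- The algebra underlying `U(𝔏)^τ #_σ U(Y)`. -/
noncomputable abbrev TAlg : Type u := (twistData k r s).Alg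

/-- The map `x ↦ x + (M ⇀ x) ε` from `U(𝔏)` to the dual numbers over the twisted product. -/
noncomputable def dualL (M : so (normalForm k r s)) : UL k r s →ₐ[k] DualNumber (TAlg k r s) :=
  envLift
    { toFun := fun x => TrivSqZeroExt.inl ((twistData k r s).algK (ι x)) +
        TrivSqZeroExt.inr ((twistData k r s).algK (ι (soL M x)))
      map_add' := by
        intro x y
        ext <;> simp [-UniversalEnvelopingAlgebra.ι_apply]
      map_smul' := by
        intro c x
        ext <;> simp [-UniversalEnvelopingAlgebra.ι_apply] }
    (by
      intro x y
      have h1 := ι_lie (k := k) x y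
      have h2 := congrArg (UniversalEnvelopingAlgebra.ι k) (soL_lie M x y)
      rw [map_add, ι_lie, ι_lie, map_zero] at h2
      have h3 := congrArg (twistData k r s).algK h2
      simp only [map_add, map_sub, map_mul, map_zero] at h3
      ext
      · simp [h1, -UniversalEnvelopingAlgebra.ι_apply]
      · simp only [soL_bracket, LinearMap.coe_mk, AddHom.coe_mk, TrivSqZeroExt.snd_add,
          TrivSqZeroExt.snd_inl, TrivSqZeroExt.snd_inr, TrivSqZeroExt.snd_sub,
          TrivSqZeroExt.snd_mul, TrivSqZeroExt.fst_add, TrivSqZeroExt.fst_inl,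
          TrivSqZeroExt.fst_inr, map_zero, zero_add, add_zero, smul_eq_mul,
          MulOpposite.smul_eq_mul_unop, MulOpposite.unop_op]
        rw [← h3]
        abel)

theorem dualL_ι (M : so (normalForm k r s)) (x : LieL k r s) : dualL M (ι x) =
    TrivSqZeroExt.inl ((twistData k r s).algK (ι x)) +
      TrivSqZeroExt.inr ((twistData k r s).algK (ι (soL M x))) := envLift_ι _ _ x

theorem dualL_lam (M : so (normalForm k r s)) : dualL M (twistData k r s).lam =
    TrivSqZeroExt.inl ((twistData k r s).algK (twistData k r s).lam) := by
  have h : dualL M (UL.x₀ k r s) =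
      TrivSqZeroExt.inl ((twistData k r s).algK (UL.x₀ k r s)) := by
    rw [UL.x₀, dualL_ι]
    have : soL M (⟨1, 0⟩ : LieL k r s) = 0 := by simp [soL, LieL.zero_def]
    rw [this, map_zero, map_zero, TrivSqZeroExt.inr_zero, add_zero]
  rw [twistData_lam, map_neg, map_smul, map_pow, h]
  simp [TrivSqZeroExt.inl_neg, TrivSqZeroExt.inl_pow]

/-- The map `v ↦ v + (M ⇀ v) ε` from `Y` to the dual numbers over the twisted product. -/
noncomputable def dualY (M : so (normalForm k r s)) : LieY k r →ₗ[k] DualNumber (TAlg k r s) where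
  toFun v := TrivSqZeroExt.inl ((twistData k r s).algY v) +
    TrivSqZeroExt.inr ((twistData k r s).algY (soY M v))
  map_add' x y := by ext <;> simp
  map_smul' c x := by ext <;> simp

/-- The maps to the dual numbers satisfy the relations of the twisted product because `𝔰𝔬(B)`
annihilates the form `B`; hence `M` acts by a derivation. -/
theorem dualPair (M : so (normalForm k r s)) : (twistData k r s).Pair (dualL M) (dualY M) where
  comm g v := by
    refine env_commute (dualL M) _ (fun x => ?_) g
    have hc := fun x v => ((twistData k r s).algPair.comm (ι x) v).eq
    rw [dualL_ι]
    change _ * _ = _ * _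
    ext <;> simp [dualY, hc, add_comm, -UniversalEnvelopingAlgebra.ι_apply]
  rel v w := by
    rw [dualL_lam]
    have h := (twistData k r s).algPair.rel
    ext
    · simpa [dualY] using h v w
    · have h0 : ((twistData k r s).algY (soY M v) * (twistData k r s).algY w -
          (twistData k r s).algY w * (twistData k r s).algY (soY M v)) +
          ((twistData k r s).algY v * (twistData k r s).algY (soY M w) -
          (twistData k r s).algY (soY M w) * (twistData k r s).algY v) = 0 := by
        rw [h, h, ← add_smul, soY_β, zero_smul]
      simp only [dualY, LinearMap.coe_mk, AddHom.coe_mk, TrivSqZeroExt.snd_add,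
          TrivSqZeroExt.snd_inl, TrivSqZeroExt.snd_inr, TrivSqZeroExt.snd_sub,
          TrivSqZeroExt.snd_mul, TrivSqZeroExt.fst_add, TrivSqZeroExt.fst_inl,
          TrivSqZeroExt.fst_inr, zero_add, add_zero, smul_eq_mul,
          MulOpposite.smul_eq_mul_unop, MulOpposite.unop_op, TrivSqZeroExt.snd_smul, smul_zero]
      rw [← h0]
      abel

theorem dualPair_fst (M : so (normalForm k r s)) (p : TAlg k r s) :
    ((dualPair M).lift p).fst = p := by
  have : (TrivSqZeroExt.fstHom k (TAlg k r s) (TAlg k r s)).comp (dualPair M).lift =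
      AlgHom.id k (TAlg k r s) := by
    apply TwistData.alg_hom_ext
    · intro x
      simp [(dualPair M).lift_algK, dualL_ι, -UniversalEnvelopingAlgebra.ι_apply]
    · intro v
      rw [AlgHom.comp_apply, (dualPair M).lift_algY]
      simp [dualY]
  exact AlgHom.congr_fun this p

/-- The derivation by which an element of `𝔰𝔬(B)` acts on the twisted product. -/
noncomputable def soDer (M : so (normalForm k r s)) : TAlg k r s →ₗ[k] TAlg k r s :=
  infPart (dualPair M).lift

theorem soDer_mul (M : so (normalForm k r s)) (p q : TAlg k r s) :
    soDer M (p * q) = p * soDer M q + soDer M p * q :=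
  infPart_mul (dualPair M).lift (AlgHom.id k _) (dualPair_fst M) p q

theorem soDer_algK (M : so (normalForm k r s)) (x : LieL k r s) :
    soDer M ((twistData k r s).algK (ι x)) = (twistData k r s).algK (ι (soL M x)) := by
  simp [soDer, infPart_apply, (dualPair M).lift_algK, dualL_ι, -UniversalEnvelopingAlgebra.ι_apply]

theorem soDer_algY (M : so (normalForm k r s)) (v : LieY k r) :
    soDer M ((twistData k r s).algY v) = (twistData k r s).algY (soY M v) := by
  rw [soDer, infPart_apply, (dualPair M).lift_algY]
  simp [dualY]

theorem soDer_one (M : so (normalForm k r s)) : soDer M 1 = 0 := by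
  simpa using soDer_mul M 1 1

theorem soDer_add (M N : so (normalForm k r s)) : soDer (M + N) = soDer M + soDer N := by
  apply TwistData.alg_leibniz_ext (AlgHom.id k _)
  · exact soDer_mul _
  · intro p q
    simp only [LinearMap.add_apply, soDer_mul, AlgHom.id_apply, mul_add, add_mul]
    abel
  · intro x
    rw [LinearMap.add_apply, soDer_algK, soDer_algK, soDer_algK, ← map_add, ← map_add]
    congr 2
    ext <;> simp [soL, LieL.add_def, vecMul_add, add_comm]
  · intro v
    rw [LinearMap.add_apply, soDer_algY, soDer_algY, soDer_algY, ← map_add]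
    congr 1
    simp only [soY, LinearMap.coe_mk, AddHom.coe_mk, ← map_add]
    congr 1
    rw [Submodule.coe_add, vecMul_add, neg_add]

theorem soDer_smul (c : k) (M : so (normalForm k r s)) : soDer (c • M) = c • soDer M := by
  apply TwistData.alg_leibniz_ext (AlgHom.id k _)
  · exact soDer_mul _
  · intro p q
    simp only [LinearMap.smul_apply, soDer_mul, AlgHom.id_apply, mul_smul_comm, smul_mul_assoc,
      smul_add]
  · intro x
    rw [LinearMap.smul_apply, soDer_algK, soDer_algK, ← map_smul, ← map_smul]
    congr 2
    ext <;> simp [soL, LieL.smul_def, vecMul_smul]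
  · intro v
    rw [LinearMap.smul_apply, soDer_algY, soDer_algY, ← map_smul]
    congr 1
    simp only [soY, LinearMap.coe_mk, AddHom.coe_mk, ← map_smul]
    congr 1
    rw [Submodule.coe_smul, vecMul_smul, smul_neg]

theorem vecMul_lie (M N : so (normalForm k r s)) (v : Fin r → k) :
    v ᵥ* (⁅M, N⁆ : so (normalForm k r s)).1 = (v ᵥ* M.1) ᵥ* N.1 - (v ᵥ* N.1) ᵥ* M.1 := by
  rw [vecMul_vecMul, vecMul_vecMul, ← vecMul_sub]
  rfl

theorem soDer_lie (M N : so (normalForm k r s)) :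
    soDer ⁅M, N⁆ = soDer M ∘ₗ soDer N - soDer N ∘ₗ soDer M := by
  apply TwistData.alg_leibniz_ext (AlgHom.id k _)
  · exact soDer_mul _
  · intro p q
    simp only [LinearMap.sub_apply, LinearMap.comp_apply, soDer_mul, map_add, AlgHom.id_apply,
      mul_sub, sub_mul]
    abel
  · intro x
    simp only [LinearMap.sub_apply, LinearMap.comp_apply, soDer_algK]
    rw [← map_sub, ← map_sub]
    congr 2
    rw [eq_sub_iff_add_eq]
    ext
    · simp [soL, LieL.add_def]
    · simp [soL, LieL.add_def, vecMul_lie, neg_vecMul]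
  · intro v
    simp only [LinearMap.sub_apply, LinearMap.comp_apply, soDer_algY]
    rw [← map_sub]
    congr 1
    simp only [soY, LinearMap.coe_mk, AddHom.coe_mk, ← map_sub, LinearEquiv.apply_symm_apply]
    congr 1
    rw [vecMul_lie, neg_vecMul, neg_vecMul]
    abel

/-- The action of `U(𝔰𝔬(B))` on the twisted product. -/
noncomputable def soAct : USo k r s →ₐ[k] Module.End k (TAlg k r s) :=
  envLift
    { toFun := soDer
      map_add' := soDer_add
      map_smul' := soDer_smul } soDer_lie

theorem soAct_ι (M : so (normalForm k r s)) : soAct (ι M) = soDer M := envLift_ι _ _ M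

/-- The twisted product is a module algebra over `U(𝔰𝔬(B))`. -/
theorem soAct_mul (a : USo k r s) (p q : TAlg k r s) : soAct a (p * q) =
    LinearMap.mul' k (TAlg k r s) (TensorProduct.map (soAct.toLinearMap.flip p)
      (soAct.toLinearMap.flip q) (comul a)) := by
  let f : USo k r s →ₐ[k] Module.End k (TAlg k r s ⊗[k] TAlg k r s) :=
    (Module.End.rTensorAlgHom k _ _).comp soAct
  let g : USo k r s →ₐ[k] Module.End k (TAlg k r s ⊗[k] TAlg k r s) :=
    (Module.End.lTensorAlgHom k _ _).comp soAct
  have hfg : ∀ x y, Commute (f (ι x)) (g (ι y)) := fun x y => by ext; rfl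
  have hf : ∀ b (p q : TAlg k r s), f b (p ⊗ₜ q) = soAct b p ⊗ₜ q := fun _ _ _ => rfl
  have hg : ∀ b (p q : TAlg k r s), g b (p ⊗ₜ q) = p ⊗ₜ soAct b q := fun _ _ _ => rfl
  have h := env_equivariant (convHom f g hfg) soAct (LinearMap.mul' k (TAlg k r s)) (fun M t => by
    rw [convHom_ι]
    induction t with
    | zero => simp
    | add _ _ h₁ h₂ => simp only [map_add, h₁, h₂]
    | tmul p q =>
      simp [hf, hg, soAct_ι, soDer_mul, -UniversalEnvelopingAlgebra.ι_apply, add_comm]) a (p ⊗ₜ q)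
  rw [LinearMap.mul'_apply] at h
  rw [← h]
  have hG : convHom f g hfg a =
      LinearMap.mul' k _ (TensorProduct.map f.toLinearMap g.toLinearMap (comul a)) :=
    LinearMap.congr_fun (congrArg WithConv.ofConv (convOf_convHom f g hfg)) a
  rw [hG]
  induction comul (R := k) a with
  | zero => simp
  | add _ _ h₁ h₂ => simp only [map_add, LinearMap.add_apply, h₁, h₂]
  | tmul b c => simp [hf, hg]

end Action

/-! ### The twisted product inside `UM(r, 2s)` -/

section Inside

variable {k : Type u} [Field k] {r s : ℕ} {κ : Type v}
  (b : Module.Basis κ k (so (normalForm k r s)))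

local notation "ι" => UniversalEnvelopingAlgebra.ι k

local notation "H" => UMrs k r s b

theorem sum_smul_commutator {A : Type*} [Ring A] [Algebra k A] (f g : Fin r → A)
    (v w : Fin r → k) :
    (∑ i, v i • f i) * (∑ j, w j • g j) - (∑ j, w j • g j) * (∑ i, v i • f i) =
      ∑ i, ∑ j, (v i * w j) • (f i * g j - g j * f i) := by
  rw [Finset.sum_mul_sum, Finset.sum_mul_sum, Finset.sum_comm (s := Finset.univ)
    (f := fun j i => w j • g j * v i • f i), ← Finset.sum_sub_distrib]
  refine Finset.sum_congr rfl fun i _ => ?_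
  rw [← Finset.sum_sub_distrib]
  refine Finset.sum_congr rfl fun j _ => ?_
  rw [smul_mul_smul_comm, smul_mul_smul_comm, mul_comm (w j), smul_sub]

theorem gen_x₀_comm (g : Gen r κ) :
    UM.gen (normalForm k r s) b .x₀ * UM.gen _ b g = UM.gen _ b g * UM.gen _ b .x₀ :=
  sub_eq_zero.1 ((UM.satisfiesRel_gen _ b).x₀_central g)

theorem dotProduct_mulVec_eq (A : Matrix (Fin r) (Fin r) k) (v w : Fin r → k) :
    v ⬝ᵥ A *ᵥ w = ∑ i, ∑ j, v i * w j * A i j := by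
  simp only [dotProduct, mulVec, Finset.mul_sum]
  exact Finset.sum_congr rfl fun i _ => Finset.sum_congr rfl fun j _ => by ring

/-- The linear map `𝔏 → UM(r, 2s)`. -/
noncomputable def linL : LieL k r s →ₗ[k] H where
  toFun p := p.c₀ • UM.gen _ b .x₀ + ∑ i, p.c i • UM.gen _ b (.x i)
  map_add' p q := by
    simp only [LieL.add_def, Pi.add_apply, add_smul, Finset.sum_add_distrib]
    abel
  map_smul' c p := by
    simp only [LieL.smul_def, Pi.smul_apply, smul_assoc, smul_add, Finset.smul_sum,
      RingHom.id_apply]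

theorem linL_apply (p : LieL k r s) :
    linL b p = p.c₀ • UM.gen _ b .x₀ + ∑ i, p.c i • UM.gen _ b (.x i) := rfl

theorem commute_gen_x₀_sum (v : Fin r → k) (f : Fin r → Gen r κ) :
    Commute (UM.gen (normalForm k r s) b .x₀) (∑ i, v i • UM.gen _ b (f i)) :=
  Commute.sum_right _ _ _ fun i _ => Commute.smul_right (gen_x₀_comm b (f i)) _

/-- The algebra map `U(𝔏) → UM(r, 2s)`. -/
noncomputable def homL : UL k r s →ₐ[k] H :=
  envLift (linL b) (by
    intro p q
    have h1 := sum_smul_commutator (fun i => UM.gen (normalForm k r s) b (.x i))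
      (fun i => UM.gen (normalForm k r s) b (.x i)) p.c q.c
    simp only [(UM.satisfiesRel_gen _ b).xx] at h1
    have h2 : ∀ v : Fin r → k, _ = _ := fun v => (commute_gen_x₀_sum b v .x).eq
    rw [bracket_eq, linL_apply, linL_apply, linL_apply, dotProduct_mulVec_eq]
    simp only [Pi.zero_apply, zero_smul, Finset.sum_const_zero, add_zero, add_mul, mul_add,
      smul_mul_assoc, mul_smul_comm, h2, Finset.sum_smul, smul_add]
    rw [smul_comm q.c₀ p.c₀]
    simp only [smul_smul] at h1
    rw [← h1]
    abel)

theorem homL_ι (p : LieL k r s) : homL b (ι p) = linL b p := envLift_ι _ _ p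

theorem homL_x₀ : homL b (UL.x₀ k r s) = UM.gen _ b .x₀ := by
  rw [UL.x₀, homL_ι, linL_apply]
  simp

theorem homL_x (i : Fin r) : homL b (UL.x k r s i) = UM.gen _ b (.x i) := by
  rw [UL.x, homL_ι, linL_apply]
  simp [Pi.single_apply]

/-- The linear map `Y → UM(r, 2s)`. -/
noncomputable def linY : LieY k r →ₗ[k] H :=
  Fintype.linearCombination k (fun i => UM.gen (normalForm k r s) b (.y i)) ∘ₗ
    (LieY.coords k r).toLinearMap

theorem linY_apply (v : LieY k r) :
    linY b v = ∑ i, LieY.coords k r v i • UM.gen (normalForm k r s) b (.y i) := rfl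

theorem linY_single (i : Fin r) : linY b ((LieY.coords k r).symm (Pi.single i 1)) =
    UM.gen (normalForm k r s) b (.y i) := by
  simp [linY_apply, Pi.single_apply]

/-- The elements `xᵢ` and `yᵢ` of `UM(r, 2s)` satisfy the relations of the twisted product. -/
theorem pairUM : (twistData k r s).Pair (homL b) (linY b) where
  comm g v := by
    refine env_commute (homL b) _ (fun p => ?_) g
    rw [homL_ι, linL_apply, linY_apply]
    refine Commute.add_left ((commute_gen_x₀_sum b _ .y).smul_left _) ?_
    refine sub_eq_zero.1 ?_
    rw [sum_smul_commutator]
    simp [(UM.satisfiesRel_gen _ b).xy]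
  rel v w := by
    rw [linY_apply, linY_apply, sum_smul_commutator, twistData_β_sub, twistData_lam, map_neg,
      map_smul, map_pow, homL_x₀, smul_neg, neg_smul, neg_neg, dotProduct_mulVec_eq]
    simp only [(UM.satisfiesRel_gen _ b).yy, smul_smul, Finset.sum_mul, Finset.sum_smul]
    exact Finset.sum_congr rfl fun i _ => Finset.sum_congr rfl fun j _ => by
      congr 1; ring

/-- The algebra map from the twisted product to `UM(r, 2s)`. -/
noncomputable def homT : TAlg k r s →ₐ[k] H := (pairUM b).lift

theorem homT_algK (g : UL k r s) : homT b ((twistData k r s).algK g) = homL b g :=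
  (pairUM b).lift_algK g

theorem homT_algY (v : LieY k r) : homT b ((twistData k r s).algY v) = linY b v :=
  (pairUM b).lift_algY v

/-- The linear map `𝔰𝔬(B) → UM(r, 2s)`. -/
noncomputable def linSo : so (normalForm k r s) →ₗ[k] H :=
  b.constr k fun j => UM.gen (normalForm k r s) b (.m j)

theorem linSo_basis (j : κ) : linSo b (b j) = UM.gen (normalForm k r s) b (.m j) :=
  b.constr_basis k _ j

/-- The Lie bracket of `𝔰𝔬(B)` as a bilinear map. -/
noncomputable def soBracket : so (normalForm k r s) →ₗ[k] so (normalForm k r s) →ₗ[k]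
    so (normalForm k r s) :=
  LinearMap.mk₂ k (fun M N => ⁅M, N⁆) (fun _ _ _ => add_lie _ _ _) (fun _ _ _ => smul_lie _ _ _)
    (fun _ _ _ => lie_add _ _ _) (fun _ _ _ => lie_smul _ _ _)

/-- The algebra map `U(𝔰𝔬(B)) → UM(r, 2s)`. -/
noncomputable def homSo : USo k r s →ₐ[k] H :=
  envLift (linSo b) (by
    intro M N
    have h : (soBracket (k := k) (r := r) (s := s)).compr₂ (linSo b) =
        (LinearMap.mul k H).compl₁₂ (linSo b) (linSo b) -
          ((LinearMap.mul k H).compl₁₂ (linSo b) (linSo b)).flip := by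
      refine b.ext fun i => b.ext fun j => ?_
      simp only [LinearMap.compr₂_apply, LinearMap.sub_apply, LinearMap.compl₁₂_apply,
        LinearMap.flip_apply, LinearMap.mul_apply', linSo_basis, (UM.satisfiesRel_gen _ b).mm]
      rw [soBracket, LinearMap.mk₂_apply, linSo, Module.Basis.constr_apply]
      rfl
    exact LinearMap.congr_fun₂ h M N)

theorem homSo_ι (M : so (normalForm k r s)) : homSo b (ι M) = linSo b M := envLift_ι _ _ M

/-- The map `p ⊗ u ↦ p u` from `(U(𝔏) ⊗ U(Y)) ⊗ U(𝔰𝔬(B))` to `UM(r, 2s)`. -/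
noncomputable def mulUM : TAlg k r s ⊗[k] USo k r s →ₗ[k] H :=
  LinearMap.mul' k H ∘ₗ TensorProduct.map (homT b).toLinearMap (homSo b).toLinearMap

theorem mulUM_tmul (p : TAlg k r s) (u : USo k r s) : mulUM b (p ⊗ₜ u) = homT b p * homSo b u :=
  rfl

theorem linSo_commutator {f : Fin r → Gen r κ} (hf : ∀ i j,
      UM.gen _ b (f i) * UM.gen _ b (.m j) - UM.gen _ b (.m j) * UM.gen _ b (f i) =
        ∑ l, (b j).1 i l • UM.gen _ b (f l)) (M : so (normalForm k r s)) (v : Fin r → k) :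
    linSo b M * (∑ i, v i • UM.gen _ b (f i)) - (∑ i, v i • UM.gen _ b (f i)) * linSo b M =
      ∑ l, (-(v ᵥ* M.1)) l • UM.gen _ b (f l) := by
  have hM : M ∈ Submodule.span k (Set.range b) := by rw [b.span_eq]; trivial
  induction hM using Submodule.span_induction with
  | mem M hM =>
    obtain ⟨j, rfl⟩ := hM
    rw [linSo_basis, Finset.mul_sum, Finset.sum_mul, ← Finset.sum_sub_distrib]
    have h : ∀ i, UM.gen _ b (.m j) * v i • UM.gen _ b (f i) -
        v i • UM.gen _ b (f i) * UM.gen _ b (.m j) =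
        ∑ l, (-(v i * (b j).1 i l)) • UM.gen _ b (f l) := by
      intro i
      rw [mul_smul_comm, smul_mul_assoc, ← smul_sub, ← neg_sub, hf, smul_neg, Finset.smul_sum,
        ← Finset.sum_neg_distrib]
      exact Finset.sum_congr rfl fun l _ => by rw [smul_smul, neg_smul]
    simp only [h]
    rw [Finset.sum_comm]
    refine Finset.sum_congr rfl fun l _ => ?_
    rw [← Finset.sum_smul, Finset.sum_neg_distrib]
    rfl
  | zero => simp
  | add M N _ _ hM hN =>
    rw [map_add, add_mul, mul_add, add_sub_add_comm, hM, hN, ← Finset.sum_add_distrib]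
    simp only [Submodule.coe_add, vecMul_add, neg_add, Pi.add_apply, add_smul]
  | smul c M _ hM =>
    rw [map_smul, smul_mul_assoc, mul_smul_comm, ← smul_sub, hM, Finset.smul_sum]
    simp only [Submodule.coe_smul, vecMul_smul, Pi.neg_apply, Pi.smul_apply, ← smul_neg,
      smul_assoc]

theorem linSo_comm_x₀ (M : so (normalForm k r s)) :
    Commute (linSo b M) (UM.gen _ b .x₀) := by
  have hM : M ∈ Submodule.span k (Set.range b) := by rw [b.span_eq]; trivial
  induction hM using Submodule.span_induction with
  | mem M hM =>
    obtain ⟨j, rfl⟩ := hM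
    rw [linSo_basis]
    exact (gen_x₀_comm b _).symm
  | zero => simp
  | add M N _ _ hM hN => rw [map_add]; exact hM.add_left hN
  | smul c M _ hM => rw [map_smul]; exact hM.smul_left c

theorem linL_soL (M : so (normalForm k r s)) (p : LieL k r s) :
    linSo b M * linL b p - linL b p * linSo b M = linL b (soL M p) := by
  have h := linSo_commutator b (UM.satisfiesRel_gen _ b).xm M p.c
  have h0 := (linSo_comm_x₀ b M).eq
  rw [linL_apply, mul_add, add_mul, add_sub_add_comm, h, mul_smul_comm, smul_mul_assoc, h0,
    sub_self, zero_add, linL_apply]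
  simp [soL]

theorem linY_soY (M : so (normalForm k r s)) (v : LieY k r) :
    linSo b M * linY b v - linY b v * linSo b M = linY b (soY M v) :=
  linSo_commutator b (UM.satisfiesRel_gen _ b).ym M (LieY.coords k r v)

/-- The commutator with an element of `𝔰𝔬(B)` realizes the derivation by which it acts. -/
theorem linSo_mul_homT (M : so (normalForm k r s)) (p : TAlg k r s) :
    linSo b M * homT b p = homT b (soDer M p) + homT b p * linSo b M := by
  rw [← sub_eq_iff_eq_add]
  refine LinearMap.congr_fun
    (f := (LinearMap.mulLeft k (linSo b M) - LinearMap.mulRight k (linSo b M)) ∘ₗ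
      (homT b).toLinearMap)
    (g := (homT b).toLinearMap ∘ₗ soDer M) ?_ p
  apply TwistData.alg_leibniz_ext (homT b)
  · intro p q
    simp only [LinearMap.comp_apply, LinearMap.sub_apply, LinearMap.mulLeft_apply,
      LinearMap.mulRight_apply, AlgHom.toLinearMap_apply, map_mul]
    noncomm_ring
  · intro p q
    simp only [LinearMap.comp_apply, AlgHom.toLinearMap_apply, soDer_mul, map_add, map_mul]
  · intro x
    simp only [LinearMap.comp_apply, LinearMap.sub_apply, LinearMap.mulLeft_apply,
      LinearMap.mulRight_apply, AlgHom.toLinearMap_apply, soDer_algK, homT_algK, homL_ι, linL_soL]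
  · intro v
    simp only [LinearMap.comp_apply, LinearMap.sub_apply, LinearMap.mulLeft_apply,
      LinearMap.mulRight_apply, AlgHom.toLinearMap_apply, soDer_algY, homT_algY, linY_soY]

end Inside

/-! ### The regular representation of `UM(r, 2s)` -/

section Regular

variable {k : Type u} [Field k] {r s : ℕ}

local notation "ι" => UniversalEnvelopingAlgebra.ι k

variable (k r s) in
/-- Left multiplication by elements of the twisted product `P` on `P ⊗ U(𝔰𝔬(B))`. -/
noncomputable def regT : TAlg k r s →ₐ[k] Module.End k (TAlg k r s ⊗[k] USo k r s) :=
  (Module.End.rTensorAlgHom k _ _).comp (Algebra.lmul k (TAlg k r s))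

theorem regT_tmul (p q : TAlg k r s) (u : USo k r s) : regT k r s p (q ⊗ₜ u) = (p * q) ⊗ₜ u := rfl

variable (k r s) in
/-- The action of `U(𝔰𝔬(B))` on the first factor of `P ⊗ U(𝔰𝔬(B))`, for the twisted product `P`. -/
noncomputable def regAct : USo k r s →ₐ[k] Module.End k (TAlg k r s ⊗[k] USo k r s) :=
  (Module.End.rTensorAlgHom k _ _).comp soAct

variable (k r s) in
/-- Left multiplication by elements of `U(𝔰𝔬(B))` on the second factor of `P ⊗ U(𝔰𝔬(B))`, for the
twisted product `P`. -/
noncomputable def regMul : USo k r s →ₐ[k] Module.End k (TAlg k r s ⊗[k] USo k r s) :=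
  (Module.End.lTensorAlgHom k _ _).comp (Algebra.lmul k (USo k r s))

theorem regAct_tmul (a : USo k r s) (p : TAlg k r s) (u : USo k r s) :
    regAct k r s a (p ⊗ₜ u) = soAct a p ⊗ₜ u := rfl

theorem regMul_tmul (a : USo k r s) (p : TAlg k r s) (u : USo k r s) :
    regMul k r s a (p ⊗ₜ u) = p ⊗ₜ (a * u) := rfl

theorem regAct_commute (M N : so (normalForm k r s)) :
    Commute (regAct k r s (ι M)) (regMul k r s (ι N)) := by
  ext; rfl

variable (k r s) in
/-- The action `a (p ⊗ u) = a₁ ⇀ p ⊗ a₂ u` of `U(𝔰𝔬(B))`. -/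
noncomputable def regSo : USo k r s →ₐ[k] Module.End k (TAlg k r s ⊗[k] USo k r s) :=
  convHom (regAct k r s) (regMul k r s) regAct_commute

theorem regSo_ι (M : so (normalForm k r s)) (p : TAlg k r s) (u : USo k r s) :
    regSo k r s (ι M) (p ⊗ₜ u) = soDer M p ⊗ₜ u + p ⊗ₜ (ι M * u) := by
  rw [regSo, convHom_ι, LinearMap.add_apply, regAct_tmul, regMul_tmul, soAct_ι]

theorem regSo_tmul_one (a : USo k r s) (p : TAlg k r s) : regSo k r s a (p ⊗ₜ 1) =
    (soAct.toLinearMap.flip p).rTensor (USo k r s) (comul a) := by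
  have h : regSo k r s a = LinearMap.mul' k _
      (TensorProduct.map (regAct k r s).toLinearMap (regMul k r s).toLinearMap (comul a)) :=
    LinearMap.congr_fun (congrArg WithConv.ofConv
      (convOf_convHom (regAct k r s) (regMul k r s) regAct_commute)) a
  rw [h]
  induction comul (R := k) a with
  | zero => simp
  | add _ _ h₁ h₂ => simp only [map_add, LinearMap.add_apply, h₁, h₂]
  | tmul b c =>
    rw [TensorProduct.map_tmul, LinearMap.mul'_apply, Module.End.mul_apply]
    simp only [AlgHom.toLinearMap_apply]
    rw [regMul_tmul, regAct_tmul, mul_one]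
    rfl

theorem regSo_one_tmul (a u : USo k r s) :
    regSo k r s a ((1 : TAlg k r s) ⊗ₜ u) = 1 ⊗ₜ (a * u) :=
  (env_equivariant (Algebra.lmul k (USo k r s)) (regSo k r s)
    (TensorProduct.mk k (TAlg k r s) (USo k r s) 1) (fun M u => by
      simp [regSo_ι, soDer_one, -UniversalEnvelopingAlgebra.ι_apply]) a u).symm

theorem regT_commutator (M : so (normalForm k r s)) (p : TAlg k r s) :
    regT k r s p * regSo k r s (ι M) - regSo k r s (ι M) * regT k r s p =
      -regT k r s (soDer M p) := by
  refine TensorProduct.ext' fun q u => ?_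
  simp only [LinearMap.sub_apply, LinearMap.neg_apply, Module.End.mul_apply, regT_tmul, regSo_ι,
    map_add, soDer_mul, TensorProduct.add_tmul]
  abel

theorem twist_xx (i j : Fin r) : UL.x k r s i * UL.x k r s j - UL.x k r s j * UL.x k r s i =
    normalForm k r s i j • UL.x₀ k r s := by
  rw [UL.x, UL.x, ← ι_lie, bracket_eq, UL.x₀, ← map_smul, LieL.smul_def]
  simp

variable (k r s) in
/-- The basis vector `ȳᵢ` of `Y`, inside the twisted product. -/
noncomputable def twistY (i : Fin r) : TAlg k r s :=
  (twistData k r s).algY ((LieY.coords k r).symm (Pi.single i 1))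

theorem twistY_commute (g : UL k r s) (i : Fin r) :
    (twistData k r s).algK g * twistY k r s i = twistY k r s i * (twistData k r s).algK g :=
  ((twistData k r s).algPair.comm g _).eq

theorem twist_yy (i j : Fin r) :
    twistY k r s i * twistY k r s j - twistY k r s j * twistY k r s i =
      (1 / 3 * normalForm k r s i j : k) • (twistData k r s).algK (UL.x₀ k r s) ^ 3 := by
  rw [twistY, twistY, (twistData k r s).algPair.rel, twistData_β_sub, twistData_lam, map_neg,
    map_smul, map_pow, smul_neg, neg_smul, neg_neg, smul_smul, mul_comm]
  simp

theorem soL_single (M : so (normalForm k r s)) (i : Fin r) :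
    (ι (soL M ⟨0, Pi.single i 1⟩) : UL k r s) = -∑ l, M.1 i l • UL.x k r s l := by
  have h : soL M ⟨0, Pi.single i 1⟩ = -∑ l, M.1 i l • vecL k r s (Pi.single l 1) := by
    rw [← vecL_eq_sum, ← map_neg]
    change vecL k r s _ = _
    congr 1
    ext l
    simp
  rw [h, map_neg, map_sum]
  simp only [map_smul]
  rfl

theorem soY_single (M : so (normalForm k r s)) (i : Fin r) :
    soY M ((LieY.coords k r).symm (Pi.single i 1)) =
      -∑ l, M.1 i l • (LieY.coords k r).symm (Pi.single l 1) := by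
  simp only [soY, LinearMap.coe_mk, AddHom.coe_mk, ← map_smul, ← map_sum, ← map_neg]
  congr 1
  ext l
  simp [Finset.sum_apply, Pi.single_apply]

theorem soDer_x₀ (M : so (normalForm k r s)) :
    soDer M ((twistData k r s).algK (UL.x₀ k r s)) = 0 := by
  have : soL M (⟨1, 0⟩ : LieL k r s) = 0 := by simp [soL, LieL.zero_def]
  rw [UL.x₀, soDer_algK, this, map_zero, map_zero]

theorem soDer_x (M : so (normalForm k r s)) (i : Fin r) :
    soDer M ((twistData k r s).algK (UL.x k r s i)) =
      -∑ l, M.1 i l • (twistData k r s).algK (UL.x k r s l) := by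
  rw [UL.x, soDer_algK, soL_single, map_neg, map_sum]
  simp only [map_smul]

theorem soDer_y (M : so (normalForm k r s)) (i : Fin r) :
    soDer M (twistY k r s i) = -∑ l, M.1 i l • twistY k r s l := by
  rw [twistY, soDer_algY, soY_single, map_neg, map_sum]
  simp only [map_smul]
  rfl

theorem soAct_one (a : USo k r s) : soAct a (1 : TAlg k r s) = counit (R := k) a • 1 := by
  have h := env_equivariant ((Algebra.lmul k k).comp (Bialgebra.counitAlgHom k (USo k r s)))
    soAct (LinearMap.toSpanSingleton k (TAlg k r s) 1) (fun M c => by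
      change (counit (R := k) (ι M) * c) • (1 : TAlg k r s) = soAct (ι M) (c • 1)
      rw [counit_ι, soAct_ι, map_smul, soDer_one, smul_zero, zero_mul, zero_smul]) a 1
  refine Eq.trans ?_ (h.symm.trans ?_)
  · simp
  · change (counit (R := k) a * 1) • (1 : TAlg k r s) = _
    rw [mul_one]

end Regular

section Bijective

variable {k : Type u} [Field k] {r s : ℕ} {κ : Type v}
  (b : Module.Basis κ k (so (normalForm k r s)))

local notation "ι" => UniversalEnvelopingAlgebra.ι k

local notation "H" => UMrs k r s b

/-- The action of the generators of `UM(r, 2s)` on `P ⊗ U(𝔰𝔬(B))`, for the twisted product `P`. -/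
noncomputable def regGen : Gen r κ → Module.End k (TAlg k r s ⊗[k] USo k r s)
  | .x₀ => regT k r s ((twistData k r s).algK (UL.x₀ k r s))
  | .x i => regT k r s ((twistData k r s).algK (UL.x k r s i))
  | .y i => regT k r s (twistY k r s i)
  | .m j => regSo k r s (ι (b j))

theorem satisfiesRel_regGen : UM.SatisfiesRel (normalForm k r s) b (regGen b) where
  x₀_central := by
    rintro (_ | i | i | j)
    · simp [regGen]
    · simp only [regGen]
      rw [← map_mul, ← map_mul, ← map_mul, ← map_mul, (x₀_commute k r s _).eq, sub_self]
    · simp only [regGen]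
      rw [← map_mul, ← map_mul, twistY_commute, sub_self]
    · simp only [regGen]
      rw [regT_commutator, soDer_x₀, map_zero, neg_zero]
  xx i j := by
    simp only [regGen]
    rw [← map_mul (regT k r s), ← map_mul (regT k r s), ← map_sub, ← map_mul, ← map_mul,
      ← map_sub, twist_xx, map_smul, map_smul]
  yy i j := by
    simp only [regGen]
    rw [← map_mul, ← map_mul, ← map_sub, twist_yy, map_smul, map_pow]
  xy i j := by
    simp only [regGen]
    rw [← map_mul, ← map_mul, twistY_commute, sub_self]
  xm i j := by
    simp only [regGen]
    rw [regT_commutator, soDer_x, map_neg, neg_neg, map_sum]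
    simp only [map_smul]
  ym i j := by
    simp only [regGen]
    rw [regT_commutator, soDer_y, map_neg, neg_neg, map_sum]
    simp only [map_smul]
  mm i j := by
    simp only [regGen]
    rw [← map_mul (regSo k r s), ← map_mul (regSo k r s), ← map_sub, ← ι_lie]
    have h := Finsupp.apply_linearCombination k
      ((regSo k r s).toLinearMap ∘ₗ (envInc : _ →ₗ[k] USo k r s)) b (b.repr ⁅b i, b j⁆)
    rw [b.linearCombination_repr] at h
    exact h

/-- The regular representation of `UM(r, 2s)`, carried over to the vector space `P ⊗ U(𝔰𝔬(B))`, for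
the twisted product `P`. -/
noncomputable def regUM : H →ₐ[k] Module.End k (TAlg k r s ⊗[k] USo k r s) :=
  UM.lift (regGen b) (satisfiesRel_regGen b)

theorem regUM_homT (p : TAlg k r s) : regUM b (homT b p) = regT k r s p := by
  refine AlgHom.congr_fun (φ₁ := (regUM b).comp (homT b)) ?_ p
  apply TwistData.alg_hom_ext
  · intro x
    rw [AlgHom.comp_apply, homT_algK, homL_ι, linL_apply, map_add, map_sum]
    simp only [map_smul, regUM, UM.lift_gen, regGen]
    simp only [← map_smul, ← map_sum, ← map_add, UL.x₀, UL.x]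
    congr 3
    change _ + ∑ l, x.c l • vecL k r s (Pi.single l 1) = _
    rw [← vecL_eq_sum]
    ext <;> simp [vecL, LieL.add_def, LieL.smul_def]
  · intro v
    rw [AlgHom.comp_apply, homT_algY, linY_apply, map_sum]
    simp only [map_smul, regUM, UM.lift_gen, regGen, twistY]
    simp only [← map_smul, ← map_sum]
    congr 2
    rw [LinearEquiv.symm_apply_eq]
    ext l
    simp [Finset.sum_apply, Pi.single_apply]

theorem regUM_homSo (a : USo k r s) : regUM b (homSo b a) = regSo k r s a := by
  refine AlgHom.congr_fun (φ₁ := (regUM b).comp (homSo b)) (env_hom_ext fun M => ?_) a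
  rw [AlgHom.comp_apply, homSo_ι]
  refine LinearMap.congr_fun (f := (regUM b).toLinearMap ∘ₗ linSo b)
    (g := (regSo k r s).toLinearMap ∘ₗ envInc) (b.ext fun j => ?_) M
  rw [LinearMap.comp_apply, linSo_basis]
  exact UM.lift_gen _ _ _

theorem mulUM_regT (p : TAlg k r s) (t : TAlg k r s ⊗[k] USo k r s) :
    mulUM b (regT k r s p t) = homT b p * mulUM b t := by
  induction t with
  | zero => simp
  | add _ _ h₁ h₂ => simp only [map_add, mul_add, h₁, h₂]
  | tmul q u => rw [regT_tmul, mulUM_tmul, mulUM_tmul, map_mul, mul_assoc]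

theorem mulUM_regSo (a : USo k r s) (t : TAlg k r s ⊗[k] USo k r s) :
    mulUM b (regSo k r s a t) = homSo b a * mulUM b t := by
  refine env_equivariant (regSo k r s) ((Algebra.lmul k H).comp (homSo b)) (mulUM b)
    (fun M t => ?_) a t
  change _ = homSo b (ι M) * mulUM b t
  rw [homSo_ι]
  induction t with
  | zero => simp
  | add _ _ h₁ h₂ => simp only [map_add, mul_add, h₁, h₂]
  | tmul q u =>
    rw [regSo_ι, map_add, mulUM_tmul, mulUM_tmul, mulUM_tmul, map_mul, homSo_ι, ← mul_assoc,
      ← mul_assoc, linSo_mul_homT, add_mul]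

theorem homT_twistY (i : Fin r) : homT b (twistY k r s i) = UM.gen (normalForm k r s) b (.y i) := by
  rw [twistY, homT_algY, linY_single]

/-- The multiplication map is a map of left `UM(r, 2s)`-modules. -/
theorem mulUM_regUM (x : H) (t : TAlg k r s ⊗[k] USo k r s) :
    mulUM b (regUM b x t) = x * mulUM b t := by
  let S : Subalgebra k H :=
    { carrier := {x | ∀ t, mulUM b (regUM b x t) = x * mulUM b t}
      mul_mem' := by
        intro x y hx hy t
        rw [map_mul, Module.End.mul_apply, hx, hy, mul_assoc]
      add_mem' := by
        intro x y hx hy t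
        rw [map_add, LinearMap.add_apply, map_add, hx, hy, add_mul]
      algebraMap_mem' := by
        intro c t
        rw [AlgHom.commutes, Module.algebraMap_end_apply, map_smul, Algebra.smul_def] }
  have hS : S = ⊤ := UM.subalgebra_eq_top _ b S (by
    rintro (_ | i | i | j) t
    · rw [regUM, UM.lift_gen, regGen, mulUM_regT, homT_algK, homL_x₀]
    · rw [regUM, UM.lift_gen, regGen, mulUM_regT, homT_algK, homL_x]
    · rw [regUM, UM.lift_gen, regGen, mulUM_regT, homT_twistY]
    · rw [regUM, UM.lift_gen, regGen, mulUM_regSo, homSo_ι, linSo_basis])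
  have hx : x ∈ S := by rw [hS]; trivial
  exact hx t

/-- The multiplication map is bijective: the inverse map sends `x` to `x (1 ⊗ 1)`. -/
theorem mulUM_bijective : Function.Bijective (mulUM b) := by
  refine Function.bijective_iff_has_inverse.2
    ⟨fun x => regUM b x (1 ⊗ₜ 1), fun t => ?_, fun x => ?_⟩
  · induction t with
    | zero => simp
    | add _ _ h₁ h₂ =>
      simp only [map_add, LinearMap.add_apply] at h₁ h₂ ⊢
      rw [h₁, h₂]
    | tmul p u =>
      simp only
      rw [mulUM_tmul, map_mul, Module.End.mul_apply, regUM_homT, regUM_homSo, regSo_one_tmul,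
        regT_tmul, mul_one, mul_one]
  · simp only
    rw [mulUM_regUM, mulUM_tmul, map_one, map_one, mul_one, mul_one]

theorem homT_injective : Function.Injective (homT b) := by
  intro p q h
  have h1 : (p ⊗ₜ[k] (1 : USo k r s)) = q ⊗ₜ 1 := (mulUM_bijective b).1 (by
    rw [mulUM_tmul, mulUM_tmul, h])
  simpa using congrArg (fun t => TensorProduct.rid k _ ((counit (R := k)).lTensor _ t)) h1

theorem homSo_mul_homT (a : USo k r s) (p : TAlg k r s) : homSo b a * homT b p =
    mulUM b ((soAct.toLinearMap.flip p).rTensor (USo k r s) (comul a)) := by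
  rw [← regSo_tmul_one, mulUM_regSo, mulUM_tmul, map_one, mul_one]

end Bijective

/-! ### Crossed products with trivial action or coaction -/

section CrossedCocycle

variable {k : Type u} [Field k] {K : Type v} {J : Type w}
  [Ring K] [HopfAlgebra k K] [Ring J] [HopfAlgebra k J] {D : CrossedData k K J}

namespace CrossedData

theorem rid_twist (D : CrossedData k K J) (a b : J) :
    TensorProduct.rid k K ((counit (R := k)).lTensor K (D.twist a b)) = D.σ a b := by
  have key : ∀ s t : J ⊗[k] J, TensorProduct.rid k K ((counit (R := k)).lTensor K
      (TensorProduct.map₂ D.σ (LinearMap.mul k J) s t)) =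
      D.σ (TensorProduct.rid k J ((counit (R := k)).lTensor J s))
        (TensorProduct.rid k J ((counit (R := k)).lTensor J t)) := by
    intro s t
    induction s with
    | zero => simp
    | add _ _ h₁ h₂ => simp only [map_add, LinearMap.add_apply, h₁, h₂]
    | tmul b c =>
      induction t with
      | zero => simp
      | add _ _ h₁ h₂ => simp only [map_add, h₁, h₂]
      | tmul b' c' => simp [smul_smul, mul_comm]
  refine (key _ _).trans ?_
  simp

/-- When the action is trivial, the cocycle identity follows from the associativity of the
product. -/
theorem TrivialAction.isCocycle (h : D.TrivialAction)
    (h_left : ∀ a, D.σ 1 a = counit (R := k) a • (1 : K))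
    (h_right : ∀ a, D.σ a 1 = counit (R := k) a • (1 : K))
    (hm : ∀ p q t, D.mul (D.mul p q) t = D.mul p (D.mul q t)) : D.IsCocycle where
  one_left := h_left
  one_right := h_right
  cocycle a b c := by
    have h1 : ∀ a b, D.mul (1 ⊗ₜ a) (1 ⊗ₜ b) = D.twist a b := by
      intro a b
      rw [h.mul_tmul, mul_one, ← Algebra.TensorProduct.one_def, one_mul]
    have h2 : ∀ (g g' : K) (a b : J), TensorProduct.rid k K ((counit (R := k)).lTensor K
        (D.mul (g ⊗ₜ a) (g' ⊗ₜ b))) = g * g' * D.σ a b := by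
      intro g g' a b
      rw [h.mul_tmul, ← D.rid_twist]
      induction D.twist a b with
      | zero => simp
      | add _ _ h₁ h₂ => simp only [mul_add, map_add, h₁, h₂]
      | tmul c d => simp
    -- associativity of the product of `1 # a`, `1 # b`, `1 # c`, followed by `id ⊗ ε`
    have e := congrArg (fun t => TensorProduct.rid k K ((counit (R := k)).lTensor K t))
      (hm (1 ⊗ₜ a) (1 ⊗ₜ b) (1 ⊗ₜ c))
    simp only [h1] at e
    have h3 : ∀ t, TensorProduct.rid k K ((counit (R := k)).lTensor K (D.mul t (1 ⊗ₜ c))) =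
        LinearMap.mul' k K ((D.σ.flip c).lTensor K t) := by
      intro t
      induction t with
      | zero => simp
      | add _ _ h₁ h₂ => simp only [map_add, LinearMap.add_apply, h₁, h₂]
      | tmul c d => simp [h2]
    have h4 : ∀ t, TensorProduct.rid k K ((counit (R := k)).lTensor K (D.mul (1 ⊗ₜ a) t)) =
        LinearMap.mul' k K ((D.σ a).lTensor K t) := by
      intro t
      induction t with
      | zero => simp
      | add _ _ h₁ h₂ => simp only [map_add, h₁, h₂]
      | tmul c d => simp [h2]
    have h5 : ∀ (s : J ⊗[k] J) t, LinearMap.mul' k K (TensorProduct.map₂ D.γ D.σ s t) =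
        LinearMap.mul' k K ((D.σ (TensorProduct.lid k J ((counit (R := k)).rTensor J s))).lTensor K
          t) := by
      intro s t
      induction t with
      | zero => simp
      | add _ _ h₁ h₂ => simp only [map_add, h₁, h₂]
      | tmul c d =>
        induction s with
        | zero => simp
        | add _ _ h₁ h₂ =>
          simp only [map_add, LinearMap.add_apply, h₁, h₂, LinearMap.lTensor_add]
        | tmul b b' => simp [h _ _]
    rw [h3, h4] at e
    rw [e, h5]
    simp

/-- The image of the coproduct of a crossed product with trivial coaction under the square of the
linear map `g ⊗ a ↦ i(g) j(a)`. -/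
theorem TrivialCoaction.map_comulMap (h : D.TrivialCoaction) {A : Type*} [Ring A] [Algebra k A]
    (i : K →ₐ[k] A) (j : J →ₗ[k] A) (g : K) (a : J) :
    TensorProduct.map (LinearMap.mul' k A ∘ₗ TensorProduct.map i.toLinearMap j)
        (LinearMap.mul' k A ∘ₗ TensorProduct.map i.toLinearMap j) (D.comulMap (g ⊗ₜ a)) =
      Algebra.TensorProduct.map i i (comul g) *
        LinearMap.mul' k (A ⊗[k] A) (TensorProduct.map
          ((Algebra.TensorProduct.map i i).toLinearMap ∘ₗ D.τ) (TensorProduct.map j j ∘ₗ comul)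
          (comul a)) := by
  set θ : K ⊗[k] J →ₗ[k] A := LinearMap.mul' k A ∘ₗ TensorProduct.map i.toLinearMap j with hθ
  have h1 : ∀ s t : K ⊗[k] K, ∀ u : J ⊗[k] J, TensorProduct.map θ θ
      (incl k K J s * (incl k K J t * TensorProduct.map (TensorProduct.mk k K J 1)
        (TensorProduct.mk k K J 1) u)) =
      Algebra.TensorProduct.map i i s *
        (Algebra.TensorProduct.map i i t * TensorProduct.map j j u) := by
    intro s t u
    induction s with
    | zero => simp
    | add _ _ h₁ h₂ => simp only [map_add, add_mul, h₁, h₂]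
    | tmul s s' =>
      induction t with
      | zero => simp
      | add _ _ h₁ h₂ => simp only [map_add, add_mul, mul_add, h₁, h₂]
      | tmul t t' =>
        induction u with
        | zero => simp
        | add _ _ h₁ h₂ => simp only [map_add, mul_add, h₁, h₂]
        | tmul u u' => simp [incl, hθ, mul_assoc]
  rw [comulMap, LinearMap.comp_apply, TensorProduct.map_tmul, LinearMap.mul'_apply,
    LinearMap.comp_apply, LinearMap.comp_apply, LinearMap.comp_apply]
  induction comul (R := k) a with
  | zero => simp
  | add _ _ h₁ h₂ => simp only [map_add, mul_add, h₁, h₂]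
  | tmul b c =>
    rw [TensorProduct.map_tmul, LinearMap.mul'_apply, LinearMap.comp_apply, h.coswap_eq, h1]
    rfl

end CrossedData

end CrossedCocycle

/-! ### The co-cocycle -/

section Cococycle

variable {k : Type u} [Field k] {r s : ℕ}

local notation "ι" => UniversalEnvelopingAlgebra.ι k

variable (k r s) in
/-- The linear map `∑ᵢ vᵢ ȳᵢ ↦ ∑ᵢ vᵢ xᵢ` from `Y` to `U(𝔏)`. -/
noncomputable def vecX : LieY k r →ₗ[k] UL k r s :=
  envInc ∘ₗ vecL k r s ∘ₗ (LieY.coords k r).toLinearMap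

theorem vecX_commutator (v w : LieY k r) :
    vecX k r s v * vecX k r s w - vecX k r s w * vecX k r s v =
      -((twistData k r s).β v w - (twistData k r s).β w v) • UL.x₀ k r s := by
  change ι _ * ι _ - ι _ * ι _ = _
  rw [← ι_lie, bracket_eq, UL.x₀, twistData_β_sub, neg_neg, ← map_smul, LieL.smul_def]
  simp only [smul_eq_mul, mul_one, smul_zero]
  rfl

theorem comul_vecX (v : LieY k r) : comul (R := k) (vecX k r s v) =
    vecX k r s v ⊗ₜ 1 + 1 ⊗ₜ vecX k r s v := comul_ι _

theorem comul_x₀ : comul (R := k) (UL.x₀ k r s) = UL.x₀ k r s ⊗ₜ 1 + 1 ⊗ₜ UL.x₀ k r s := comul_ι _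

variable (k r s) in
/-- The linear map `ȳᵢ ↦ x₀ ⊗ xᵢ - xᵢ ⊗ x₀`. -/
noncomputable def tauLin : LieY k r →ₗ[k] UL k r s ⊗[k] UL k r s :=
  (TensorProduct.mk k _ _ (UL.x₀ k r s) - (TensorProduct.mk k _ _).flip (UL.x₀ k r s)) ∘ₗ vecX k r s

theorem tauLin_apply (v : LieY k r) : tauLin k r s v =
    UL.x₀ k r s ⊗ₜ vecX k r s v - vecX k r s v ⊗ₜ UL.x₀ k r s := rfl

/-- The commutators vanish on each of the two parts of `Y`, on which the form is trivial. -/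
theorem tauLin_commutator (v w : LieY k r) :
    tauLin k r s v * tauLin k r s w - tauLin k r s w * tauLin k r s v =
      -((twistData k r s).β v w - (twistData k r s).β w v) •
        ((UL.x₀ k r s * UL.x₀ k r s) ⊗ₜ UL.x₀ k r s +
          UL.x₀ k r s ⊗ₜ (UL.x₀ k r s * UL.x₀ k r s)) := by
  have h := sub_eq_iff_eq_add.1 (vecX_commutator (s := s) v w)
  simp only [tauLin_apply, mul_sub, sub_mul, Algebra.TensorProduct.tmul_mul_tmul, h,
    ← (x₀_commute k r s (vecX k r s _)).eq, TensorProduct.add_tmul, TensorProduct.tmul_add,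
    ← TensorProduct.smul_tmul', TensorProduct.tmul_smul, smul_add]
  abel

theorem pi_β_pi (v w : LieY k r) :
    (twistData k r s).β ((twistData k r s).π v) ((twistData k r s).π w) -
      (twistData k r s).β ((twistData k r s).π w) ((twistData k r s).π v) = 0 := by
  rw [(twistData k r s).β_right, (twistData k r s).β_right, sub_zero]

theorem compl_β_compl (v w : LieY k r) :
    (twistData k r s).β (v - (twistData k r s).π v) (w - (twistData k r s).π w) -
      (twistData k r s).β (w - (twistData k r s).π w) (v - (twistData k r s).π v) = 0 := by
  rw [(twistData k r s).β_compl, (twistData k r s).β_compl, sub_zero]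

variable (k r s) in
/-- The algebra map on `U(Y)` given by `v ↦ tauLin (v - π v)`. -/
noncomputable def tauFirst : UY k r →ₐ[k] UL k r s ⊗[k] UL k r s :=
  envLift (tauLin k r s ∘ₗ (LinearMap.id - (twistData k r s).π)) (by
    intro v w
    have := tauLin_commutator (s := s) (v - (twistData k r s).π v) (w - (twistData k r s).π w)
    rw [compl_β_compl, neg_zero, zero_smul] at this
    rw [trivial_lie_zero, map_zero]
    exact this.symm)

variable (k r s) in
/-- The algebra map on `U(Y)` given by `v ↦ tauLin (π v)`. -/
noncomputable def tauSecond : UY k r →ₐ[k] UL k r s ⊗[k] UL k r s :=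
  envLift (tauLin k r s ∘ₗ (twistData k r s).π) (by
    intro v w
    have := tauLin_commutator (s := s) ((twistData k r s).π v) ((twistData k r s).π w)
    rw [pi_β_pi, neg_zero, zero_smul] at this
    rw [trivial_lie_zero, map_zero]
    exact this.symm)

theorem tauFirst_ι (v : LieY k r) :
    tauFirst k r s (ι v) = tauLin k r s (v - (twistData k r s).π v) := envLift_ι _ _ v

theorem tauSecond_ι (v : LieY k r) :
    tauSecond k r s (ι v) = tauLin k r s ((twistData k r s).π v) := envLift_ι _ _ v

variable (k r s) in
/-- The co-cocycle `τ`, in which the factors are ordered in the same way as in the cocycle. -/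
noncomputable def tau : UY k r →ₗ[k] UL k r s ⊗[k] UL k r s :=
  (convOf (tauFirst k r s) * convOf (tauSecond k r s)).ofConv

theorem tau_ι (v : LieY k r) : tau k r s (ι v) = tauLin k r s v := by
  change LinearMap.mul' k _ (TensorProduct.map (tauFirst k r s).toLinearMap
    (tauSecond k r s).toLinearMap (comul (ι v))) = _
  rw [comul_ι]
  simp only [map_add, TensorProduct.map_tmul, LinearMap.mul'_apply, AlgHom.toLinearMap_apply,
    map_one, mul_one, one_mul]
  rw [tauFirst_ι, tauSecond_ι, ← map_add, sub_add_cancel]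

theorem map_tau {Q : Type*} [Ring Q] [Algebra k Q] (F : UL k r s ⊗[k] UL k r s →ₐ[k] Q) :
    toConv (F.toLinearMap ∘ₗ tau k r s) =
      convOf (F.comp (tauFirst k r s)) * convOf (F.comp (tauSecond k r s)) :=
  convOf_comp_mul F _ _

/-- An algebra map that annihilates the values of `τ` on the generators turns `τ` into the
counit. -/
theorem map_tau_eq_counit {Q : Type*} [Ring Q] [Algebra k Q]
    (F : UL k r s ⊗[k] UL k r s →ₐ[k] Q) (h : ∀ v, F (tauLin k r s v) = 0) (a : UY k r) :
    F (tau k r s a) = counit (R := k) a • (1 : Q) := by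
  have h0 : ∀ v, (F.comp (tauFirst k r s)) (ι v) = 0 := fun v => by
    rw [AlgHom.comp_apply, tauFirst_ι, h]
  have h1 : ∀ v, (F.comp (tauSecond k r s)) (ι v) = 0 := fun v => by
    rw [AlgHom.comp_apply, tauSecond_ι, h]
  have h2 := convOf_mul_eq_convOf (f := F.comp (tauFirst k r s)) (g := F.comp (tauSecond k r s))
    (f' := (Algebra.ofId k Q).comp (Bialgebra.counitAlgHom k (UY k r)))
    (fun x y => by rw [h0]; exact Commute.zero_left _) (fun x => by
      rw [h0, h1, AlgHom.comp_apply]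
      change _ = Algebra.ofId k Q (counit (ι x))
      rw [counit_ι, map_zero, add_zero])
  rw [← map_tau] at h2
  refine (LinearMap.congr_fun (congrArg WithConv.ofConv h2) a).trans ?_
  exact Algebra.algebraMap_eq_smul_one _

theorem counit_vecX (v : LieY k r) : counit (R := k) (vecX k r s v) = 0 := counit_ι _

theorem counit_x₀ : counit (R := k) (UL.x₀ k r s) = 0 := counit_ι _

theorem tau_counit_left (a : UY k r) : TensorProduct.lid k (UL k r s)
    ((counit (R := k)).rTensor (UL k r s) (tau k r s a)) = counit (R := k) a • 1 :=
  map_tau_eq_counit ((Algebra.TensorProduct.lid k (UL k r s)).toAlgHom.comp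
    (Algebra.TensorProduct.map (Bialgebra.counitAlgHom k _) (AlgHom.id k _))) (fun v => by
      simp [tauLin_apply, counit_vecX, counit_x₀]) a

theorem tau_counit_right (a : UY k r) : TensorProduct.rid k (UL k r s)
    ((counit (R := k)).lTensor (UL k r s) (tau k r s a)) = counit (R := k) a • 1 :=
  map_tau_eq_counit ((Algebra.TensorProduct.rid k k (UL k r s)).toAlgHom.comp
    (Algebra.TensorProduct.map (AlgHom.id k _) (Bialgebra.counitAlgHom k _))) (fun v => by
      simp [tauLin_apply, counit_vecX, counit_x₀]) a

local notation "L" => UL k r s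

variable (k r s) in
/-- The algebra map `p ⊗ q ↦ Δ(p) ⊗ q`. -/
noncomputable def comulFirst : L ⊗[k] L →ₐ[k] L ⊗[k] (L ⊗[k] L) :=
  (Algebra.TensorProduct.assoc k k k L L L).toAlgHom.comp
    (Algebra.TensorProduct.map (Bialgebra.comulAlgHom k L) (AlgHom.id k L))

variable (k r s) in
/-- The algebra map `p ⊗ q ↦ p ⊗ Δ(q)`. -/
noncomputable def comulLast : L ⊗[k] L →ₐ[k] L ⊗[k] (L ⊗[k] L) :=
  Algebra.TensorProduct.map (AlgHom.id k L) (Bialgebra.comulAlgHom k L)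

variable (k r s) in
/-- The algebra map `p ⊗ q ↦ p ⊗ q ⊗ 1`. -/
noncomputable def inclHead : L ⊗[k] L →ₐ[k] L ⊗[k] (L ⊗[k] L) :=
  (Algebra.TensorProduct.assoc k k k L L L).toAlgHom.comp Algebra.TensorProduct.includeLeft

variable (k r s) in
/-- The algebra map `p ⊗ q ↦ 1 ⊗ p ⊗ q`. -/
noncomputable def inclTail : L ⊗[k] L →ₐ[k] L ⊗[k] (L ⊗[k] L) :=
  Algebra.TensorProduct.includeRight

theorem comulFirst_tauLin (v : LieY k r) : comulFirst k r s (tauLin k r s v) =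
    UL.x₀ k r s ⊗ₜ (1 ⊗ₜ vecX k r s v) + 1 ⊗ₜ (UL.x₀ k r s ⊗ₜ vecX k r s v) -
      (vecX k r s v ⊗ₜ (1 ⊗ₜ UL.x₀ k r s) + 1 ⊗ₜ (vecX k r s v ⊗ₜ UL.x₀ k r s)) := by
  simp [comulFirst, tauLin_apply, comul_vecX, comul_x₀, TensorProduct.add_tmul]

theorem comulLast_tauLin (v : LieY k r) : comulLast k r s (tauLin k r s v) =
    UL.x₀ k r s ⊗ₜ (vecX k r s v ⊗ₜ 1) + UL.x₀ k r s ⊗ₜ (1 ⊗ₜ vecX k r s v) -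
      (vecX k r s v ⊗ₜ (UL.x₀ k r s ⊗ₜ 1) + vecX k r s v ⊗ₜ (1 ⊗ₜ UL.x₀ k r s)) := by
  simp [comulLast, tauLin_apply, comul_vecX, comul_x₀, TensorProduct.tmul_add]

theorem inclHead_tauLin (v : LieY k r) : inclHead k r s (tauLin k r s v) =
    UL.x₀ k r s ⊗ₜ (vecX k r s v ⊗ₜ 1) - vecX k r s v ⊗ₜ (UL.x₀ k r s ⊗ₜ 1) := by
  simp [inclHead, tauLin_apply, TensorProduct.sub_tmul]

theorem inclTail_tauLin (v : LieY k r) : inclTail k r s (tauLin k r s v) =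
    1 ⊗ₜ (UL.x₀ k r s ⊗ₜ vecX k r s v) - 1 ⊗ₜ (vecX k r s v ⊗ₜ UL.x₀ k r s) := by
  simp [inclTail, tauLin_apply, TensorProduct.tmul_sub]

/-- The two contributions of `[xᵢ, xⱼ]` to the commutator cancel. -/
theorem commute_comulFirst_inclHead (v w : LieY k r) :
    Commute (comulFirst k r s (tauLin k r s v)) (inclHead k r s (tauLin k r s w)) := by
  have h := sub_eq_iff_eq_add.1 (vecX_commutator (s := s) v w)
  change _ * _ = _ * _
  rw [comulFirst_tauLin, inclHead_tauLin]
  simp only [mul_sub, sub_mul, mul_add, add_mul, Algebra.TensorProduct.tmul_mul_tmul, h,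
    ← (x₀_commute k r s (vecX k r s _)).eq, TensorProduct.add_tmul, TensorProduct.tmul_add,
    ← TensorProduct.smul_tmul', TensorProduct.tmul_smul, mul_one, one_mul]
  abel

theorem commute_comulLast_inclTail (v w : LieY k r) :
    Commute (comulLast k r s (tauLin k r s v)) (inclTail k r s (tauLin k r s w)) := by
  have h := sub_eq_iff_eq_add.1 (vecX_commutator (s := s) v w)
  change _ * _ = _ * _
  rw [comulLast_tauLin, inclTail_tauLin]
  simp only [mul_sub, sub_mul, mul_add, add_mul, Algebra.TensorProduct.tmul_mul_tmul, h,
    ← (x₀_commute k r s (vecX k r s _)).eq, TensorProduct.add_tmul, TensorProduct.tmul_add,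
    ← TensorProduct.smul_tmul', TensorProduct.tmul_smul, mul_one, one_mul]
  abel

/-- The co-cocycle identity of `tau`. -/
theorem tau_cococycle :
    toConv ((comulFirst k r s).toLinearMap ∘ₗ tau k r s) *
        toConv ((inclHead k r s).toLinearMap ∘ₗ tau k r s) =
      toConv ((comulLast k r s).toLinearMap ∘ₗ tau k r s) *
        toConv ((inclTail k r s).toLinearMap ∘ₗ tau k r s) := by
  have key : ∀ v, comulFirst k r s (tauLin k r s v) + inclHead k r s (tauLin k r s v) =
      comulLast k r s (tauLin k r s v) + inclTail k r s (tauLin k r s v) := fun v => by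
    rw [comulFirst_tauLin, comulLast_tauLin, inclHead_tauLin, inclTail_tauLin]
    abel
  have hf : ∀ (F : L ⊗[k] L →ₐ[k] L ⊗[k] (L ⊗[k] L)) v, F.comp (tauFirst k r s) (ι v) =
      F (tauLin k r s (v - (twistData k r s).π v)) := fun F v => by
    rw [AlgHom.comp_apply, tauFirst_ι]
  have hs : ∀ (F : L ⊗[k] L →ₐ[k] L ⊗[k] (L ⊗[k] L)) v, F.comp (tauSecond k r s) (ι v) =
      F (tauLin k r s ((twistData k r s).π v)) := fun F v => by
    rw [AlgHom.comp_apply, tauSecond_ι]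
  rw [map_tau, map_tau, map_tau, map_tau,
    convOf_mul_mul_mul_comm (g₁ := (comulFirst k r s).comp (tauSecond k r s))
      (f₂ := (inclHead k r s).comp (tauFirst k r s))
      (fun v w => by rw [hf, hs]; exact (commute_comulFirst_inclHead _ _).symm),
    convOf_mul_mul_mul_comm (g₁ := (comulLast k r s).comp (tauSecond k r s))
      (f₂ := (inclTail k r s).comp (tauFirst k r s))
      (fun v w => by rw [hf, hs]; exact (commute_comulLast_inclTail _ _).symm),
    convOf_mul_eq (f := (comulFirst k r s).comp (tauFirst k r s))
      (g := (inclHead k r s).comp (tauFirst k r s))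
      (f' := (comulLast k r s).comp (tauFirst k r s))
      (g' := (inclTail k r s).comp (tauFirst k r s))
      (fun v w => by rw [hf, hf]; exact commute_comulFirst_inclHead _ _)
      (fun v w => by rw [hf, hf]; exact commute_comulLast_inclTail _ _)
      (fun v => by rw [hf, hf, hf, hf]; exact key _),
    convOf_mul_eq (f := (comulFirst k r s).comp (tauSecond k r s))
      (g := (inclHead k r s).comp (tauSecond k r s))
      (f' := (comulLast k r s).comp (tauSecond k r s))
      (g' := (inclTail k r s).comp (tauSecond k r s))
      (fun v w => by rw [hs, hs]; exact commute_comulFirst_inclHead _ _)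
      (fun v w => by rw [hs, hs]; exact commute_comulLast_inclTail _ _)
      (fun v => by rw [hs, hs, hs, hs]; exact key _)]

end Cococycle

/-! ### The crossed product of `U(𝔏)` and `U(Y)` -/

section First

variable {k : Type u} [Field k] {r s : ℕ}

local notation "ι" => UniversalEnvelopingAlgebra.ι k

variable (k r s) in
/-- The data of the crossed product `U(𝔏)^τ #_σ U(Y)`. -/
noncomputable def dataLY : CrossedData k (UL k r s) (UY k r) where
  γ := (counit (R := k) (A := UY k r)).smulRight LinearMap.id
  σ := (twistData k r s).cocycle
  ρ := (TensorProduct.mk k (UY k r) (UL k r s)).flip 1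
  τ := tau k r s

theorem dataLY_trivialAction : (dataLY k r s).TrivialAction := fun _ _ => rfl

theorem dataLY_trivialCoaction : (dataLY k r s).TrivialCoaction := fun _ => rfl

/-- The product of the crossed product is that of the twisted product. -/
theorem dataLY_mul (p q : UL k r s ⊗[k] UY k r) :
    (dataLY k r s).mul p q = (twistData k r s).mulOp p q := by
  induction p with
  | zero => simp
  | add _ _ h₁ h₂ => simp only [map_add, LinearMap.add_apply, h₁, h₂]
  | tmul g a =>
    induction q with
    | zero => simp
    | add _ _ h₁ h₂ => simp only [map_add, h₁, h₂]
    | tmul g' a' =>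
      rw [dataLY_trivialAction.mul_tmul, TwistData.mulOp_tmul_tmul]
      have h : ∀ (g : UL k r s) (t : UL k r s ⊗[k] UY k r),
          (g ⊗ₜ[k] (1 : UY k r)) * t = TwistData.leftOp g t := by
        intro g t
        induction t with
        | zero => simp
        | add _ _ h₁ h₂ => simp only [mul_add, map_add, h₁, h₂]
        | tmul c d => simp
      exact h _ _

theorem dataLY_isCocycle : (dataLY k r s).IsCocycle :=
  dataLY_trivialAction.isCocycle (twistData k r s).cocycle_one_left
    (twistData k r s).cocycle_one_right (fun p q t => by
      simp only [dataLY_mul]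
      exact (twistData k r s).mulOp_assoc p q t)

theorem dataLY_isCococycle : (dataLY k r s).IsCococycle where
  counit_left := tau_counit_left
  counit_right := tau_counit_right
  cococycle a := by
    refine Eq.trans ?_ (LinearMap.congr_fun (congrArg WithConv.ofConv
      (tau_cococycle (k := k) (r := r) (s := s))) a)
    change _ = LinearMap.mul' k _ (TensorProduct.map _ _ (comul a))
    induction comul (R := k) a with
    | zero => simp
    | add _ _ h₁ h₂ => simp only [map_add, h₁, h₂]
    | tmul c d =>
      simp only [TensorProduct.map_tmul, LinearMap.mul'_apply, LinearMap.comp_apply]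
      exact map_mul (Algebra.TensorProduct.assoc k k k _ _ _) _ _

variable {κ : Type v} (b : Module.Basis κ k (so (normalForm k r s)))

local notation "H" => UMrs k r s b

theorem homL_vecX (v : LieY k r) : homL b (vecX k r s v) =
    ∑ i, LieY.coords k r v i • UM.gen (normalForm k r s) b (.x i) := by
  change homL b (ι (⟨0, LieY.coords k r v⟩ : LieL k r s)) = _
  rw [homL_ι, linL_apply, zero_smul, zero_add]

variable [CharZero k]

theorem comul_gen (g : Gen r κ) :
    comul (R := k) (UM.gen (normalForm k r s) b g) = UM.comulGen _ b g :=
  UM.comulHom_gen _ b g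

theorem counit_gen (g : Gen r κ) : counit (R := k) (UM.gen (normalForm k r s) b g) = 0 :=
  UM.counitHom_gen _ b g

theorem comul_linL (p : LieL k r s) : comul (R := k) (linL b p) =
    linL b p ⊗ₜ 1 + 1 ⊗ₜ linL b p := by
  simp only [linL_apply, map_add, map_smul, map_sum, comul_gen, UM.comulGen, smul_add,
    Finset.sum_add_distrib, TensorProduct.add_tmul, TensorProduct.tmul_add, TensorProduct.sum_tmul,
    TensorProduct.tmul_sum, TensorProduct.smul_tmul', TensorProduct.tmul_smul]
  abel

theorem counit_linL (p : LieL k r s) : counit (R := k) (linL b p) = 0 := by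
  simp [linL_apply, counit_gen]

/-- The algebra map `U(𝔏) ⊗ U(𝔏) → UM(r, 2s) ⊗ UM(r, 2s)`. -/
noncomputable def homLL : UL k r s ⊗[k] UL k r s →ₐ[k] H ⊗[k] H :=
  Algebra.TensorProduct.map (homL b) (homL b)

theorem comul_homL (g : UL k r s) : comul (R := k) (homL b g) = homLL b (comul g) :=
  AlgHom.congr_fun (φ₁ := (Bialgebra.comulAlgHom k H).comp (homL b))
    (φ₂ := (homLL b).comp (Bialgebra.comulAlgHom k (UL k r s))) (env_hom_ext fun p => by
      change comul (homL b (ι p)) = homLL b (comul (ι p))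
      rw [comul_ι, homL_ι, comul_linL, homLL, map_add, Algebra.TensorProduct.map_tmul,
        Algebra.TensorProduct.map_tmul, map_one, homL_ι]) g

theorem counit_homL (g : UL k r s) : counit (R := k) (homL b g) = counit (R := k) g :=
  AlgHom.congr_fun (φ₁ := (Bialgebra.counitAlgHom k H).comp (homL b))
    (φ₂ := Bialgebra.counitAlgHom k (UL k r s)) (env_hom_ext fun p => by
      change counit (homL b (ι p)) = counit (ι p)
      rw [counit_ι, homL_ι, counit_linL]) g

theorem comul_linY (v : LieY k r) : comul (R := k) (linY b v) =
    homLL b (tauLin k r s v) + (linY b v ⊗ₜ 1 + 1 ⊗ₜ linY b v) := by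
  rw [tauLin_apply, map_sub, homLL, Algebra.TensorProduct.map_tmul, Algebra.TensorProduct.map_tmul,
    homL_x₀, homL_vecX, linY_apply]
  simp only [map_smul, map_sum, comul_gen, UM.comulGen, smul_add, smul_sub,
    Finset.sum_add_distrib, Finset.sum_sub_distrib, TensorProduct.sum_tmul,
    TensorProduct.tmul_sum, TensorProduct.smul_tmul', TensorProduct.tmul_smul]
  abel

theorem counit_linY (v : LieY k r) : counit (R := k) (linY b v) = 0 := by
  simp [linY_apply, counit_gen]

theorem counit_sec (a : UY k r) : counit (R := k) ((pairUM b).sec a) = counit (R := k) a := by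
  have h1 : ∀ v, ((Bialgebra.counitAlgHom k H).comp (pairUM b).first) (ι v) = 0 := fun v => by
    rw [AlgHom.comp_apply, (pairUM b).first_ι]
    exact counit_linY b _
  have h2 : ∀ v, ((Bialgebra.counitAlgHom k H).comp (pairUM b).second) (ι v) = 0 := fun v => by
    rw [AlgHom.comp_apply, (pairUM b).second_ι]
    exact counit_linY b _
  have h := convOf_mul_eq_convOf (f' := Bialgebra.counitAlgHom k (UY k r))
    (fun x y => Commute.all (((Bialgebra.counitAlgHom k H).comp (pairUM b).first) (ι x))
      (((Bialgebra.counitAlgHom k H).comp (pairUM b).second) (ι y))) (fun v => by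
      rw [h1, h2, add_zero]
      exact (counit_ι v).symm)
  rw [← convOf_comp_mul] at h
  exact LinearMap.congr_fun (congrArg WithConv.ofConv h) a

/-- The coproduct of an ordered monomial in the `yᵢ`. -/
theorem comul_sec (a : UY k r) : comul (R := k) ((pairUM b).sec a) =
    LinearMap.mul' k (H ⊗[k] H) (TensorProduct.map ((homLL b).toLinearMap ∘ₗ tau k r s)
      (TensorProduct.map (pairUM b).sec (pairUM b).sec ∘ₗ comul) (comul a)) := by
  let il : H →ₐ[k] H ⊗[k] H := Algebra.TensorProduct.includeLeft
  let ir : H →ₐ[k] H ⊗[k] H := Algebra.TensorProduct.includeRight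
  let F₁ := (homLL b).comp (tauFirst k r s)
  let F₂ := (homLL b).comp (tauSecond k r s)
  let L₁ := il.comp (pairUM b).first
  let L₂ := il.comp (pairUM b).second
  let R₁ := ir.comp (pairUM b).first
  let R₂ := ir.comp (pairUM b).second
  have hil : ∀ x y : H, Commute (il x) (ir y) := fun x y => by
    change _ * _ = _ * _
    simp [il, ir]
  have hLR₁ : ∀ v w, Commute (L₁ (ι v)) (R₁ (ι w)) := fun _ _ => hil _ _
  have hLR₂ : ∀ v w, Commute (L₂ (ι v)) (R₂ (ι w)) := fun _ _ => hil _ _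
  have hLR₃ : ∀ v w, Commute (L₂ (ι v)) (R₁ (ι w)) := fun _ _ => hil _ _
  have hT : ∀ t v, Commute (homLL b t) (il (linY b v) + ir (linY b v)) := fun t v => by
    have hc := fun g => ((pairUM b).comm g v).eq
    change _ * _ = _ * _
    induction t with
    | zero => simp
    | add _ _ h₁ h₂ => rw [map_add, add_mul, h₁, h₂, ← mul_add]
    | tmul g g' => simp [homLL, il, ir, mul_add, add_mul, hc]
  have hF₁ : ∀ v, F₁ (ι v) = homLL b (tauLin k r s (v - (twistData k r s).π v)) := fun v => by
    rw [AlgHom.comp_apply, tauFirst_ι]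
  have hF₂ : ∀ v, F₂ (ι v) = homLL b (tauLin k r s ((twistData k r s).π v)) := fun v => by
    rw [AlgHom.comp_apply, tauSecond_ι]
  have hP₁ : ∀ v, convHom L₁ R₁ hLR₁ (ι v) =
      il (linY b (v - (twistData k r s).π v)) + ir (linY b (v - (twistData k r s).π v)) :=
    fun v => by
      rw [convHom_ι, AlgHom.comp_apply, AlgHom.comp_apply, (pairUM b).first_ι]
  have hP₂ : ∀ v, convHom L₂ R₂ hLR₂ (ι v) =
      il (linY b ((twistData k r s).π v)) + ir (linY b ((twistData k r s).π v)) := fun v => by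
    rw [convHom_ι, AlgHom.comp_apply, AlgHom.comp_apply, (pairUM b).second_ι]
  -- `Δ` of each part is a convolution product of algebra maps, and the middle factors commute
  have h₁ : convOf F₁ * (convOf L₁ * convOf R₁) =
      convOf ((Bialgebra.comulAlgHom k H).comp (pairUM b).first) := by
    rw [← convOf_convHom L₁ R₁ hLR₁]
    refine convOf_mul_eq_convOf (fun v w => ?_) fun v => ?_
    · rw [hF₁, hP₁]; exact hT _ _
    · rw [hF₁, hP₁, AlgHom.comp_apply, (pairUM b).first_ι]
      exact (comul_linY b _).symm
  have h₂ : convOf F₂ * (convOf L₂ * convOf R₂) =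
      convOf ((Bialgebra.comulAlgHom k H).comp (pairUM b).second) := by
    rw [← convOf_convHom L₂ R₂ hLR₂]
    refine convOf_mul_eq_convOf (fun v w => ?_) fun v => ?_
    · rw [hF₂, hP₂]; exact hT _ _
    · rw [hF₂, hP₂, AlgHom.comp_apply, (pairUM b).second_ι]
      exact (comul_linY b _).symm
  have h₃ : convOf F₁ * (convOf L₁ * convOf R₁) * (convOf F₂ * (convOf L₂ * convOf R₂)) =
      convOf F₁ * convOf F₂ * (convOf L₁ * convOf L₂ * (convOf R₁ * convOf R₂)) := by
    rw [← convOf_mul_mul_mul_comm (g₁ := R₁) (f₂ := L₂) hLR₃,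
      ← convOf_convHom L₁ R₁ hLR₁, ← convOf_convHom L₂ R₂ hLR₂]
    refine convOf_mul_mul_mul_comm (fun v w => ?_) _ _
    rw [hF₂, hP₁]
    exact hT _ _
  rw [h₁, h₂, ← convOf_comp_mul] at h₃
  refine (LinearMap.congr_fun (congrArg WithConv.ofConv h₃) a).trans ?_
  rw [← map_tau]
  change LinearMap.mul' k _ (TensorProduct.map ((homLL b).toLinearMap ∘ₗ tau k r s)
    ((convOf L₁ * convOf L₂ * (convOf R₁ * convOf R₂)).ofConv) (comul a)) = _
  congr 3
  rw [← convOf_comp_mul, ← convOf_comp_mul]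
  ext a
  change LinearMap.mul' k _ (TensorProduct.map (il.toLinearMap ∘ₗ (pairUM b).sec)
    (ir.toLinearMap ∘ₗ (pairUM b).sec) (comul a)) = TensorProduct.map _ _ (comul a)
  induction comul (R := k) a with
  | zero => simp
  | add _ _ h₁ h₂ => simp only [map_add, h₁, h₂]
  | tmul c d => simp [il, ir]

end First

section SystemLY

variable {k : Type u} [Field k] {r s : ℕ} {κ : Type v}
  (b : Module.Basis κ k (so (normalForm k r s)))

local notation "ι" => UniversalEnvelopingAlgebra.ι k

local notation "H" => UMrs k r s b

theorem antipodeHom_linL (p : LieL k r s) :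
    UM.antipodeHom (normalForm k r s) b (linL b p) = MulOpposite.op (-linL b p) := by
  simp only [linL_apply, map_add, map_sum, map_smul, UM.antipodeHom_gen, MulOpposite.op_neg,
    MulOpposite.op_add, MulOpposite.op_smul, Finset.op_sum, smul_neg, Finset.sum_neg_distrib,
    neg_add]

theorem antipodeHom_linY (v : LieY k r) :
    UM.antipodeHom (normalForm k r s) b (linY b v) = MulOpposite.op (-linY b v) := by
  simp only [linY_apply, map_sum, map_smul, UM.antipodeHom_gen, MulOpposite.op_neg,
    MulOpposite.op_smul, Finset.op_sum, smul_neg, Finset.sum_neg_distrib]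

variable [CharZero k]

theorem dataLY_isHopfMap : (dataLY k r s).IsHopfMap (pairUM b).ext where
  map_one := by
    rw [Algebra.TensorProduct.one_def, (pairUM b).ext_tmul, map_one, (pairUM b).sec_one, one_mul]
  map_mul p q := by rw [dataLY_mul, (pairUM b).ext_mulOp]
  map_comul p := by
    induction p with
    | zero => simp
    | add _ _ h₁ h₂ => simp only [map_add, h₁, h₂]
    | tmul g a =>
      rw [(pairUM b).ext_tmul, Bialgebra.comul_mul, comul_homL, comul_sec]
      exact (dataLY_trivialCoaction.map_comulMap (homL b) (pairUM b).sec g a).symm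
  map_counit p := by
    induction p with
    | zero => simp
    | add _ _ h₁ h₂ => simp only [map_add, h₁, h₂]
    | tmul g a =>
      rw [(pairUM b).ext_tmul, Bialgebra.counit_mul, counit_homL, counit_sec]
      rfl

theorem antipode_homT (p : TAlg k r s) :
    HopfAlgebra.antipode k (homT b p) ∈ (homT b).range := by
  let S : Subalgebra k (TAlg k r s) :=
    (homT b).range.op.comap ((UM.antipodeHom (normalForm k r s) b).comp (homT b))
  have key : ∀ q, q ∈ S ↔
      (UM.antipodeHom (normalForm k r s) b (homT b q)).unop ∈ (homT b).range := fun q => Iff.rfl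
  have hS : S = ⊤ := by
    refine (twistData k r s).subalgebra_eq_top_of_env S (fun x => ?_) fun v => ?_
    · rw [key, homT_algK, homL_ι, antipodeHom_linL, MulOpposite.unop_op, ← homL_ι, ← homT_algK]
      exact neg_mem ⟨_, rfl⟩
    · rw [key, homT_algY, antipodeHom_linY, MulOpposite.unop_op, ← homT_algY]
      exact neg_mem ⟨_, rfl⟩
  have hp : p ∈ S := by rw [hS]; trivial
  exact hp

/-- The crossed product `U(𝔏)^τ #_σ U(Y)`; it is a Hopf algebra because it embeds in
`UM(r, 2s)`. -/
noncomputable def sysLY : CrossedSystem k (UL k r s) (UY k r) :=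
  (dataLY_isHopfMap b).crossedSystem (homT_injective b) dataLY_trivialAction.isWeakAction
    dataLY_trivialCoaction.isWeakCoaction dataLY_isCocycle dataLY_isCococycle
    fun p => antipode_homT b p

/-- The map of bialgebras from `U(𝔏)^τ #_σ U(Y)` to `UM(r, 2s)`. -/
noncomputable def homLY : (sysLY b).Prod →ₐc[k] H := (sysLY b).bialgHom (dataLY_isHopfMap b)

/-- The crossed product `U(𝔏)^τ #_σ U(Y)`, identified as an algebra with the twisted product. -/
noncomputable def equivLY : TAlg k r s ≃ₐ[k] (sysLY b).Prod :=
  AlgEquiv.ofLinearEquiv (A₂ := (sysLY b).Prod) (LinearEquiv.refl k (UL k r s ⊗[k] UY k r)) rfl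
    fun p q => (dataLY_mul p q).symm

theorem homLY_equivLY (p : TAlg k r s) : homLY b (equivLY b p) = homT b p := rfl

end SystemLY

/-! ### Smash products -/

section Smash

variable {k : Type u} [Field k] {K : Type v} {J : Type w}
  [Ring K] [HopfAlgebra k K] [Ring J] [HopfAlgebra k J]
  {A : Type*} [Ring A] [HopfAlgebra k A]

/-- The data of a smash product: only the action is not trivial. -/
noncomputable def smashData (act : J →ₗ[k] K →ₗ[k] K) : CrossedData k K J where
  γ := act
  σ := (counit (R := k) (A := J)).smulRight ((counit (R := k) (A := J)).smulRight 1)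
  ρ := (TensorProduct.mk k J K).flip 1
  τ := (counit (R := k) (A := J)).smulRight (1 ⊗ₜ 1)

variable (act : J →ₗ[k] K →ₗ[k] K)

theorem smashData_trivialCocycle : (smashData act).TrivialCocycle := fun a c => by
  simp [smashData, smul_smul]

theorem smashData_trivialCococycle : (smashData act).TrivialCococycle := fun _ => rfl

theorem smashData_trivialCoaction : (smashData act).TrivialCoaction := fun _ => rfl

variable {act}

/-- The linear map `g ⊗ a ↦ i(g) j(a)`. -/
noncomputable def mulMap (i : K →ₐc[k] A) (j : J →ₐc[k] A) : K ⊗[k] J →ₗ[k] A :=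
  LinearMap.mul' k A ∘ₗ TensorProduct.map (i : K →ₐ[k] A).toLinearMap (j : J →ₐ[k] A).toLinearMap

theorem mulMap_tmul (i : K →ₐc[k] A) (j : J →ₐc[k] A) (g : K) (a : J) :
    mulMap i j (g ⊗ₜ a) = i g * j a := rfl

theorem smashData_map_mul (i : K →ₐc[k] A) (j : J →ₐc[k] A)
    (h : ∀ a g, j a * i g = mulMap i j ((act.flip g).rTensor J (comul a)))
    (g g' : K) (a c : J) : mulMap i j ((smashData act).mul (g ⊗ₜ a) (g' ⊗ₜ c)) =
      mulMap i j (g ⊗ₜ a) * mulMap i j (g' ⊗ₜ c) := by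
  have h1 : ∀ t, mulMap i j ((g ⊗ₜ[k] (1 : J)) * (t * ((1 : K) ⊗ₜ c))) =
      i g * mulMap i j t * j c := by
    intro t
    induction t with
    | zero => simp
    | add _ _ h₁ h₂ => simp only [map_add, add_mul, mul_add, h₁, h₂]
    | tmul p d => simp [mulMap_tmul, mul_assoc]
  rw [(smashData_trivialCocycle act).mul_tmul, h1]
  change _ * mulMap i j ((act.flip g').rTensor J (comul a)) * _ = _
  rw [← h, mulMap_tmul, mulMap_tmul, mul_assoc, mul_assoc, mul_assoc]

/-- The multiplication map of a smash product into a Hopf algebra, given by maps of bialgebras that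
are compatible with the action. -/
theorem smashData_isHopfMap (i : K →ₐc[k] A) (j : J →ₐc[k] A)
    (h : ∀ a g, j a * i g = mulMap i j ((act.flip g).rTensor J (comul a))) :
    (smashData act).IsHopfMap (mulMap i j) where
  map_one := by
    rw [Algebra.TensorProduct.one_def, mulMap_tmul, map_one, map_one, one_mul]
  map_mul p q := by
    induction p with
    | zero => simp
    | add _ _ h₁ h₂ => simp only [map_add, LinearMap.add_apply, add_mul, h₁, h₂]
    | tmul g a =>
      induction q with
      | zero => simp
      | add _ _ h₁ h₂ => simp only [map_add, mul_add, h₁, h₂]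
      | tmul g' a' => exact smashData_map_mul i j h g g' a a'
  map_comul p := by
    induction p with
    | zero => simp
    | add _ _ h₁ h₂ => simp only [map_add, h₁, h₂]
    | tmul g a =>
      refine Eq.trans ?_ ((smashData_trivialCoaction act).map_comulMap (i : K →ₐ[k] A)
        (j : J →ₐ[k] A).toLinearMap g a).symm
      have h1 : comul (R := k) (i g) =
          Algebra.TensorProduct.map (i : K →ₐ[k] A) (i : K →ₐ[k] A) (comul g) :=
        (CoalgHomClass.map_comp_comul_apply i g).symm
      have h2 : comul (R := k) (j a) = TensorProduct.map (j : J →ₐ[k] A).toLinearMap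
          (j : J →ₐ[k] A).toLinearMap (comul a) :=
        (CoalgHomClass.map_comp_comul_apply j a).symm
      rw [mulMap_tmul, Bialgebra.comul_mul, h1, h2]
      congr 1
      have h3 : ∀ t : J ⊗[k] J, LinearMap.mul' k (A ⊗[k] A) (TensorProduct.map
          ((Algebra.TensorProduct.map (i : K →ₐ[k] A) (i : K →ₐ[k] A)).toLinearMap ∘ₗ
            (smashData act).τ)
          (TensorProduct.map (j : J →ₐ[k] A).toLinearMap (j : J →ₐ[k] A).toLinearMap ∘ₗ comul) t) =
          TensorProduct.map (j : J →ₐ[k] A).toLinearMap (j : J →ₐ[k] A).toLinearMap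
            (comul (TensorProduct.lid k _ ((counit (R := k)).rTensor _ t))) := by
        intro t
        induction t with
        | zero => simp
        | add _ _ h₁ h₂ => simp only [map_add, h₁, h₂]
        | tmul c d =>
          simp only [TensorProduct.map_tmul, LinearMap.mul'_apply, LinearMap.comp_apply,
            smashData_trivialCococycle act c, map_smul, ← Algebra.TensorProduct.one_def,
            AlgHom.toLinearMap_apply, map_one, smul_mul_assoc, one_mul, LinearMap.rTensor_tmul,
            TensorProduct.lid_tmul]
      rw [h3]
      simp
  map_counit p := by
    induction p with
    | zero => simp
    | add _ _ h₁ h₂ => simp only [map_add, h₁, h₂]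
    | tmul g a =>
      rw [mulMap_tmul, Bialgebra.counit_mul, CoalgHomClass.counit_comp_apply,
        CoalgHomClass.counit_comp_apply]
      rfl

variable (i : K →ₐc[k] A) (j : J →ₐc[k] A)

/-- The smash product, as a Hopf algebra isomorphic to a given one. -/
noncomputable def smashSystem (hact : (smashData act).IsWeakAction)
    (h : ∀ a g, j a * i g = mulMap i j ((act.flip g).rTensor J (comul a)))
    (hb : Function.Bijective (mulMap i j)) : CrossedSystem k K J :=
  (smashData_isHopfMap i j h).crossedSystem hb.1 hact
    (smashData_trivialCoaction act).isWeakCoaction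
    ((smashData_trivialCocycle act).isCocycle hact)
    ((smashData_trivialCococycle act).isCococycle (smashData_trivialCoaction act))
    fun _ => hb.2 _

/-- The isomorphism of a Hopf algebra with a smash product. -/
noncomputable def smashEquiv (hact : (smashData act).IsWeakAction)
    (h : ∀ a g, j a * i g = mulMap i j ((act.flip g).rTensor J (comul a)))
    (hb : Function.Bijective (mulMap i j)) : A ≃ₐc[k] (smashSystem i j hact h hb).Prod :=
  (BialgEquiv.ofBijective ((smashSystem i j hact h hb).bialgHom (smashData_isHopfMap i j h))
    hb).symm

theorem smashEquiv_mul (hact : (smashData act).IsWeakAction)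
    (h : ∀ a g, j a * i g = mulMap i j ((act.flip g).rTensor J (comul a)))
    (hb : Function.Bijective (mulMap i j)) (g : K) (a : J) :
    smashEquiv i j hact h hb (i g * j a) = (smashSystem i j hact h hb).tmul g a :=
  (BialgEquiv.ofBijective ((smashSystem i j hact h hb).bialgHom (smashData_isHopfMap i j h))
    hb).symm_apply_apply ((smashSystem i j hact h hb).tmul g a)

end Smash

/-! ### The crossed product with `U(𝔰𝔬(B))` -/

section SystemSo

variable {k : Type u} [Field k] [CharZero k] {r s : ℕ} {κ : Type v}
  (b : Module.Basis κ k (so (normalForm k r s)))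

local notation "ι" => UniversalEnvelopingAlgebra.ι k

local notation "H" => UMrs k r s b

/-- The action of `U(𝔰𝔬(B))` on `U(𝔏)^τ #_σ U(Y)`. -/
noncomputable def actLY : USo k r s →ₗ[k] (sysLY b).Prod →ₗ[k] (sysLY b).Prod :=
  (equivLY b).toLinearEquiv.conj.toLinearMap ∘ₗ soAct.toLinearMap

theorem actLY_equivLY (a : USo k r s) (p : TAlg k r s) :
    actLY b a (equivLY b p) = equivLY b (soAct a p) := by
  simp [actLY, LinearEquiv.conj_apply]

theorem actLY_mul (a c : USo k r s) (p : (sysLY b).Prod) :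
    actLY b (a * c) p = actLY b a (actLY b c p) := by
  obtain ⟨p, rfl⟩ := (equivLY b).surjective p
  rw [actLY_equivLY, actLY_equivLY, actLY_equivLY, map_mul, Module.End.mul_apply]

theorem actLY_isWeakAction : (smashData (actLY b)).IsWeakAction where
  one_act g := by
    obtain ⟨p, rfl⟩ := (equivLY b).surjective g
    change actLY b 1 _ = _
    rw [actLY_equivLY, map_one, Module.End.one_apply]
  act_one a := by
    change actLY b a 1 = _
    rw [← map_one (equivLY b), actLY_equivLY, soAct_one, map_smul]
  act_mul a g h := by
    obtain ⟨p, rfl⟩ := (equivLY b).surjective g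
    obtain ⟨q, rfl⟩ := (equivLY b).surjective h
    change actLY b a _ = LinearMap.mul' k _ (TensorProduct.map ((actLY b).flip _)
      ((actLY b).flip _) (comul a))
    rw [← map_mul, actLY_equivLY, soAct_mul]
    induction comul (R := k) a with
    | zero => simp
    | add _ _ h₁ h₂ => simp only [map_add, h₁, h₂]
    | tmul c d => simp [actLY_equivLY]

theorem comul_linSo (M : so (normalForm k r s)) : comul (R := k) (linSo b M) =
    linSo b M ⊗ₜ 1 + 1 ⊗ₜ linSo b M := by
  refine LinearMap.congr_fun (f := comul ∘ₗ linSo b)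
    (g := ((TensorProduct.mk k H H).flip 1 + TensorProduct.mk k H H 1) ∘ₗ linSo b)
    (b.ext fun j => ?_) M
  simp only [LinearMap.comp_apply, linSo_basis, comul_gen]
  rfl

theorem counit_linSo (M : so (normalForm k r s)) : counit (R := k) (linSo b M) = 0 := by
  refine LinearMap.congr_fun (f := counit ∘ₗ linSo b) (g := 0) (b.ext fun j => ?_) M
  simp only [LinearMap.comp_apply, linSo_basis, counit_gen]
  rfl

/-- The map `U(𝔰𝔬(B)) → UM(r, 2s)` as a map of bialgebras. -/
noncomputable def bialgSo : USo k r s →ₐc[k] H :=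
  BialgHom.ofAlgHom (homSo b)
    (env_hom_ext fun M => by
      change counit (homSo b (ι M)) = counit (ι M)
      rw [counit_ι, homSo_ι, counit_linSo])
    (env_hom_ext fun M => by
      change Algebra.TensorProduct.map (homSo b) (homSo b) (comul (ι M)) = comul (homSo b (ι M))
      rw [comul_ι, homSo_ι, comul_linSo, map_add, Algebra.TensorProduct.map_tmul,
        Algebra.TensorProduct.map_tmul, map_one, homSo_ι])

theorem mulMap_eq (t : TAlg k r s ⊗[k] USo k r s) : mulMap (homLY b) (bialgSo b)
    ((equivLY b).toLinearMap.rTensor (USo k r s) t) = mulUM b t := by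
  induction t with
  | zero => simp
  | add _ _ h₁ h₂ => simp only [map_add, h₁, h₂]
  | tmul p a => rfl

theorem mulMap_bijective : Function.Bijective (mulMap (homLY b) (bialgSo b)) := by
  have hb := mulUM_bijective b
  have h : mulUM b = mulMap (homLY b) (bialgSo b) ∘
      ((equivLY b).toLinearEquiv.rTensor (USo k r s)) := funext fun t => (mulMap_eq b t).symm
  rw [h] at hb
  exact (Function.Bijective.of_comp_iff _
    ((equivLY b).toLinearEquiv.rTensor (USo k r s)).bijective).1 hb

theorem bialgSo_mul_homLY (a : USo k r s) (g : (sysLY b).Prod) : bialgSo b a * homLY b g =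
    mulMap (homLY b) (bialgSo b) (((actLY b).flip g).rTensor (USo k r s) (comul a)) := by
  obtain ⟨q, rfl⟩ := (equivLY b).surjective g
  have h2 : (((actLY b).flip (equivLY b q)).rTensor (USo k r s) (comul a)) =
      (equivLY b).toLinearMap.rTensor (USo k r s)
        ((soAct.toLinearMap.flip q).rTensor (USo k r s) (comul a)) := by
    induction comul (R := k) a with
    | zero => simp
    | add _ _ h₁ h₂ => simp only [map_add, h₁, h₂]
    | tmul p d => simp [actLY_equivLY]
  rw [h2, mulMap_eq, ← homSo_mul_homT]
  rfl

end SystemSo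

/-! ### The action on the generators -/

section Values

variable {k : Type u} [Field k] [CharZero k] {r s : ℕ} {κ : Type v}
  (b : Module.Basis κ k (so (normalForm k r s)))

local notation "ι" => UniversalEnvelopingAlgebra.ι k

theorem tmul_one_eq (g : UL k r s) :
    (sysLY b).tmul g 1 = equivLY b ((twistData k r s).algK g) := rfl

theorem tmul_y_eq (g : UL k r s) (i : Fin r) : (sysLY b).tmul g (UY.y k r i) =
    equivLY b ((twistData k r s).algK g * twistY k r s i) := by
  have h : twistY k r s i = (twistData k r s).toAlg (1 ⊗ₜ UY.y k r i) := rfl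
  rw [h, TwistData.algK_mul, TwistData.leftOp_tmul, mul_one]
  rfl

theorem tmul_smul_left (c : k) (g : UL k r s) (a : UY k r) :
    (sysLY b).tmul (c • g) a = c • (sysLY b).tmul g a := rfl

theorem tmul_smul_right (c : k) (g : UL k r s) (a : UY k r) :
    (sysLY b).tmul g (c • a) = c • (sysLY b).tmul g a := TensorProduct.tmul_smul c g a

theorem actLY_m (M : so (normalForm k r s)) (p : TAlg k r s) :
    actLY b (USo.m M) (equivLY b p) = equivLY b (soDer M p) := by
  rw [actLY_equivLY, USo.m, soAct_ι]

theorem actLY_x₀ (M : so (normalForm k r s)) :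
    actLY b (USo.m M) ((sysLY b).tmul (UL.x₀ k r s) 1) = 0 := by
  rw [tmul_one_eq, actLY_m, soDer_x₀, map_zero]

theorem actLY_x (M : so (normalForm k r s)) (i : Fin r) :
    actLY b (USo.m M) ((sysLY b).tmul (UL.x k r s i) 1) =
      ∑ l, (sysLY b).tmul (-M.1 i l • UL.x k r s l) 1 := by
  simp only [tmul_smul_left]
  simp only [tmul_one_eq]
  rw [actLY_m, soDer_x, map_neg, map_sum, ← Finset.sum_neg_distrib]
  simp only [map_smul, neg_smul]

theorem actLY_y (M : so (normalForm k r s)) (j : Fin r) :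
    actLY b (USo.m M) ((sysLY b).tmul 1 (UY.y k r j)) =
      -∑ l, (sysLY b).tmul 1 (M.1 j l • UY.y k r l) := by
  simp only [tmul_smul_right]
  simp only [tmul_y_eq, map_one, one_mul]
  rw [actLY_m, soDer_y, map_neg, map_sum]
  simp only [map_smul]

theorem actLY_x_y (M : so (normalForm k r s)) (i j : Fin r) :
    actLY b (USo.m M) ((sysLY b).tmul (UL.x k r s i) (UY.y k r j)) =
      ∑ l, ((sysLY b).tmul (-M.1 i l • UL.x k r s l) (UY.y k r j) -
        (sysLY b).tmul (UL.x k r s i) (M.1 j l • UY.y k r l)) := by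
  simp only [tmul_smul_left, tmul_smul_right]
  simp only [tmul_y_eq]
  rw [actLY_m, soDer_mul, soDer_x, soDer_y, Finset.sum_sub_distrib, neg_mul, mul_neg,
    Finset.sum_mul, Finset.mul_sum]
  simp only [map_add, map_neg, map_sum, smul_mul_assoc, mul_smul_comm, map_smul, neg_smul,
    Finset.sum_neg_distrib]
  abel

theorem homLY_x₀ : homLY b ((sysLY b).tmul (UL.x₀ k r s) 1) = UM.gen _ b .x₀ := by
  rw [tmul_one_eq, homLY_equivLY, homT_algK, homL_x₀]

theorem homLY_x (i : Fin r) : homLY b ((sysLY b).tmul (UL.x k r s i) 1) = UM.gen _ b (.x i) := by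
  rw [tmul_one_eq, homLY_equivLY, homT_algK, homL_x]

theorem homLY_y (i : Fin r) : homLY b ((sysLY b).tmul 1 (UY.y k r i)) = UM.gen _ b (.y i) := by
  rw [tmul_y_eq, map_one, one_mul, homLY_equivLY, homT_twistY]

theorem bialgSo_m (j : κ) : bialgSo b (USo.m (b j)) = UM.gen _ b (.m j) := by
  change homSo b (ι (b j)) = _
  rw [homSo_ι, linSo_basis]

end Values

end Umbrella

theorem mainTheorem4 {k : Type*} [Field k] [CharZero k] (r s : ℕ) (hrs : 2 * s ≤ r)
    {ι : Type*} (b : Module.Basis ι k (Umbrella.so (Umbrella.normalForm k r s))) :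
    -- the crossed product `U(𝔏)^τ #_σ U(Y)`, with trivial action and coaction
    ∃ D₁ : Umbrella.CrossedSystem k (Umbrella.UL k r s) (Umbrella.UY k r),
      D₁.TrivialAction ∧ D₁.TrivialCoaction ∧
      (∀ i j : Fin r, D₁.σ (Umbrella.UY.y k r i) (Umbrella.UY.y k r j) =
        if ∃ p < s, i.val = 2 * p + 1 ∧ j.val = 2 * p
          then -((1 / 3 : k) • Umbrella.UL.x₀ k r s ^ 3) else 0) ∧
      (∀ i : Fin r, D₁.τ (Umbrella.UY.y k r i) =
        Umbrella.UL.x₀ k r s ⊗ₜ[k] Umbrella.UL.x k r s i -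
          Umbrella.UL.x k r s i ⊗ₜ[k] Umbrella.UL.x₀ k r s) ∧
    -- the crossed product `(U(𝔏)^τ #_σ U(Y)) # U(𝔰𝔬(B))`
    ∃ D₂ : Umbrella.CrossedSystem k D₁.Prod (Umbrella.USo k r s),
      D₂.TrivialCocycle ∧ D₂.TrivialCococycle ∧ D₂.TrivialCoaction ∧
      (∀ u v p, D₂.γ (u * v) p = D₂.γ u (D₂.γ v p)) ∧
      (∀ M : Umbrella.so (Umbrella.normalForm k r s),
        D₂.γ (Umbrella.USo.m M) (D₁.tmul (Umbrella.UL.x₀ k r s) 1) = 0 ∧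
        (∀ i : Fin r, D₂.γ (Umbrella.USo.m M) (D₁.tmul (Umbrella.UL.x k r s i) 1) =
          ∑ l, D₁.tmul (-M.1 i l • Umbrella.UL.x k r s l) 1) ∧
        (∀ j : Fin r, D₂.γ (Umbrella.USo.m M) (D₁.tmul 1 (Umbrella.UY.y k r j)) =
          -∑ l, D₁.tmul 1 (M.1 j l • Umbrella.UY.y k r l)) ∧
        ∀ i j : Fin r,
          D₂.γ (Umbrella.USo.m M) (D₁.tmul (Umbrella.UL.x k r s i) (Umbrella.UY.y k r j)) =
            ∑ l, (D₁.tmul (-M.1 i l • Umbrella.UL.x k r s l) (Umbrella.UY.y k r j) -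
              D₁.tmul (Umbrella.UL.x k r s i) (M.1 j l • Umbrella.UY.y k r l))) ∧
    -- the isomorphism of Hopf algebras
    ∃ e : Umbrella.UMrs k r s b ≃ₐc[k] D₂.Prod,
      e (Umbrella.UM.gen _ b .x₀) = D₂.tmul (D₁.tmul (Umbrella.UL.x₀ k r s) 1) 1 ∧
      (∀ i, e (Umbrella.UM.gen _ b (.x i)) = D₂.tmul (D₁.tmul (Umbrella.UL.x k r s i) 1) 1) ∧
      (∀ i, e (Umbrella.UM.gen _ b (.y i)) = D₂.tmul (D₁.tmul 1 (Umbrella.UY.y k r i)) 1) ∧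
      ∀ j, e (Umbrella.UM.gen _ b (.m j)) = D₂.tmul 1 (Umbrella.USo.m (b j)) := by
  have hmul := Umbrella.smashEquiv_mul _ _ (Umbrella.actLY_isWeakAction b)
    (Umbrella.bialgSo_mul_homLY b) (Umbrella.mulMap_bijective b)
  refine ⟨Umbrella.sysLY b, Umbrella.dataLY_trivialAction, Umbrella.dataLY_trivialCoaction,
    fun i j => ?_, fun i => Umbrella.tau_ι _,
    Umbrella.smashSystem _ _ (Umbrella.actLY_isWeakAction b) (Umbrella.bialgSo_mul_homLY b)
      (Umbrella.mulMap_bijective b),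
    Umbrella.smashData_trivialCocycle _, Umbrella.smashData_trivialCococycle _,
    Umbrella.smashData_trivialCoaction _, Umbrella.actLY_mul b,
    fun M => ⟨Umbrella.actLY_x₀ b M, Umbrella.actLY_x b M, Umbrella.actLY_y b M,
      Umbrella.actLY_x_y b M⟩,
    Umbrella.smashEquiv _ _ (Umbrella.actLY_isWeakAction b) (Umbrella.bialgSo_mul_homLY b)
      (Umbrella.mulMap_bijective b), ?_, fun i => ?_, fun i => ?_, fun j => ?_⟩
  · refine (Umbrella.twistData k r s).cocycle_ι _ _ |>.trans ?_
    refine (congrArg (· • _) (Umbrella.twistData_β_single i j)).trans ?_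
    rw [ite_smul, one_smul, zero_smul, Umbrella.twistData_lam]
  · rw [← hmul, map_one, mul_one, Umbrella.homLY_x₀]
  · rw [← hmul, map_one, mul_one, Umbrella.homLY_x]
  · rw [← hmul, map_one, mul_one, Umbrella.homLY_y]
  · rw [← hmul, map_one, one_mul, Umbrella.bialgSo_m]
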